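/- Let $A$ and $B$ be associative unital rings (algebras over a commutative base ring $k$ are included; $k$ plays no role). Let $\mathfrak C$ be an $A$-coring and $\mathfrak D$ a $B$-coring such that ${}_A\mathfrak C$, $\mathfrak C_A$, ${}_B\mathfrak D$, $\mathfrak D_B$ are flat. Let $X$ be a $\mathfrak C$-$\mathfrak D$-bicomodule and $\Lambda$ a $\mathfrak D$-$\mathfrak C$-bicomodule. Write $\mathcal M^{\mathfrak C}$ and ${}^{\mathfrak C}\mathcal M$ for the categories of right and left $\mathfrak C$-comodules. For a right $\mathfrak C$-comodule $M$ and a left $\mathfrak C$-comodule $N$, let $\omega_{M,N}=\rho_M\otimes_A N-M\otimes_A\lambda_N: M\otimes_A N\to M\otimes_A\mathfrak C\otimes_A N$, where $\rho_M,\lambda_N$ are the coactions, and let $M\square_{\mathfrak C}N=\ker\omega_{M,N}$ be the cotensor product; similarly over $\mathfrak D$. The comodule $\Lambda$ is quasi-finite as a right $\mathfrak C$-comodule if $-\otimes_B\Lambda:\mathcal M_B\to\mathcal M^{\mathfrak C}$ has a left adjoint; a left adjoint $\mathcal M^{\mathfrak C}\to\mathcal M^{\mathfrak D}$ of $-\square_{\mathfrak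 D}\Lambda$ is then denoted $h_{\mathfrak C}(\Lambda,-)$ (the co-hom functor). The right $\mathfrak D$-comodule $F(\mathfrak C)$, where $F=h_{\mathfrak C}(\Lambda,-)$, is a $\mathfrak C$-$\mathfrak D$-bicomodule: $a\in A$ acts on it by $F(c\mapsto ac)$, and its left coaction corresponds to $F(\Delta_{\mathfrak C}):F(\mathfrak C)\to F(\mathfrak C\otimes_A\mathfrak C)$ under the canonical isomorphism $\mathfrak C\otimes_A F(\mathfrak C)\cong F(\mathfrak C\otimes_A\mathfrak C)$, $c\otimes y\mapsto F(c'\mapsto c\otimes c')(y)$. A coring is coseparable if its comultiplication is a split monomorphism of bicomodules. A left (right) $\mathfrak C$-comodule $N$ is coflat if $-\square_{\mathfrak C}N$ (respectively $N\square_{\mathfrak C}-$) is exact on right (left) $\mathfrak C$-comodules. A map $f$ of left $A$-modules is pure if $Z\otimes_A-$ preserves the kernel of $f$ for every right $A$-module $Z$. Consider the following properties: (1) $-\square_{\mathfrak C}X:\mathcal M^{\mathfrak C}\to\mathcal M^{\mathfrak D}$ is left adjoint to $-\square_{\mathfrak D}\Lambda:\mathcal M^{\mathfrak D}\to\mathcal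 M^{\mathfrak C}$; (2) $\Lambda$ is quasi-finite as a right $\mathfrak C$-comodule and $-\square_{\mathfrak C}X\simeq h_{\mathfrak C}(\Lambda,-)$; (3) $\Lambda$ is quasi-finite as a right $\mathfrak C$-comodule and $X\simeq h_{\mathfrak C}(\Lambda,\mathfrak C)$ as $\mathfrak C$-$\mathfrak D$-bicomodules; (4) there exist bicolinear maps $\psi:\mathfrak C\to X\square_{\mathfrak D}\Lambda$ (of $\mathfrak C$-$\mathfrak C$-bicomodules) and $\omega:\Lambda\square_{\mathfrak C}X\to\mathfrak D$ (of $\mathfrak D$-$\mathfrak D$-bicomodules) such that $$(\omega\square_{\mathfrak D}\Lambda)\circ(\Lambda\square_{\mathfrak C}\psi)=\Lambda,\qquad (X\square_{\mathfrak D}\omega)\circ(\psi\square_{\mathfrak C}X)=X,$$ where $(\Lambda\square_{\mathfrak C}X)\square_{\mathfrak D}\Lambda$ and $\Lambda\square_{\mathfrak C}(X\square_{\mathfrak D}\Lambda)$ are compared inside $\Lambda\otimes_A X\otimes_B\Lambda$ (that is, for every $l\in\Lambda$ there is an element $w$ of the first module with the same image there as $(\Lambda\square_{\mathfrak C}\psi)(\rho_\Lambda(l))$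 and with $(\omega\square_{\mathfrak D}\Lambda)(w)=\lambda_\Lambda(l)$), and $(X\square_{\mathfrak D}\Lambda)\square_{\mathfrak C}X$ and $X\square_{\mathfrak D}(\Lambda\square_{\mathfrak C}X)$ are compared likewise inside $X\otimes_B\Lambda\otimes_A X$; (5) $\Lambda\square_{\mathfrak C}-:{}^{\mathfrak C}\mathcal M\to{}^{\mathfrak D}\mathcal M$ is left adjoint to $X\square_{\mathfrak D}-:{}^{\mathfrak D}\mathcal M\to{}^{\mathfrak C}\mathcal M$. Then: (a) (1) and (2) are equivalent, and they imply (3). If $\mathfrak C$ is coseparable, (3) implies (1) and (2). (b) Suppose that ${}_AX$ and ${}_B\Lambda$ are flat, $\omega_{X,\Lambda}:X\otimes_B\Lambda\to X\otimes_B\mathfrak D\otimes_B\Lambda$ is pure as a map of left $A$-modules and $\omega_{\Lambda,X}:\Lambda\otimes_A X\to\Lambda\otimes_A\mathfrak C\otimes_A X$ is pure as a map of left $B$-modules; or that $\mathfrak C$ and $\mathfrak D$ are coseparable. Then (4) implies (1). The flatness and purity assumptions hold if ${}_{\mathfrak C}X$ and ${}_{\mathfrak D}\Lambda$ are coflat,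 and also if $A$ and $B$ are von Neumann regular. (c) If ${}_{\mathfrak C}X$ and ${}_{\mathfrak D}\Lambda$ are coflat, or $A$ and $B$ are von Neumann regular, or $\mathfrak C$ and $\mathfrak D$ are coseparable, then (1) implies (4). (d) If $\mathfrak C$ and $\mathfrak D$ are coseparable, or $X$ and $\Lambda$ are coflat on both sides, or $A$ and $B$ are von Neumann regular, then (1), (4) and (5) are equivalent. -/

import Mathlib

universe u

open CategoryTheory MulOpposite

namespace Corings

noncomputable section

/-! ## The balanced tensor product over a noncommutative ring

Right `A`-modules are modules over `Aᵐᵒᵖ`. -/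

section Tensor

variable (A : Type u) [Ring A]

/-- The subgroup of `M ⊗_ℤ N` generated by the elements `(m a) ⊗ n - m ⊗ (a n)`. -/
def balancing (M N : Type u) [AddCommGroup M] [Module Aᵐᵒᵖ M] [AddCommGroup N] [Module A N] :
    AddSubgroup (TensorProduct ℤ M N) :=
  AddSubgroup.closure
    {t | ∃ (m : M) (a : A) (n : N),
      t = TensorProduct.tmul ℤ (op a • m) n - TensorProduct.tmul ℤ m (a • n)}

/-- The tensor product `M ⊗_A N` of a right `A`-module and a left `A`-module. -/
def BTensor (M N : Type u) [AddCommGroup M] [Module Aᵐᵒᵖ M] [AddCommGroup N] [Module A N] :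
    Type u :=
  TensorProduct ℤ M N ⧸ balancing A M N

variable {M M' M'' N N' N'' P : Type u}
  [AddCommGroup M] [Module Aᵐᵒᵖ M] [AddCommGroup M'] [Module Aᵐᵒᵖ M']
  [AddCommGroup M''] [Module Aᵐᵒᵖ M'']
  [AddCommGroup N] [Module A N] [AddCommGroup N'] [Module A N']
  [AddCommGroup N''] [Module A N''] [AddCommGroup P]

instance : AddCommGroup (BTensor A M N) :=
  inferInstanceAs (AddCommGroup (TensorProduct ℤ M N ⧸ balancing A M N))

namespace BTensor

/-- The pure tensor `m ⊗ n`. -/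
def tmul (m : M) (n : N) : BTensor A M N :=
  QuotientAddGroup.mk' (balancing A M N) (TensorProduct.tmul ℤ m n)

theorem add_tmul (m m' : M) (n : N) : tmul A (m + m') n = tmul A m n + tmul A m' n := by
  unfold tmul
  rw [TensorProduct.add_tmul]
  exact map_add (QuotientAddGroup.mk' (balancing A M N)) _ _

theorem tmul_add (m : M) (n n' : N) : tmul A m (n + n') = tmul A m n + tmul A m n' := by
  unfold tmul
  rw [TensorProduct.tmul_add]
  exact map_add (QuotientAddGroup.mk' (balancing A M N)) _ _

theorem smul_tmul (m : M) (a : A) (n : N) : tmul A (op a • m) n = tmul A m (a • n) := by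
  unfold tmul
  refine (QuotientAddGroup.eq_iff_sub_mem).2 ?_
  exact AddSubgroup.subset_closure ⟨m, a, n, rfl⟩

theorem zero_tmul (n : N) : tmul A (0 : M) n = 0 := by
  have h := add_tmul A (0 : M) 0 n
  simpa using h

theorem tmul_zero (m : M) : tmul A m (0 : N) = 0 := by
  have h := tmul_add A m (0 : N) 0
  simpa using h

variable {A}

@[elab_as_elim]
theorem induction_on {p : BTensor A M N → Prop} (t : BTensor A M N) (h0 : p 0)
    (ht : ∀ m n, p (tmul A m n)) (ha : ∀ x y, p x → p y → p (x + y)) : p t := by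
  obtain ⟨t, rfl⟩ := QuotientAddGroup.mk'_surjective (balancing A M N) t
  induction t with
  | zero => rw [map_zero]; exact h0
  | tmul m n => exact ht m n
  | add x y hx hy => rw [map_add]; exact ha _ _ hx hy

/-- The universal property of `M ⊗_A N`. -/
def lift (f : M → N → P) (hl : ∀ m m' n, f (m + m') n = f m n + f m' n)
    (hr : ∀ m n n', f m (n + n') = f m n + f m n')
    (hb : ∀ (m : M) (a : A) (n : N), f (op a • m) n = f m (a • n)) : BTensor A M N →+ P :=
  QuotientAddGroup.lift (balancing A M N)
    (TensorProduct.liftAddHom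
      (AddMonoidHom.mk' (fun m => AddMonoidHom.mk' (f m) (hr m))
        (fun m m' => AddMonoidHom.ext (hl m m')))
      (fun r m n => by
        simp only [map_zsmul, AddMonoidHom.coe_smul, Pi.smul_apply])) (by
    unfold balancing
    rw [AddSubgroup.closure_le]
    rintro _ ⟨m, a, n, rfl⟩
    simp only [SetLike.mem_coe, AddMonoidHom.mem_ker, map_sub, TensorProduct.liftAddHom_tmul,
      AddMonoidHom.mk'_apply, hb, sub_self])

@[simp]
theorem lift_tmul (f : M → N → P) (hl hr hb) (m : M) (n : N) :
    lift (A := A) f hl hr hb (tmul A m n) = f m n := rfl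

theorem hom_ext {f g : BTensor A M N →+ P} (h : ∀ m n, f (tmul A m n) = g (tmul A m n)) :
    f = g := by
  ext t
  induction t using induction_on with
  | h0 => simp
  | ht m n => exact h m n
  | ha x y hx hy => simp [hx, hy]

variable {S T : Type u} [Ring S] [Ring T]

section LeftModule

variable [Module S M] [SMulCommClass S Aᵐᵒᵖ M]

/-- `S` acts on the left of `M ⊗_A N` through `M`. -/
def lsmul (s : S) : BTensor A M N →+ BTensor A M N :=
  lift (fun m n => tmul A (s • m) n)
    (fun m m' n => by rw [smul_add, add_tmul])
    (fun m n n' => by rw [tmul_add])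
    (fun m a n => by rw [smul_comm, smul_tmul])

instance leftModule : Module S (BTensor A M N) where
  smul s t := lsmul s t
  one_smul t := by
    change lsmul (1 : S) t = t
    have : lsmul (A := A) (M := M) (N := N) (1 : S) = AddMonoidHom.id _ :=
      hom_ext fun m n => by simp [lsmul]
    rw [this]; rfl
  mul_smul s s' t := by
    change lsmul (s * s') t = lsmul s (lsmul s' t)
    have : lsmul (A := A) (M := M) (N := N) (s * s') = (lsmul s).comp (lsmul s') :=
      hom_ext fun m n => by simp [lsmul, mul_smul]
    rw [this]; rfl
  smul_zero s := map_zero (lsmul s)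
  smul_add s := map_add (lsmul s)
  add_smul s s' t := by
    change lsmul (s + s') t = lsmul s t + lsmul s' t
    have : lsmul (A := A) (M := M) (N := N) (s + s') = lsmul s + lsmul s' :=
      hom_ext fun m n => by simp [lsmul, add_smul, add_tmul]
    rw [this]; rfl
  zero_smul t := by
    change lsmul (0 : S) t = 0
    have : lsmul (A := A) (M := M) (N := N) (0 : S) = 0 :=
      hom_ext fun m n => by simp [lsmul, zero_tmul]
    rw [this]; rfl

theorem lsmul_tmul (s : S) (m : M) (n : N) : s • tmul A m n = tmul A (s • m) n := rfl

end LeftModule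

section RightModule

variable [Module Tᵐᵒᵖ N] [SMulCommClass A Tᵐᵒᵖ N]

/-- `T` acts on the right of `M ⊗_A N` through `N`. -/
def rsmul (s : Tᵐᵒᵖ) : BTensor A M N →+ BTensor A M N :=
  lift (fun m n => tmul A m (s • n))
    (fun m m' n => by rw [add_tmul])
    (fun m n n' => by rw [smul_add, tmul_add])
    (fun m a n => by rw [← smul_comm a s n, smul_tmul])

instance rightModule : Module Tᵐᵒᵖ (BTensor A M N) where
  smul s t := rsmul s t
  one_smul t := by
    change rsmul (1 : Tᵐᵒᵖ) t = t
    have : rsmul (A := A) (M := M) (N := N) (1 : Tᵐᵒᵖ) = AddMonoidHom.id _ :=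
      hom_ext fun m n => by simp [rsmul]
    rw [this]; rfl
  mul_smul s s' t := by
    change rsmul (s * s') t = rsmul s (rsmul s' t)
    have : rsmul (A := A) (M := M) (N := N) (s * s') = (rsmul s).comp (rsmul s') :=
      hom_ext fun m n => by simp [rsmul, mul_smul]
    rw [this]; rfl
  smul_zero s := map_zero (rsmul s)
  smul_add s := map_add (rsmul s)
  add_smul s s' t := by
    change rsmul (s + s') t = rsmul s t + rsmul s' t
    have : rsmul (A := A) (M := M) (N := N) (s + s') = rsmul s + rsmul s' :=
      hom_ext fun m n => by simp [rsmul, add_smul, tmul_add]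
    rw [this]; rfl
  zero_smul t := by
    change rsmul (0 : Tᵐᵒᵖ) t = 0
    have : rsmul (A := A) (M := M) (N := N) (0 : Tᵐᵒᵖ) = 0 :=
      hom_ext fun m n => by simp [rsmul, tmul_zero]
    rw [this]; rfl

theorem rsmul_tmul (s : Tᵐᵒᵖ) (m : M) (n : N) : s • tmul A m n = tmul A m (s • n) := rfl

instance [Module S M] [SMulCommClass S Aᵐᵒᵖ M] : SMulCommClass S Tᵐᵒᵖ (BTensor A M N) where
  smul_comm s s' t := by
    induction t using induction_on with
    | h0 => simp
    | ht m n => simp only [rsmul_tmul, lsmul_tmul]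
    | ha x y hx hy => simp only [smul_add, hx, hy]

end RightModule

/-- `f ⊗_A N`. -/
def rTensor (N : Type u) [AddCommGroup N] [Module A N] (f : M →ₗ[Aᵐᵒᵖ] M') :
    BTensor A M N →+ BTensor A M' N :=
  lift (fun m n => tmul A (f m) n)
    (fun m m' n => by rw [map_add, add_tmul])
    (fun m n n' => by rw [tmul_add])
    (fun m a n => by rw [map_smul, smul_tmul])

/-- `M ⊗_A g`. -/
def lTensor (M : Type u) [AddCommGroup M] [Module Aᵐᵒᵖ M] (g : N →ₗ[A] N') :
    BTensor A M N →+ BTensor A M N' :=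
  lift (fun m n => tmul A m (g n))
    (fun m m' n => by rw [add_tmul])
    (fun m n n' => by rw [map_add, tmul_add])
    (fun m a n => by rw [map_smul, smul_tmul])

@[simp]
theorem rTensor_tmul (f : M →ₗ[Aᵐᵒᵖ] M') (m : M) (n : N) :
    rTensor N f (tmul A m n) = tmul A (f m) n := rfl

@[simp]
theorem lTensor_tmul (g : N →ₗ[A] N') (m : M) (n : N) :
    lTensor M g (tmul A m n) = tmul A m (g n) := rfl

theorem rTensor_id_apply (t : BTensor A M N) : rTensor N (LinearMap.id (R := Aᵐᵒᵖ)) t = t :=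
  DFunLike.congr_fun (f := rTensor N (LinearMap.id (R := Aᵐᵒᵖ) (M := M)))
    (g := AddMonoidHom.id _) (hom_ext fun _ _ => rfl) t

theorem lTensor_id_apply (t : BTensor A M N) : lTensor M (LinearMap.id (R := A)) t = t :=
  DFunLike.congr_fun (f := lTensor M (LinearMap.id (R := A) (M := N)))
    (g := AddMonoidHom.id _) (hom_ext fun _ _ => rfl) t

theorem rTensor_comp_apply (g : M' →ₗ[Aᵐᵒᵖ] M'') (f : M →ₗ[Aᵐᵒᵖ] M') (t : BTensor A M N) :
    rTensor N (g.comp f) t = rTensor N g (rTensor N f t) :=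
  DFunLike.congr_fun (f := rTensor N (g.comp f))
    (g := (rTensor N g).comp (rTensor N f)) (hom_ext fun _ _ => rfl) t

theorem lTensor_comp_apply (g : N' →ₗ[A] N'') (f : N →ₗ[A] N') (t : BTensor A M N) :
    lTensor M (g.comp f) t = lTensor M g (lTensor M f t) :=
  DFunLike.congr_fun (f := lTensor M (g.comp f))
    (g := (lTensor M g).comp (lTensor M f)) (hom_ext fun _ _ => rfl) t

theorem rTensor_lTensor (f : M →ₗ[Aᵐᵒᵖ] M') (g : N →ₗ[A] N') (t : BTensor A M N) :
    rTensor N' f (lTensor M g t) = lTensor M' g (rTensor N f t) :=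
  DFunLike.congr_fun (f := (rTensor N' f).comp (lTensor M g))
    (g := (lTensor M' g).comp (rTensor N f)) (hom_ext fun _ _ => rfl) t

theorem rTensor_smul [Module Tᵐᵒᵖ N] [SMulCommClass A Tᵐᵒᵖ N] (f : M →ₗ[Aᵐᵒᵖ] M') (s : Tᵐᵒᵖ)
    (t : BTensor A M N) : rTensor N f (s • t) = s • rTensor N f t := by
  induction t using induction_on with
  | h0 => simp
  | ht m n => simp only [rsmul_tmul, rTensor_tmul]
  | ha x y hx hy => simp only [smul_add, map_add, hx, hy]

theorem lTensor_smul [Module S M] [SMulCommClass S Aᵐᵒᵖ M] (g : N →ₗ[A] N') (s : S)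
    (t : BTensor A M N) : lTensor M g (s • t) = s • lTensor M g t := by
  induction t using induction_on with
  | h0 => simp
  | ht m n => simp only [lsmul_tmul, lTensor_tmul]
  | ha x y hx hy => simp only [smul_add, map_add, hx, hy]

/-- `f ⊗_A N` is left `S`-linear if `f` is. -/
theorem rTensor_lsmul [Module S M] [SMulCommClass S Aᵐᵒᵖ M] [Module S M'] [SMulCommClass S Aᵐᵒᵖ M']
    (f : M →ₗ[Aᵐᵒᵖ] M') (hf : ∀ (s : S) m, f (s • m) = s • f m) (s : S)
    (t : BTensor A M N) : rTensor N f (s • t) = s • rTensor N f t := by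
  induction t using induction_on with
  | h0 => simp
  | ht m n => simp only [lsmul_tmul, rTensor_tmul, hf]
  | ha x y hx hy => simp only [smul_add, map_add, hx, hy]

/-- `M ⊗_A g` is right `T`-linear if `g` is. -/
theorem lTensor_rsmul [Module Tᵐᵒᵖ N] [SMulCommClass A Tᵐᵒᵖ N] [Module Tᵐᵒᵖ N']
    [SMulCommClass A Tᵐᵒᵖ N'] (g : N →ₗ[A] N') (hg : ∀ (s : Tᵐᵒᵖ) n, g (s • n) = s • g n)
    (s : Tᵐᵒᵖ) (t : BTensor A M N) : lTensor M g (s • t) = s • lTensor M g t := by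
  induction t using induction_on with
  | h0 => simp
  | ht m n => simp only [rsmul_tmul, lTensor_tmul, hg]
  | ha x y hx hy => simp only [smul_add, map_add, hx, hy]

section Assoc

variable (A) (B : Type u) [Ring B] (M) (Q P : Type u)
  [AddCommGroup Q] [Module A Q] [Module Bᵐᵒᵖ Q] [SMulCommClass A Bᵐᵒᵖ Q]
  [AddCommGroup P] [Module B P]

/-- `(M ⊗_A Q) ⊗_B P → M ⊗_A (Q ⊗_B P)`. -/
def assocHom : BTensor B (BTensor A M Q) P →+ BTensor A M (BTensor B Q P) :=
  lift (fun t p => lift (P := BTensor A M (BTensor B Q P)) (fun m q => tmul A m (tmul B q p))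
      (fun m m' n => by rw [add_tmul])
      (fun m n n' => by rw [add_tmul, tmul_add])
      (fun m a n => by rw [smul_tmul, lsmul_tmul]) t)
    (fun t t' p => map_add _ _ _)
    (fun t p p' => by
      induction t using induction_on with
      | h0 => simp
      | ht m n => simp only [lift_tmul, tmul_add]
      | ha x y hx hy => simp only [map_add, hx, hy]; abel)
    (fun t b p => by
      induction t using induction_on with
      | h0 => simp
      | ht m n => simp only [rsmul_tmul, lift_tmul, smul_tmul]
      | ha x y hx hy => simp only [smul_add, map_add, hx, hy])

/-- `M ⊗_A (Q ⊗_B P) → (M ⊗_A Q) ⊗_B P`. -/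
def assocInv : BTensor A M (BTensor B Q P) →+ BTensor B (BTensor A M Q) P :=
  lift (fun m t => lift (P := BTensor B (BTensor A M Q) P) (fun q p => tmul B (tmul A m q) p)
      (fun m m' n => by rw [tmul_add, add_tmul])
      (fun m n n' => by rw [tmul_add])
      (fun m a n => by rw [← rsmul_tmul, smul_tmul]) t)
    (fun m m' t => by
      induction t using induction_on with
      | h0 => simp
      | ht m n => simp only [lift_tmul, add_tmul]
      | ha x y hx hy => simp only [map_add, hx, hy]; abel)
    (fun m t t' => map_add _ _ _)
    (fun m a t => by
      induction t using induction_on with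
      | h0 => simp
      | ht q n => simp only [lsmul_tmul, lift_tmul, smul_tmul]
      | ha x y hx hy => simp only [smul_add, map_add, hx, hy])

/-- The associativity isomorphism `(M ⊗_A Q) ⊗_B P ≅ M ⊗_A (Q ⊗_B P)`. -/
def assoc : BTensor B (BTensor A M Q) P ≃+ BTensor A M (BTensor B Q P) :=
  AddMonoidHom.toAddEquiv (assocHom A M B Q P) (assocInv A M B Q P)
    (hom_ext fun t p => by
      induction t using induction_on with
      | h0 => simp [zero_tmul]
      | ht m q => rfl
      | ha x y hx hy => rw [add_tmul, map_add, map_add, hx, hy])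
    (hom_ext fun m t => by
      induction t using induction_on with
      | h0 => simp [tmul_zero]
      | ht m q => rfl
      | ha x y hx hy => rw [tmul_add, map_add, map_add, hx, hy])

@[simp]
theorem assoc_tmul (m : M) (q : Q) (p : P) :
    assoc A M B Q P (tmul B (tmul A m q) p) = tmul A m (tmul B q p) := rfl

@[simp]
theorem assoc_symm_tmul (m : M) (q : Q) (p : P) :
    (assoc A M B Q P).symm (tmul A m (tmul B q p)) = tmul B (tmul A m q) p := rfl

end Assoc

end BTensor

end Tensor

namespace BTensor

/-! ### Linear versions and naturality -/

section Linear

variable {A : Type u} [Ring A] {B : Type u} [Ring B] {S T : Type u} [Ring S] [Ring T]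

section

variable {M M' N N' : Type u}
  [AddCommGroup M] [Module Aᵐᵒᵖ M] [AddCommGroup M'] [Module Aᵐᵒᵖ M']
  [AddCommGroup N] [Module A N] [AddCommGroup N'] [Module A N']

/-- `f ⊗_A N` as a right `T`-linear map. -/
def rTensorLin (T : Type u) [Ring T] (N : Type u) [AddCommGroup N] [Module A N] [Module Tᵐᵒᵖ N]
    [SMulCommClass A Tᵐᵒᵖ N] (f : M →ₗ[Aᵐᵒᵖ] M') : BTensor A M N →ₗ[Tᵐᵒᵖ] BTensor A M' N where
  toFun := rTensor N f
  map_add' := map_add _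
  map_smul' := rTensor_smul f

/-- `M ⊗_A g` as a left `S`-linear map. -/
def lTensorLin (S : Type u) [Ring S] (M : Type u) [AddCommGroup M] [Module Aᵐᵒᵖ M] [Module S M]
    [SMulCommClass S Aᵐᵒᵖ M] (g : N →ₗ[A] N') : BTensor A M N →ₗ[S] BTensor A M N' where
  toFun := lTensor M g
  map_add' := map_add _
  map_smul' := lTensor_smul g

@[simp]
theorem rTensorLin_apply [Module Tᵐᵒᵖ N] [SMulCommClass A Tᵐᵒᵖ N] (f : M →ₗ[Aᵐᵒᵖ] M')
    (t : BTensor A M N) : rTensorLin T N f t = rTensor N f t := rfl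

@[simp]
theorem lTensorLin_apply [Module S M] [SMulCommClass S Aᵐᵒᵖ M] (g : N →ₗ[A] N')
    (t : BTensor A M N) : lTensorLin S M g t = lTensor M g t := rfl

/-- `n ↦ m ⊗ n` as a right `T`-linear map. -/
def tmulL (T : Type u) [Ring T] (N : Type u) [AddCommGroup N] [Module A N] [Module Tᵐᵒᵖ N]
    [SMulCommClass A Tᵐᵒᵖ N] (m : M) : N →ₗ[Tᵐᵒᵖ] BTensor A M N where
  toFun n := tmul A m n
  map_add' := tmul_add A m
  map_smul' _ _ := rfl

/-- `m ↦ m ⊗ n` as a left `S`-linear map. -/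
def tmulR (S : Type u) [Ring S] (M : Type u) [AddCommGroup M] [Module Aᵐᵒᵖ M] [Module S M]
    [SMulCommClass S Aᵐᵒᵖ M] (n : N) : M →ₗ[S] BTensor A M N where
  toFun m := tmul A m n
  map_add' m m' := add_tmul A m m' n
  map_smul' _ _ := rfl

@[simp]
theorem tmulL_apply [Module Tᵐᵒᵖ N] [SMulCommClass A Tᵐᵒᵖ N] (m : M) (n : N) :
    tmulL (A := A) T N m n = tmul A m n := rfl

@[simp]
theorem tmulR_apply [Module S M] [SMulCommClass S Aᵐᵒᵖ M] (m : M) (n : N) :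
    tmulR (A := A) S M n m = tmul A m n := rfl

theorem rTensor_add_apply (f g : M →ₗ[Aᵐᵒᵖ] M') (t : BTensor A M N) :
    rTensor N (f + g) t = rTensor N f t + rTensor N g t :=
  DFunLike.congr_fun (f := rTensor N (f + g)) (g := rTensor N f + rTensor N g)
    (hom_ext fun m n => by simp [add_tmul]) t

theorem lTensor_add_apply (f g : N →ₗ[A] N') (t : BTensor A M N) :
    lTensor M (f + g) t = lTensor M f t + lTensor M g t :=
  DFunLike.congr_fun (f := lTensor M (f + g)) (g := lTensor M f + lTensor M g)
    (hom_ext fun m n => by simp [tmul_add]) t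

theorem rTensor_sub_apply (f g : M →ₗ[Aᵐᵒᵖ] M') (t : BTensor A M N) :
    rTensor N (f - g) t = rTensor N f t - rTensor N g t := by
  rw [eq_sub_iff_add_eq, ← rTensor_add_apply, sub_add_cancel]

theorem lTensor_sub_apply (f g : N →ₗ[A] N') (t : BTensor A M N) :
    lTensor M (f - g) t = lTensor M f t - lTensor M g t := by
  rw [eq_sub_iff_add_eq, ← lTensor_add_apply, sub_add_cancel]

theorem rTensor_zero_apply (t : BTensor A M N) :
    rTensor N (0 : M →ₗ[Aᵐᵒᵖ] M') t = 0 :=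
  DFunLike.congr_fun (f := rTensor N (0 : M →ₗ[Aᵐᵒᵖ] M')) (g := 0)
    (hom_ext fun m n => by simp [zero_tmul]) t

theorem lTensor_zero_apply (t : BTensor A M N) :
    lTensor M (0 : N →ₗ[A] N') t = 0 :=
  DFunLike.congr_fun (f := lTensor M (0 : N →ₗ[A] N')) (g := 0)
    (hom_ext fun m n => by simp [tmul_zero]) t

end

section AssocNat

variable {M M' Q Q' P P' : Type u}
  [AddCommGroup M] [Module Aᵐᵒᵖ M] [AddCommGroup M'] [Module Aᵐᵒᵖ M']
  [AddCommGroup Q] [Module A Q] [Module Bᵐᵒᵖ Q] [SMulCommClass A Bᵐᵒᵖ Q]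
  [AddCommGroup Q'] [Module A Q'] [Module Bᵐᵒᵖ Q'] [SMulCommClass A Bᵐᵒᵖ Q']
  [AddCommGroup P] [Module B P] [AddCommGroup P'] [Module B P']

theorem hom_ext₃ {R : Type u} [AddCommGroup R] {f g : BTensor B (BTensor A M Q) P →+ R}
    (h : ∀ m q p, f (tmul B (tmul A m q) p) = g (tmul B (tmul A m q) p)) : f = g :=
  hom_ext fun t p => by
    induction t using induction_on with
    | h0 => simp [zero_tmul]
    | ht m q => exact h m q p
    | ha x y hx hy => rw [add_tmul, map_add, map_add, hx, hy]

theorem assoc_rTensor_rTensor (f : M →ₗ[Aᵐᵒᵖ] M') (t : BTensor B (BTensor A M Q) P) :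
    assoc A M' B Q P (rTensor P (rTensorLin B Q f) t) =
      rTensor (BTensor B Q P) f (assoc A M B Q P t) :=
  DFunLike.congr_fun
    (f := (assoc A M' B Q P).toAddMonoidHom.comp (rTensor P (rTensorLin B Q f)))
    (g := (rTensor (BTensor B Q P) f).comp (assoc A M B Q P).toAddMonoidHom)
    (hom_ext₃ fun _ _ _ => rfl) t

theorem assoc_lTensor (g : P →ₗ[B] P') (t : BTensor B (BTensor A M Q) P) :
    assoc A M B Q P' (lTensor (BTensor A M Q) g t) =
      lTensor M (lTensorLin A Q g) (assoc A M B Q P t) :=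
  DFunLike.congr_fun
    (f := (assoc A M B Q P').toAddMonoidHom.comp (lTensor (BTensor A M Q) g))
    (g := (lTensor M (lTensorLin A Q g)).comp (assoc A M B Q P).toAddMonoidHom)
    (hom_ext₃ fun _ _ _ => rfl) t

theorem assoc_symm_eq (m : M) (t : BTensor B Q P) :
    (assoc A M B Q P).symm (tmul A m t) = rTensor P (tmulL B Q m) t := by
  rw [AddEquiv.symm_apply_eq]
  induction t using induction_on with
  | h0 => simp [tmul_zero]
  | ht q p => rfl
  | ha x y hx hy => rw [tmul_add, map_add, map_add, ← hx, ← hy]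

theorem assoc_tmul_eq (t : BTensor A M Q) (p : P) :
    assoc A M B Q P (tmul B t p) = lTensor M (tmulR A Q p) t := by
  induction t using induction_on with
  | h0 => simp [zero_tmul]
  | ht q p => rfl
  | ha x y hx hy => rw [add_tmul, map_add, map_add, ← hx, ← hy]

theorem assoc_rsmul [Module Tᵐᵒᵖ P] [SMulCommClass B Tᵐᵒᵖ P] (s : Tᵐᵒᵖ)
    (t : BTensor B (BTensor A M Q) P) : assoc A M B Q P (s • t) = s • assoc A M B Q P t :=
  DFunLike.congr_fun
    (f := (assoc A M B Q P).toAddMonoidHom.comp (DistribSMul.toAddMonoidHom _ s))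
    (g := (DistribSMul.toAddMonoidHom _ s).comp (assoc A M B Q P).toAddMonoidHom)
    (hom_ext₃ fun _ _ _ => rfl) t

theorem assoc_lsmul [Module S M] [SMulCommClass S Aᵐᵒᵖ M] (s : S)
    (t : BTensor B (BTensor A M Q) P) : assoc A M B Q P (s • t) = s • assoc A M B Q P t :=
  DFunLike.congr_fun
    (f := (assoc A M B Q P).toAddMonoidHom.comp (DistribSMul.toAddMonoidHom _ s))
    (g := (DistribSMul.toAddMonoidHom _ s).comp (assoc A M B Q P).toAddMonoidHom)
    (hom_ext₃ fun _ _ _ => rfl) t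

theorem assoc_symm_rsmul [Module Tᵐᵒᵖ P] [SMulCommClass B Tᵐᵒᵖ P] (s : Tᵐᵒᵖ)
    (t : BTensor A M (BTensor B Q P)) :
    (assoc A M B Q P).symm (s • t) = s • (assoc A M B Q P).symm t := by
  rw [AddEquiv.symm_apply_eq, assoc_rsmul, AddEquiv.apply_symm_apply]

theorem assoc_symm_lsmul [Module S M] [SMulCommClass S Aᵐᵒᵖ M] (s : S)
    (t : BTensor A M (BTensor B Q P)) :
    (assoc A M B Q P).symm (s • t) = s • (assoc A M B Q P).symm t := by
  rw [AddEquiv.symm_apply_eq, assoc_lsmul, AddEquiv.apply_symm_apply]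

end AssocNat

end Linear

end BTensor

open BTensor

/-! ## Flatness, purity, von Neumann regularity -/

/-- The left `A`-module `N` is flat: `- ⊗_A N` is exact on right `A`-modules. -/
class LFlat (A : Type u) [Ring A] (N : Type u) [AddCommGroup N] [Module A N] : Prop where
  exact : ∀ {M M' M'' : Type u} [AddCommGroup M] [Module Aᵐᵒᵖ M] [AddCommGroup M']
    [Module Aᵐᵒᵖ M'] [AddCommGroup M''] [Module Aᵐᵒᵖ M''] (f : M →ₗ[Aᵐᵒᵖ] M')
    (g : M' →ₗ[Aᵐᵒᵖ] M''), Function.Exact f g → Function.Exact (rTensor N f) (rTensor N g)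

/-- The right `A`-module `M` is flat: `M ⊗_A -` is exact on left `A`-modules. -/
class RFlat (A : Type u) [Ring A] (M : Type u) [AddCommGroup M] [Module Aᵐᵒᵖ M] : Prop where
  exact : ∀ {N N' N'' : Type u} [AddCommGroup N] [Module A N] [AddCommGroup N']
    [Module A N'] [AddCommGroup N''] [Module A N''] (f : N →ₗ[A] N')
    (g : N' →ₗ[A] N''), Function.Exact f g → Function.Exact (lTensor M f) (lTensor M g)

/-- A map of left `A`-modules is pure if, for every right `A`-module `Z`, the functor `Z ⊗_A -`
preserves its kernel. -/
def LPure {A : Type u} [Ring A] {N N' : Type u} [AddCommGroup N] [Module A N] [AddCommGroup N']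
    [Module A N'] (f : N →ₗ[A] N') : Prop :=
  ∀ (Z : Type u) [AddCommGroup Z] [Module Aᵐᵒᵖ Z],
    Function.Injective (lTensor Z (LinearMap.ker f).subtype) ∧
    Function.Exact (lTensor Z (LinearMap.ker f).subtype) (lTensor Z f)

/-- Von Neumann regular rings. -/
def VonNeumannRegular (A : Type u) [Ring A] : Prop :=
  ∀ a : A, ∃ b : A, a * b * a = a

theorem LFlat.injective {A : Type u} [Ring A] (N : Type u) [AddCommGroup N] [Module A N]
    [LFlat A N] {M M' : Type u} [AddCommGroup M] [Module Aᵐᵒᵖ M] [AddCommGroup M']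
    [Module Aᵐᵒᵖ M'] (f : M →ₗ[Aᵐᵒᵖ] M') (hf : Function.Injective f) :
    Function.Injective (rTensor N f) := by
  have h : Function.Exact (0 : M →ₗ[Aᵐᵒᵖ] M) f := by
    intro m
    constructor
    · intro hm
      exact ⟨0, by simpa using (hf (by simpa using hm)).symm⟩
    · rintro ⟨x, rfl⟩
      simp
  have h' := LFlat.exact (N := N) _ _ h
  rw [injective_iff_map_eq_zero]
  intro t ht
  obtain ⟨s, rfl⟩ := (h' t).1 ht
  exact rTensor_zero_apply s

theorem RFlat.injective {A : Type u} [Ring A] (M : Type u) [AddCommGroup M] [Module Aᵐᵒᵖ M]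
    [RFlat A M] {N N' : Type u} [AddCommGroup N] [Module A N] [AddCommGroup N']
    [Module A N'] (f : N →ₗ[A] N') (hf : Function.Injective f) :
    Function.Injective (lTensor M f) := by
  have h : Function.Exact (0 : N →ₗ[A] N) f := by
    intro m
    constructor
    · intro hm
      exact ⟨0, by simpa using (hf (by simpa using hm)).symm⟩
    · rintro ⟨x, rfl⟩
      simp
  have h' := RFlat.exact (M := M) _ _ h
  rw [injective_iff_map_eq_zero]
  intro t ht
  obtain ⟨s, rfl⟩ := (h' t).1 ht
  exact lTensor_zero_apply s

/-! ## Corings and comodules -/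

/-- An `A`-coring: an `A`-bimodule with a coassociative and counital pair of bimodule maps
`Δ : C → C ⊗_A C` and `ε : C → A`. -/
structure Coring (A : Type u) [Ring A] where
  carrier : Type u
  [addCommGroup : AddCommGroup carrier]
  [leftModule : Module A carrier]
  [rightModule : Module Aᵐᵒᵖ carrier]
  [smulComm : SMulCommClass A Aᵐᵒᵖ carrier]
  comul : carrier →ₗ[A] BTensor A carrier carrier
  comul_rsmul : ∀ (a : Aᵐᵒᵖ) (c : carrier), comul (a • c) = a • comul c
  counit : carrier →ₗ[A] A
  counit_rsmul : ∀ (a : Aᵐᵒᵖ) (c : carrier), counit (a • c) = a • counit c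
  coassoc : ∀ c : carrier, lTensor carrier comul (comul c) =
    assoc A carrier A carrier carrier (rTensor carrier
      { toFun := comul, map_add' := comul.map_add, map_smul' := comul_rsmul } (comul c))
  counit_left : ∀ c : carrier, rTensor carrier
      { toFun := counit, map_add' := counit.map_add, map_smul' := counit_rsmul } (comul c) =
    tmul A (1 : A) c
  counit_right : ∀ c : carrier, lTensor carrier counit (comul c) = tmul A c (1 : A)

namespace Coring

variable {A : Type u} [Ring A]

instance : CoeSort (Coring A) (Type u) := ⟨Coring.carrier⟩

attribute [instance] addCommGroup leftModule rightModule smulComm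

/-- `Δ` as a right linear map. -/
def comulR (C : Coring A) : C →ₗ[Aᵐᵒᵖ] BTensor A C C where
  toFun := C.comul
  map_add' := C.comul.map_add
  map_smul' := C.comul_rsmul

/-- `ε` as a right linear map. -/
def counitR (C : Coring A) : C →ₗ[Aᵐᵒᵖ] A where
  toFun := C.counit
  map_add' := C.counit.map_add
  map_smul' := C.counit_rsmul

end Coring

section Comodules

variable {A : Type u} [Ring A] {B : Type u} [Ring B]

/-- A right `C`-comodule structure on a right `A`-module `M`. -/
class RComodule (C : Coring A) (M : Type u) [AddCommGroup M] [Module Aᵐᵒᵖ M] where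
  coact : M →ₗ[Aᵐᵒᵖ] BTensor A M C
  coassoc : ∀ m : M, lTensor M C.comul (coact m) = assoc A M A C C (rTensor C coact (coact m))
  counit : ∀ m : M, lTensor M C.counit (coact m) = tmul A m (1 : A)

/-- A left `C`-comodule structure on a left `A`-module `N`. -/
class LComodule (C : Coring A) (N : Type u) [AddCommGroup N] [Module A N] where
  coact : N →ₗ[A] BTensor A C N
  coassoc : ∀ n : N, assoc A C A C N (rTensor N C.comulR (coact n)) = lTensor C coact (coact n)
  counit : ∀ n : N, rTensor N C.counitR (coact n) = tmul A (1 : A) n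

/-- The coaction `ρ : M → M ⊗_A C` of a right comodule. -/
def rho (C : Coring A) {M : Type u} [AddCommGroup M] [Module Aᵐᵒᵖ M] [RComodule C M] :
    M →ₗ[Aᵐᵒᵖ] BTensor A M C := RComodule.coact

/-- The coaction `λ : N → C ⊗_A N` of a left comodule. -/
def lam (C : Coring A) {N : Type u} [AddCommGroup N] [Module A N] [LComodule C N] :
    N →ₗ[A] BTensor A C N := LComodule.coact

/-- The right coaction of `M` is left `S`-linear. -/
class RCoactLin (C : Coring A) (S : Type u) [Ring S] (M : Type u) [AddCommGroup M]
    [Module Aᵐᵒᵖ M] [RComodule C M] [Module S M] [SMulCommClass S Aᵐᵒᵖ M] : Prop where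
  rho_smul : ∀ (s : S) (m : M), rho C (s • m) = s • rho C m

/-- The left coaction of `N` is right `T`-linear. -/
class LCoactLin (C : Coring A) (T : Type u) [Ring T] (N : Type u) [AddCommGroup N]
    [Module A N] [LComodule C N] [Module Tᵐᵒᵖ N] [SMulCommClass A Tᵐᵒᵖ N] : Prop where
  lam_smul : ∀ (t : Tᵐᵒᵖ) (n : N), lam C (t • n) = t • lam C n

/-- `ρ` as a left `S`-linear map. -/
def rhoLin (C : Coring A) (S : Type u) [Ring S] {M : Type u} [AddCommGroup M]
    [Module Aᵐᵒᵖ M] [RComodule C M] [Module S M] [SMulCommClass S Aᵐᵒᵖ M] [RCoactLin C S M] :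
    M →ₗ[S] BTensor A M C where
  toFun := rho C
  map_add' := (rho C).map_add
  map_smul' := RCoactLin.rho_smul

/-- `λ` as a right `T`-linear map. -/
def lamLin (C : Coring A) (T : Type u) [Ring T] {N : Type u} [AddCommGroup N]
    [Module A N] [LComodule C N] [Module Tᵐᵒᵖ N] [SMulCommClass A Tᵐᵒᵖ N] [LCoactLin C T N] :
    N →ₗ[Tᵐᵒᵖ] BTensor A C N where
  toFun := lam C
  map_add' := (lam C).map_add
  map_smul' := LCoactLin.lam_smul

/-- The regular right comodule. -/
instance (C : Coring A) : RComodule C C where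
  coact := C.comulR
  coassoc := C.coassoc
  counit := C.counit_right

/-- The regular left comodule. -/
instance (C : Coring A) : LComodule C C where
  coact := C.comul
  coassoc c := (C.coassoc c).symm
  counit := C.counit_left

instance (C : Coring A) : RCoactLin C A C := ⟨C.comul.map_smul⟩

instance (C : Coring A) : LCoactLin C A C := ⟨C.comul_rsmul⟩

/-- Morphisms of right comodules. -/
structure RComodHom (C : Coring A) (M M' : Type u) [AddCommGroup M] [Module Aᵐᵒᵖ M]
    [RComodule C M] [AddCommGroup M'] [Module Aᵐᵒᵖ M'] [RComodule C M'] where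
  lin : M →ₗ[Aᵐᵒᵖ] M'
  colin : ∀ m, rTensor C lin (rho C m) = rho C (lin m)

/-- Morphisms of left comodules. -/
structure LComodHom (C : Coring A) (N N' : Type u) [AddCommGroup N] [Module A N]
    [LComodule C N] [AddCommGroup N'] [Module A N'] [LComodule C N'] where
  lin : N →ₗ[A] N'
  colin : ∀ n, lTensor C lin (lam C n) = lam C (lin n)

@[ext]
theorem RComodHom.ext {C : Coring A} {M M' : Type u} [AddCommGroup M] [Module Aᵐᵒᵖ M]
    [RComodule C M] [AddCommGroup M'] [Module Aᵐᵒᵖ M'] [RComodule C M']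
    {f g : RComodHom C M M'} (h : ∀ m, f.lin m = g.lin m) : f = g := by
  cases f; cases g
  congr
  exact LinearMap.ext h

@[ext]
theorem LComodHom.ext {C : Coring A} {N N' : Type u} [AddCommGroup N] [Module A N]
    [LComodule C N] [AddCommGroup N'] [Module A N'] [LComodule C N']
    {f g : LComodHom C N N'} (h : ∀ m, f.lin m = g.lin m) : f = g := by
  cases f; cases g
  congr
  exact LinearMap.ext h

/-- The category `M^C` of right comodules. -/
structure RComod (C : Coring A) where
  carrier : Type u
  [addCommGroup : AddCommGroup carrier]
  [module : Module Aᵐᵒᵖ carrier]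
  [comodule : RComodule C carrier]

/-- The category `^C M` of left comodules. -/
structure LComod (C : Coring A) where
  carrier : Type u
  [addCommGroup : AddCommGroup carrier]
  [module : Module A carrier]
  [comodule : LComodule C carrier]

attribute [instance] RComod.addCommGroup RComod.module RComod.comodule
attribute [instance] LComod.addCommGroup LComod.module LComod.comodule

instance (C : Coring A) : CoeSort (RComod C) (Type u) := ⟨RComod.carrier⟩

instance (C : Coring A) : CoeSort (LComod C) (Type u) := ⟨LComod.carrier⟩

instance (C : Coring A) : Category (RComod C) where
  Hom M N := RComodHom C M N
  id M := ⟨LinearMap.id, fun m => rTensor_id_apply _⟩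
  comp f g := ⟨g.lin.comp f.lin, fun m => by
    rw [rTensor_comp_apply, f.colin, g.colin]; rfl⟩

instance (C : Coring A) : Category (LComod C) where
  Hom M N := LComodHom C M N
  id M := ⟨LinearMap.id, fun m => lTensor_id_apply _⟩
  comp f g := ⟨g.lin.comp f.lin, fun m => by
    rw [lTensor_comp_apply, f.colin, g.colin]; rfl⟩

/-- A `C`-`D`-bicomodule: an `A`-`B`-bimodule with a left `C`-coaction and a right `D`-coaction
such that the right coaction is a morphism of left `C`-comodules (equivalently, the left coaction
is a morphism of right `D`-comodules). -/
structure Bicomod (C : Coring A) (D : Coring B) where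
  carrier : Type u
  [addCommGroup : AddCommGroup carrier]
  [leftModule : Module A carrier]
  [rightModule : Module Bᵐᵒᵖ carrier]
  [smulComm : SMulCommClass A Bᵐᵒᵖ carrier]
  [lcomodule : LComodule C carrier]
  [rcomodule : RComodule D carrier]
  [lcoactLin : LCoactLin C B carrier]
  [rcoactLin : RCoactLin D A carrier]
  compat : ∀ x : carrier,
    assoc A C B carrier D (rTensor D (lamLin C B) (rho D x)) = lTensor C (rhoLin D A) (lam C x)

instance (C : Coring A) (D : Coring B) : CoeSort (Bicomod C D) (Type u) := ⟨Bicomod.carrier⟩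

attribute [instance] Bicomod.addCommGroup Bicomod.leftModule Bicomod.rightModule
  Bicomod.smulComm Bicomod.lcomodule Bicomod.rcomodule Bicomod.lcoactLin Bicomod.rcoactLin

/-! ### Comodule structures on tensor products -/

section TensorComodule

/-- `M ⊗_A N` is a right `D`-comodule with coaction `M ⊗_A ρ_N`, for a right `A`-module `M` and a
right `D`-comodule `N` on which `A` acts by comodule maps. -/
instance tensorRComodule (D : Coring B) (M N : Type u) [AddCommGroup M] [Module Aᵐᵒᵖ M]
    [AddCommGroup N] [Module A N] [Module Bᵐᵒᵖ N] [SMulCommClass A Bᵐᵒᵖ N] [RComodule D N]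
    [RCoactLin D A N] : RComodule D (BTensor A M N) :=
  let r : BTensor A M N →ₗ[Bᵐᵒᵖ] BTensor B (BTensor A M N) D :=
    { toFun := fun t => (assoc A M B N D).symm (lTensor M (rhoLin D A) t)
      map_add' := fun t t' => by rw [map_add, map_add]
      map_smul' := fun s t => by
        rw [lTensor_rsmul (rhoLin D A) (fun s n => (rho D).map_smul s n), assoc_symm_rsmul]; rfl }
  have hr : ∀ m n, r (tmul A m n) = rTensor D (tmulL B N m) (rho D n) := fun m n =>
    assoc_symm_eq m _
  { coact := r
    coassoc := fun t => by
      induction t using induction_on with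
      | h0 => simp
      | ht m n =>
        rw [hr, ← rTensor_lTensor]
        have h := RComodule.coassoc (C := D) n
        change lTensor N D.comul (rho D n) = assoc B N B D D (rTensor D (rho D) (rho D n)) at h
        rw [h, ← assoc_rTensor_rTensor, ← rTensor_comp_apply, ← rTensor_comp_apply]
        congr 2
      | ha x y hx hy => simp only [map_add, hx, hy]
    counit := fun t => by
      induction t using induction_on with
      | h0 => simp [zero_tmul]
      | ht m n =>
        rw [hr, ← rTensor_lTensor]
        have h := RComodule.counit (C := D) n
        change lTensor N D.counit (rho D n) = _ at h
        rw [h]; rfl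
      | ha x y hx hy => simp only [map_add, hx, hy, add_tmul] }

theorem rho_tmul (D : Coring B) {M N : Type u} [AddCommGroup M] [Module Aᵐᵒᵖ M]
    [AddCommGroup N] [Module A N] [Module Bᵐᵒᵖ N] [SMulCommClass A Bᵐᵒᵖ N] [RComodule D N]
    [RCoactLin D A N] (m : M) (n : N) :
    rho D (tmul A m n) = rTensor D (tmulL B N m) (rho D n) :=
  assoc_symm_eq m _

instance (D : Coring B) (S : Type u) [Ring S] (M N : Type u) [AddCommGroup M] [Module Aᵐᵒᵖ M]
    [Module S M] [SMulCommClass S Aᵐᵒᵖ M]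
    [AddCommGroup N] [Module A N] [Module Bᵐᵒᵖ N] [SMulCommClass A Bᵐᵒᵖ N] [RComodule D N]
    [RCoactLin D A N] : RCoactLin D S (BTensor A M N) where
  rho_smul s t := by
    change (assoc A M B N D).symm (lTensor M (rhoLin D A) (s • t)) =
      s • (assoc A M B N D).symm (lTensor M (rhoLin D A) t)
    rw [lTensor_smul, assoc_symm_lsmul]

/-- `M ⊗_A N` is a left `D`-comodule with coaction `λ_M ⊗_A N`, for a left `D`-comodule `M` on
which `A` acts on the right by comodule maps and a left `A`-module `N`. -/
instance tensorLComodule (D : Coring B) (M N : Type u) [AddCommGroup M] [Module B M]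
    [Module Aᵐᵒᵖ M] [SMulCommClass B Aᵐᵒᵖ M] [LComodule D M] [LCoactLin D A M]
    [AddCommGroup N] [Module A N] : LComodule D (BTensor A M N) :=
  let r : BTensor A M N →ₗ[B] BTensor B D (BTensor A M N) :=
    { toFun := fun t => assoc B D A M N (rTensor N (lamLin D A) t)
      map_add' := fun t t' => by rw [map_add, map_add]
      map_smul' := fun s t => by
        rw [rTensor_lsmul (lamLin D A) (fun s n => (lam D).map_smul s n), assoc_lsmul]; rfl }
  have hr : ∀ m n, r (tmul A m n) = lTensor D (tmulR B M n) (lam D m) := fun m n =>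
    assoc_tmul_eq _ n
  { coact := r
    coassoc := fun t => by
      induction t using induction_on with
      | h0 => simp
      | ht m n =>
        rw [hr, rTensor_lTensor]
        have h := LComodule.coassoc (C := D) m
        change assoc B D B D M (rTensor M D.comulR (lam D m)) = lTensor D (lam D) (lam D m) at h
        rw [assoc_lTensor, h, ← lTensor_comp_apply, ← lTensor_comp_apply]
        congr 2
      | ha x y hx hy => simp only [map_add, hx, hy]
    counit := fun t => by
      induction t using induction_on with
      | h0 => simp [tmul_zero]
      | ht m n =>
        rw [hr, rTensor_lTensor]
        have h := LComodule.counit (C := D) m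
        change rTensor M D.counitR (lam D m) = _ at h
        rw [h]; rfl
      | ha x y hx hy => simp only [map_add, hx, hy, tmul_add] }

theorem lam_tmul (D : Coring B) {M N : Type u} [AddCommGroup M] [Module B M]
    [Module Aᵐᵒᵖ M] [SMulCommClass B Aᵐᵒᵖ M] [LComodule D M] [LCoactLin D A M]
    [AddCommGroup N] [Module A N] (m : M) (n : N) :
    lam D (tmul A m n) = lTensor D (tmulR B M n) (lam D m) :=
  assoc_tmul_eq _ n

instance (D : Coring B) (T : Type u) [Ring T] (M N : Type u) [AddCommGroup M] [Module B M]
    [Module Aᵐᵒᵖ M] [SMulCommClass B Aᵐᵒᵖ M] [LComodule D M] [LCoactLin D A M]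
    [AddCommGroup N] [Module A N] [Module Tᵐᵒᵖ N] [SMulCommClass A Tᵐᵒᵖ N] :
    LCoactLin D T (BTensor A M N) where
  lam_smul s t := by
    change assoc B D A M N (rTensor N (lamLin D A) (s • t)) =
      s • assoc B D A M N (rTensor N (lamLin D A) t)
    rw [rTensor_smul, assoc_rsmul]

end TensorComodule

/-! ### Subcomodules over flat corings -/

theorem tmul_one_surjective {M : Type u} [AddCommGroup M] [Module Aᵐᵒᵖ M] :
    ∃ r : BTensor A M A →+ M, (∀ t, t = tmul A (r t) (1 : A)) ∧ ∀ m a, r (tmul A m a) = op a • m := by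
  refine ⟨lift (fun m a => op a • m) (fun m m' a => smul_add _ _ _)
    (fun m a a' => add_smul (op a) (op a') m) (fun m a b => ?_), ?_, fun m a => rfl⟩
  · rw [smul_smul, smul_eq_mul, op_mul]
  · intro t
    induction t using induction_on with
    | h0 => simp [zero_tmul]
    | ht m a => rw [lift_tmul, smul_tmul, smul_eq_mul, mul_one]
    | ha x y hx hy => rw [map_add, add_tmul, ← hx, ← hy]

theorem one_tmul_surjective {N : Type u} [AddCommGroup N] [Module A N] :
    ∃ r : BTensor A A N →+ N, (∀ t, t = tmul A (1 : A) (r t)) ∧ ∀ a n, r (tmul A a n) = a • n := by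
  refine ⟨lift (fun a n => a • n) (fun a a' n => add_smul _ _ _)
    (fun a n n' => smul_add _ _ _) (fun a b n => ?_), ?_, fun m a => rfl⟩
  · rw [smul_smul]; rfl
  · intro t
    induction t using induction_on with
    | h0 => simp [tmul_zero]
    | ht a n => rw [lift_tmul, ← smul_tmul]; simp
    | ha x y hx hy => rw [map_add, tmul_add, ← hx, ← hy]

section Sub

/-- If `D` is flat as a left module, a submodule `K` of a right comodule `P` whose elements are
mapped by the coaction into `K ⊗ D` is a right comodule. -/
@[reducible]
def subRComodule (D : Coring B) [LFlat B D] {K P : Type u} [AddCommGroup K] [Module Bᵐᵒᵖ K]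
    [AddCommGroup P] [Module Bᵐᵒᵖ P] [RComodule D P] (ι : K →ₗ[Bᵐᵒᵖ] P)
    (hι : Function.Injective ι) (h : ∀ k, ∃ z, rTensor D ι z = rho D (ι k)) : RComodule D K :=
  have hinj : Function.Injective (rTensor D ι) := LFlat.injective D ι hι
  have hc := fun k => (h k).choose_spec
  let r : K →ₗ[Bᵐᵒᵖ] BTensor B K D :=
    { toFun := fun k => (h k).choose
      map_add' := fun k k' => hinj (((hc _).trans (by rw [map_add, map_add])).trans
        ((map_add _ _ _).trans (congrArg₂ (· + ·) (hc _) (hc _))).symm)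
      map_smul' := fun s k => hinj (((hc _).trans (by rw [map_smul, map_smul])).trans
        ((rTensor_smul ι s _).trans (congrArg (s • ·) (hc _))).symm) }
  have hr : ∀ k, rTensor D ι (r k) = rho D (ι k) := hc
  { coact := r
    coassoc := fun k => by
      have hinj2 : Function.Injective (rTensor (BTensor B D D) ι) := by
        have h1 : Function.Injective (rTensor D (rTensorLin B D ι)) :=
          LFlat.injective D (rTensorLin B D ι) hinj
        intro x y hxy
        have h2 := assoc_rTensor_rTensor (A := B) (B := B) (Q := D) (P := D) ι
          ((assoc B K B D D).symm x)
        have h3 := assoc_rTensor_rTensor (A := B) (B := B) (Q := D) (P := D) ι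
          ((assoc B K B D D).symm y)
        rw [AddEquiv.apply_symm_apply] at h2 h3
        rw [← h2, ← h3] at hxy
        exact (assoc B K B D D).symm.injective (h1 ((assoc B P B D D).injective hxy))
      apply hinj2
      rw [rTensor_lTensor, hr, ← assoc_rTensor_rTensor, ← rTensor_comp_apply]
      have h1 : (rTensorLin B D ι).comp r = (rho D).comp ι := LinearMap.ext hr
      rw [h1, rTensor_comp_apply, hr]
      exact RComodule.coassoc (C := D) (ι k)
    counit := fun k => by
      obtain ⟨q, hq, hq'⟩ := tmul_one_surjective (A := B) (M := K)
      obtain ⟨p, hp, hp'⟩ := tmul_one_surjective (A := B) (M := P)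
      have hpq : ∀ t, p (rTensor B ι t) = ι (q t) := fun t => by
        induction t using induction_on with
        | h0 => simp
        | ht m a => rw [rTensor_tmul, hp', hq', map_smul]
        | ha x y hx hy => simp only [map_add, hx, hy]
      rw [hq (lTensor K D.counit (r k))]
      congr 1
      apply hι
      rw [← hpq, rTensor_lTensor, hr]
      have h1 := RComodule.counit (C := D) (ι k)
      change lTensor P D.counit (rho D (ι k)) = _ at h1
      rw [h1, hp', op_one, one_smul] }

theorem subRComodule_rho (D : Coring B) [LFlat B D] {K P : Type u} [AddCommGroup K]
    [Module Bᵐᵒᵖ K] [AddCommGroup P] [Module Bᵐᵒᵖ P] [RComodule D P] (ι : K →ₗ[Bᵐᵒᵖ] P)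
    (hι : Function.Injective ι) (h : ∀ k, ∃ z, rTensor D ι z = rho D (ι k)) (k : K) :
    rTensor D ι ((subRComodule D ι hι h).coact k) = rho D (ι k) :=
  (h k).choose_spec

/-- The left-sided version of `subRComodule`. -/
@[reducible]
def subLComodule (D : Coring B) [RFlat B D] {K P : Type u} [AddCommGroup K] [Module B K]
    [AddCommGroup P] [Module B P] [LComodule D P] (ι : K →ₗ[B] P)
    (hι : Function.Injective ι) (h : ∀ k, ∃ z, lTensor D ι z = lam D (ι k)) : LComodule D K :=
  have hinj : Function.Injective (lTensor D ι) := RFlat.injective D ι hι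
  have hc := fun k => (h k).choose_spec
  let r : K →ₗ[B] BTensor B D K :=
    { toFun := fun k => (h k).choose
      map_add' := fun k k' => hinj (((hc _).trans (by rw [map_add, map_add])).trans
        ((map_add _ _ _).trans (congrArg₂ (· + ·) (hc _) (hc _))).symm)
      map_smul' := fun s k => hinj (((hc _).trans (by rw [map_smul, map_smul])).trans
        ((lTensor_smul ι s _).trans (congrArg (s • ·) (hc _))).symm) }
  have hr : ∀ k, lTensor D ι (r k) = lam D (ι k) := hc
  { coact := r
    coassoc := fun k => by
      have hinj2 : Function.Injective (lTensor D (lTensorLin B D ι)) :=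
        RFlat.injective D (lTensorLin B D ι) hinj
      apply hinj2
      rw [← assoc_lTensor, ← rTensor_lTensor, hr, ← lTensor_comp_apply]
      have h1 : (lTensorLin B D ι).comp r = (lam D).comp ι := LinearMap.ext hr
      rw [h1, lTensor_comp_apply, hr]
      exact LComodule.coassoc (C := D) (ι k)
    counit := fun k => by
      obtain ⟨q, hq, hq'⟩ := one_tmul_surjective (A := B) (N := K)
      obtain ⟨p, hp, hp'⟩ := one_tmul_surjective (A := B) (N := P)
      have hpq : ∀ t, p (lTensor B ι t) = ι (q t) := fun t => by
        induction t using induction_on with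
        | h0 => simp
        | ht m a => rw [lTensor_tmul, hp', hq', map_smul]
        | ha x y hx hy => simp only [map_add, hx, hy]
      rw [hq (rTensor K D.counitR (r k))]
      congr 1
      apply hι
      rw [← hpq, ← rTensor_lTensor, hr]
      have h1 := LComodule.counit (C := D) (ι k)
      change rTensor P D.counitR (lam D (ι k)) = _ at h1
      rw [h1, hp', one_smul] }

theorem subLComodule_lam (D : Coring B) [RFlat B D] {K P : Type u} [AddCommGroup K]
    [Module B K] [AddCommGroup P] [Module B P] [LComodule D P] (ι : K →ₗ[B] P)
    (hι : Function.Injective ι) (h : ∀ k, ∃ z, lTensor D ι z = lam D (ι k)) (k : K) :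
    lTensor D ι ((subLComodule D ι hι h).coact k) = lam D (ι k) :=
  (h k).choose_spec

end Sub

/-! ### The cotensor product -/

section Cotensor

variable (C : Coring A)

/-- The map `ω_{M,N} = ρ_M ⊗ N - M ⊗ λ_N : M ⊗_A N → M ⊗_A C ⊗_A N`. -/
def omega (M N : Type u) [AddCommGroup M] [Module Aᵐᵒᵖ M] [RComodule C M]
    [AddCommGroup N] [Module A N] [LComodule C N] :
    BTensor A M N →+ BTensor A M (BTensor A C N) :=
  (assoc A M A C N).toAddMonoidHom.comp (rTensor N (rho C)) - lTensor M (lam C)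

/-- The cotensor product `M □_C N`, the kernel of `ω_{M,N}`. -/
def Cotensor (M N : Type u) [AddCommGroup M] [Module Aᵐᵒᵖ M] [RComodule C M]
    [AddCommGroup N] [Module A N] [LComodule C N] : Type u :=
  (omega C M N).ker

section Basic

variable {M M' N N' : Type u} [AddCommGroup M] [Module Aᵐᵒᵖ M] [RComodule C M]
  [AddCommGroup M'] [Module Aᵐᵒᵖ M'] [RComodule C M']
  [AddCommGroup N] [Module A N] [LComodule C N] [AddCommGroup N'] [Module A N'] [LComodule C N']

instance : AddCommGroup (Cotensor C M N) :=
  inferInstanceAs (AddCommGroup (omega C M N).ker)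

theorem omega_apply (t : BTensor A M N) :
    omega C M N t = assoc A M A C N (rTensor N (rho C) t) - lTensor M (lam C) t := rfl

theorem omega_rsmul (T : Type u) [Ring T] [Module Tᵐᵒᵖ N] [SMulCommClass A Tᵐᵒᵖ N]
    [LCoactLin C T N] (s : Tᵐᵒᵖ) (t : BTensor A M N) :
    omega C M N (s • t) = s • omega C M N t := by
  rw [omega_apply, omega_apply, rTensor_smul, assoc_rsmul,
    lTensor_rsmul (lam C) (LCoactLin.lam_smul (C := C) (T := T)), smul_sub]

theorem omega_lsmul (S : Type u) [Ring S] [Module S M] [SMulCommClass S Aᵐᵒᵖ M]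
    [RCoactLin C S M] (s : S) (t : BTensor A M N) :
    omega C M N (s • t) = s • omega C M N t := by
  rw [omega_apply, omega_apply, lTensor_smul,
    rTensor_lsmul (rho C) (RCoactLin.rho_smul (C := C) (S := S)), assoc_lsmul, smul_sub]

variable (M N)

/-- `ω_{M,N}` as a left `S`-linear map. -/
def omegaL (S : Type u) [Ring S] [Module S M] [SMulCommClass S Aᵐᵒᵖ M] [RCoactLin C S M] :
    BTensor A M N →ₗ[S] BTensor A M (BTensor A C N) where
  toFun := omega C M N
  map_add' := map_add _
  map_smul' := omega_lsmul C S

/-- `ω_{M,N}` as a right `T`-linear map. -/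
def omegaR (T : Type u) [Ring T] [Module Tᵐᵒᵖ N] [SMulCommClass A Tᵐᵒᵖ N] [LCoactLin C T N] :
    BTensor A M N →ₗ[Tᵐᵒᵖ] BTensor A M (BTensor A C N) where
  toFun := omega C M N
  map_add' := map_add _
  map_smul' := omega_rsmul C T

variable {M N}

theorem omega_rTensor (f : RComodHom C M M') (t : BTensor A M N) :
    omega C M' N (rTensor N f.lin t) = rTensor (BTensor A C N) f.lin (omega C M N t) := by
  induction t using induction_on with
  | h0 => simp
  | ht m n =>
    simp only [omega_apply, rTensor_tmul, map_sub, lTensor_tmul]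
    rw [← f.colin, assoc_tmul_eq, assoc_tmul_eq, rTensor_lTensor]
  | ha x y hx hy => simp only [map_add, hx, hy]

theorem omega_lTensor (g : LComodHom C N N') (t : BTensor A M N) :
    omega C M N' (lTensor M g.lin t) = lTensor M (lTensorLin A C g.lin) (omega C M N t) := by
  induction t using induction_on with
  | h0 => simp
  | ht m n =>
    simp only [omega_apply, rTensor_tmul, map_sub, lTensor_tmul, lTensorLin_apply]
    rw [← g.colin, ← assoc_lTensor, lTensor_tmul]
  | ha x y hx hy => simp only [map_add, hx, hy]

end Basic

namespace Cotensor

variable {C}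

section Basic

variable {M M' N N' : Type u} [AddCommGroup M] [Module Aᵐᵒᵖ M] [RComodule C M]
  [AddCommGroup M'] [Module Aᵐᵒᵖ M'] [RComodule C M']
  [AddCommGroup N] [Module A N] [LComodule C N] [AddCommGroup N'] [Module A N'] [LComodule C N']

/-- The inclusion of `M □_C N` in `M ⊗_A N`. -/
def incl : Cotensor C M N →+ BTensor A M N := (omega C M N).ker.subtype

theorem incl_injective : Function.Injective (incl (C := C) (M := M) (N := N)) :=
  Subtype.val_injective

theorem omega_incl (k : Cotensor C M N) : omega C M N (incl k) = 0 := k.2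

/-- Elements of `M □_C N`. -/
def mk (t : BTensor A M N) (h : omega C M N t = 0) : Cotensor C M N := ⟨t, h⟩

@[simp]
theorem incl_mk (t : BTensor A M N) (h : omega C M N t = 0) : incl (mk t h) = t := rfl

instance rightModule (T : Type u) [Ring T] [Module Tᵐᵒᵖ N] [SMulCommClass A Tᵐᵒᵖ N]
    [LCoactLin C T N] : Module Tᵐᵒᵖ (Cotensor C M N) :=
  letI : SMul Tᵐᵒᵖ (Cotensor C M N) :=
    ⟨fun s k => mk (s • incl k) (by rw [omega_rsmul, omega_incl, smul_zero])⟩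
  Function.Injective.module Tᵐᵒᵖ incl incl_injective fun _ _ => rfl

instance leftModule (S : Type u) [Ring S] [Module S M] [SMulCommClass S Aᵐᵒᵖ M]
    [RCoactLin C S M] : Module S (Cotensor C M N) :=
  letI : SMul S (Cotensor C M N) :=
    ⟨fun s k => mk (s • incl k) (by rw [omega_lsmul, omega_incl, smul_zero])⟩
  Function.Injective.module S incl incl_injective fun _ _ => rfl

/-- The inclusion as a right `T`-linear map. -/
def inclR (T : Type u) [Ring T] [Module Tᵐᵒᵖ N] [SMulCommClass A Tᵐᵒᵖ N]
    [LCoactLin C T N] : Cotensor C M N →ₗ[Tᵐᵒᵖ] BTensor A M N where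
  toFun := incl
  map_add' := map_add _
  map_smul' _ _ := rfl

/-- The inclusion as a left `S`-linear map. -/
def inclL (S : Type u) [Ring S] [Module S M] [SMulCommClass S Aᵐᵒᵖ M]
    [RCoactLin C S M] : Cotensor C M N →ₗ[S] BTensor A M N where
  toFun := incl
  map_add' := map_add _
  map_smul' _ _ := rfl

variable (N) in
/-- `f □_C N`. -/
def mapL (f : RComodHom C M M') : Cotensor C M N →+ Cotensor C M' N where
  toFun k := mk (rTensor N f.lin (incl k)) (by rw [omega_rTensor, omega_incl, map_zero])
  map_zero' := incl_injective (by simp)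
  map_add' k k' := incl_injective (by simp)

variable (M) in
/-- `M □_C g`. -/
def mapR (g : LComodHom C N N') : Cotensor C M N →+ Cotensor C M N' where
  toFun k := mk (lTensor M g.lin (incl k)) (by rw [omega_lTensor, omega_incl, map_zero])
  map_zero' := incl_injective (by simp)
  map_add' k k' := incl_injective (by simp)

@[simp]
theorem incl_mapL (f : RComodHom C M M') (k : Cotensor C M N) :
    incl (mapL N f k) = rTensor N f.lin (incl k) := rfl

@[simp]
theorem incl_mapR (g : LComodHom C N N') (k : Cotensor C M N) :
    incl (mapR M g k) = lTensor M g.lin (incl k) := rfl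

/-- The canonical isomorphism `M ≅ M □_C C`, given by the coaction. -/
def unitR (m : M) : Cotensor C M C :=
  mk (rho C m) (by
    rw [omega_apply, sub_eq_zero]
    exact (RComodule.coassoc (C := C) m).symm)

/-- The canonical isomorphism `N ≅ C □_C N`, given by the coaction. -/
def unitL (n : N) : Cotensor C C N :=
  mk (lam C n) (by
    rw [omega_apply, sub_eq_zero]
    exact LComodule.coassoc (C := C) n)

end Basic

section RightComodule

variable {D : Coring B} (M : Type u) [AddCommGroup M] [Module Aᵐᵒᵖ M] (X : Bicomod C D)

theorem rho_assoc (z : BTensor A (BTensor A M C) X) :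
    rTensor D ({ toFun := assoc A M A C X, map_add' := map_add _, map_smul' := assoc_rsmul } :
        BTensor A (BTensor A M C) X →ₗ[Bᵐᵒᵖ] BTensor A M (BTensor A C X)) (rho D z) =
      rho D (assoc A M A C X z) := by
  induction z using induction_on with
  | h0 => simp
  | ht t x =>
    induction t using induction_on with
    | h0 => simp [zero_tmul]
    | ht m c =>
      rw [assoc_tmul, rho_tmul, rho_tmul, rho_tmul, ← rTensor_comp_apply, ← rTensor_comp_apply]
      rfl
    | ha x y hx hy => rw [add_tmul, map_add, map_add, hx, hy, map_add, map_add]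
  | ha x y hx hy => simp only [map_add, hx, hy]

theorem rho_rTensor {M' : Type u} [AddCommGroup M'] [Module Aᵐᵒᵖ M'] (f : M →ₗ[Aᵐᵒᵖ] M')
    (z : BTensor A M X) :
    rTensor D (rTensorLin B X f) (rho D z) = rho D (rTensor X f z) := by
  induction z using induction_on with
  | h0 => simp
  | ht m x =>
    rw [rTensor_tmul, rho_tmul, rho_tmul, ← rTensor_comp_apply]
    rfl
  | ha x y hx hy => simp only [map_add, hx, hy]

theorem rho_lam (x : X) : rTensor D (lamLin C B) (rho D x) = rho D (lam C x) := by
  refine (assoc A C B X D).injective ?_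
  rw [X.compat]
  change _ = assoc A C B X D ((assoc A C B X D).symm (lTensor C (rhoLin D A) (lam C x)))
  rw [AddEquiv.apply_symm_apply]

variable [RComodule C M]

theorem rho_omega (z : BTensor A M X) :
    rTensor D (omegaR C M X B) (rho D z) = rho D (omega C M X z) := by
  have h : omegaR C M X B =
      LinearMap.comp ({ toFun := assoc A M A C X, map_add' := map_add _, map_smul' := assoc_rsmul } :
        BTensor A (BTensor A M C) X →ₗ[Bᵐᵒᵖ] BTensor A M (BTensor A C X)) (rTensorLin B X (rho C))
      - { toFun := lTensor M (lam C), map_add' := map_add _,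
          map_smul' := lTensor_rsmul (lam C) (LCoactLin.lam_smul (C := C) (T := B)) } := rfl
  rw [h, rTensor_sub_apply, rTensor_comp_apply, rho_rTensor, rho_assoc, omega_apply, map_sub]
  congr 1
  induction z using induction_on with
  | h0 => simp
  | ht m x =>
    rw [lTensor_tmul, rho_tmul, rho_tmul, ← rho_lam, ← rTensor_comp_apply, ← rTensor_comp_apply]
    rfl
  | ha x y hx hy => simp only [map_add, hx, hy]

theorem exists_rho [LFlat B D] (k : Cotensor C M X) :
    ∃ z, rTensor D (inclR (C := C) (M := M) (N := X) B) z = rho D (inclR B k) := by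
  have h : Function.Exact (inclR (C := C) (M := M) (N := X) B) (omegaR C M X B) := fun t =>
    ⟨fun ht => ⟨mk t ht, rfl⟩, by rintro ⟨k, rfl⟩; exact omega_incl k⟩
  refine (LFlat.exact (N := D) _ _ h _).1 ?_
  rw [rho_omega]
  change rho D (omega C M X (incl k)) = 0
  rw [omega_incl, map_zero]

/-- For `D` flat as a left module, `M □_C X` is a right `D`-comodule, with the coaction induced by
`M ⊗ ρ_X`. -/
instance rcomodule [LFlat B D] : RComodule D (Cotensor C M X) :=
  subRComodule D (inclR B) incl_injective (exists_rho M X)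

theorem rho_incl [LFlat B D] (k : Cotensor C M X) :
    rTensor D (inclR B) (rho D k) = rho D (incl k) :=
  subRComodule_rho D (inclR B) incl_injective (exists_rho M X) k

variable {M}

/-- `f □_C X` as a morphism of right `D`-comodules. -/
def mapLHom [LFlat B D] {M' : Type u} [AddCommGroup M'] [Module Aᵐᵒᵖ M'] [RComodule C M']
    (f : RComodHom C M M') : RComodHom D (Cotensor C M X) (Cotensor C M' X) where
  lin :=
    { toFun := mapL X f
      map_add' := map_add _
      map_smul' := fun s k => incl_injective (rTensor_smul f.lin s (incl k)) }
  colin k := by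
    apply LFlat.injective D (inclR (C := C) (M := M') (N := X) B) incl_injective
    rw [rho_incl]
    change _ = rho D (rTensor X f.lin (incl k))
    rw [← rho_rTensor, ← rho_incl, ← rTensor_comp_apply, ← rTensor_comp_apply]
    rfl

end RightComodule

section LeftComodule

variable {D : Coring B} (X : Bicomod D C) (N : Type u) [AddCommGroup N] [Module A N]

theorem lam_assoc (z : BTensor A (BTensor A X C) N) :
    lTensor D ({ toFun := assoc A X A C N, map_add' := map_add _, map_smul' := assoc_lsmul } :
        BTensor A (BTensor A X C) N →ₗ[B] BTensor A X (BTensor A C N)) (lam D z) =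
      lam D (assoc A X A C N z) := by
  induction z using induction_on with
  | h0 => simp
  | ht t x =>
    induction t using induction_on with
    | h0 => simp [zero_tmul]
    | ht m c =>
      rw [assoc_tmul, lam_tmul, lam_tmul, lam_tmul, ← lTensor_comp_apply, ← lTensor_comp_apply]
      rfl
    | ha x y hx hy => rw [add_tmul, map_add, map_add, hx, hy, map_add, map_add]
  | ha x y hx hy => simp only [map_add, hx, hy]

theorem lam_lTensor {N' : Type u} [AddCommGroup N'] [Module A N'] (g : N →ₗ[A] N')
    (z : BTensor A X N) :
    lTensor D (lTensorLin B X g) (lam D z) = lam D (lTensor X g z) := by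
  induction z using induction_on with
  | h0 => simp
  | ht m x =>
    rw [lTensor_tmul, lam_tmul, lam_tmul, ← lTensor_comp_apply]
    rfl
  | ha x y hx hy => simp only [map_add, hx, hy]

theorem lam_rho (x : X) : lTensor D (rhoLin C B) (lam D x) = lam D (rho C x) :=
  (X.compat x).symm

variable [LComodule C N]

theorem lam_omega (z : BTensor A X N) :
    lTensor D (omegaL C X N B) (lam D z) = lam D (omega C X N z) := by
  have h : omegaL C X N B =
      LinearMap.comp ({ toFun := assoc A X A C N, map_add' := map_add _, map_smul' := assoc_lsmul } :
        BTensor A (BTensor A X C) N →ₗ[B] BTensor A X (BTensor A C N))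
        ({ toFun := rTensor N (rho C), map_add' := map_add _,
           map_smul' := rTensor_lsmul (rho C) (RCoactLin.rho_smul (C := C) (S := B)) } :
          BTensor A X N →ₗ[B] BTensor A (BTensor A X C) N)
      - lTensorLin B X (lam C) := rfl
  rw [h, lTensor_sub_apply, lTensor_comp_apply, lam_lTensor, omega_apply, map_sub, ← lam_assoc]
  congr 2
  induction z using induction_on with
  | h0 => simp
  | ht m x =>
    rw [rTensor_tmul, lam_tmul, lam_tmul, ← lam_rho, ← lTensor_comp_apply, ← lTensor_comp_apply]
    rfl
  | ha x y hx hy => simp only [map_add, hx, hy]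

theorem exists_lam [RFlat B D] (k : Cotensor C X N) :
    ∃ z, lTensor D (inclL (C := C) (M := X) (N := N) B) z = lam D (inclL B k) := by
  have h : Function.Exact (inclL (C := C) (M := X) (N := N) B) (omegaL C X N B) := fun t =>
    ⟨fun ht => ⟨mk t ht, rfl⟩, by rintro ⟨k, rfl⟩; exact omega_incl k⟩
  refine (RFlat.exact (M := D) _ _ h _).1 ?_
  rw [lam_omega]
  change lam D (omega C X N (incl k)) = 0
  rw [omega_incl, map_zero]

/-- For `D` flat as a right module, `X □_C N` is a left `D`-comodule, with the coaction induced by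
`λ_X ⊗ N`. -/
instance lcomodule [RFlat B D] : LComodule D (Cotensor C X N) :=
  subLComodule D (inclL B) incl_injective (exists_lam X N)

theorem lam_incl [RFlat B D] (k : Cotensor C X N) :
    lTensor D (inclL B) (lam D k) = lam D (incl k) :=
  subLComodule_lam D (inclL B) incl_injective (exists_lam X N) k

variable {N}

/-- `X □_C g` as a morphism of left `D`-comodules. -/
def mapRHom [RFlat B D] {N' : Type u} [AddCommGroup N'] [Module A N'] [LComodule C N']
    (g : LComodHom C N N') : LComodHom D (Cotensor C X N) (Cotensor C X N') where
  lin :=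
    { toFun := mapR X g
      map_add' := map_add _
      map_smul' := fun s k => incl_injective (lTensor_smul g.lin s (incl k)) }
  colin k := by
    apply RFlat.injective D (inclL (C := C) (M := X) (N := N') B) incl_injective
    rw [lam_incl]
    change _ = lam D (lTensor X g.lin (incl k))
    rw [← lam_lTensor, ← lam_incl, ← lTensor_comp_apply, ← lTensor_comp_apply]
    rfl

end LeftComodule

end Cotensor

end Cotensor

open Cotensor

/-! ### The functors -/

section Functors

variable {C : Coring A} {D : Coring B}

/-- The functor `- □_C X : M^C ⥤ M^D`. -/
def cotensorRight [LFlat B D] (X : Bicomod C D) : RComod C ⥤ RComod D where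
  obj M := ⟨Cotensor C M X⟩
  map f := mapLHom X f
  map_id _ := RComodHom.ext fun _ => incl_injective (rTensor_id_apply _)
  map_comp f g := RComodHom.ext fun _ => incl_injective (rTensor_comp_apply g.lin f.lin _)

/-- The functor `X □_D - : ^D M ⥤ ^C M`. -/
def cotensorLeft [RFlat A C] (X : Bicomod C D) : LComod D ⥤ LComod C where
  obj N := ⟨Cotensor D X N⟩
  map g := mapRHom X g
  map_id _ := LComodHom.ext fun _ => incl_injective (lTensor_id_apply _)
  map_comp f g := LComodHom.ext fun _ => incl_injective (lTensor_comp_apply g.lin f.lin _)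

/-- The functor `- ⊗_A X` from right `A`-modules to right `D`-comodules. -/
def tensorRight (X : Bicomod C D) : ModuleCat.{u} Aᵐᵒᵖ ⥤ RComod D where
  obj M := ⟨BTensor A M X⟩
  map f := ⟨rTensorLin B X f.hom, fun z => rho_rTensor _ X f.hom z⟩
  map_id _ := RComodHom.ext fun _ => rTensor_id_apply _
  map_comp f g := RComodHom.ext fun _ => rTensor_comp_apply g.hom f.hom _

/-- `X` is quasi-finite as a right `D`-comodule: `- ⊗_A X : M_A ⥤ M^D` has a left adjoint. -/
def QuasiFinite (X : Bicomod C D) : Prop := (tensorRight X).IsRightAdjoint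

end Functors

/-! ### Coseparable corings and coflat comodules -/

/-- A morphism of bicomodules: an additive map which is a morphism of left `C`-comodules and of
right `D`-comodules. -/
structure BicomodHom (C : Coring A) (D : Coring B) (Y Y' : Type u)
    [AddCommGroup Y] [Module A Y] [Module Bᵐᵒᵖ Y] [LComodule C Y] [RComodule D Y]
    [AddCommGroup Y'] [Module A Y'] [Module Bᵐᵒᵖ Y'] [LComodule C Y'] [RComodule D Y'] where
  left : LComodHom C Y Y'
  right : RComodHom D Y Y'
  eq : ∀ y, left.lin y = right.lin y

/-- `C` is coseparable: `Δ : C → C ⊗_A C` is a split monomorphism of `C`-bicomodules. -/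
def Coseparable (C : Coring A) : Prop :=
  ∃ π : BicomodHom C C (BTensor A C C) C, ∀ c : C, π.left.lin (C.comul c) = c

/-- The left `C`-comodule `N` is coflat: `- □_C N` preserves short exact sequences (for `C` flat as
a left module, exactness in `M^C` is exactness of the underlying sequence of modules). -/
def LCoflat (C : Coring A) (N : Type u) [AddCommGroup N] [Module A N] [LComodule C N] : Prop :=
  ∀ (M M' M'' : RComod C) (f : RComodHom C M M') (g : RComodHom C M' M''),
    Function.Injective f.lin → Function.Exact f.lin g.lin → Function.Surjective g.lin →
    Function.Injective (mapL N f) ∧ Function.Exact (mapL N f) (mapL N g) ∧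
      Function.Surjective (mapL N g)

/-- The right `C`-comodule `M` is coflat: `M □_C -` preserves short exact sequences (for `C` flat as
a right module, exactness in `^C M` is exactness of the underlying sequence of modules). -/
def RCoflat (C : Coring A) (M : Type u) [AddCommGroup M] [Module Aᵐᵒᵖ M] [RComodule C M] : Prop :=
  ∀ (N N' N'' : LComod C) (f : LComodHom C N N') (g : LComodHom C N' N''),
    Function.Injective f.lin → Function.Exact f.lin g.lin → Function.Surjective g.lin →
    Function.Injective (mapR M f) ∧ Function.Exact (mapR M f) (mapR M g) ∧
      Function.Surjective (mapR M g)

/-! ### The five conditions -/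

section Conditions

variable {C : Coring A} {D : Coring B}

/-- The underlying right comodule of a bicomodule. -/
def Bicomod.toRComod (X : Bicomod C D) : RComod D := ⟨X⟩

/-- `C` as a right comodule over itself. -/
def Coring.toRComod (C : Coring A) : RComod C := ⟨C⟩

/-- `C ⊗_A C` as a right `C`-comodule, with coaction `C ⊗ Δ`. -/
def Coring.tensorSelf (C : Coring A) : RComod C := ⟨BTensor A C C⟩

/-- The endomorphism `c ↦ a c` of the right `C`-comodule `C`. -/
def Coring.mulLeft (C : Coring A) (a : A) : C.toRComod ⟶ C.toRComod where
  lin := Module.toModuleEnd Aᵐᵒᵖ (S := A) C a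
  colin := fun (c : C) => by
    change rTensor C _ (C.comul c) = C.comul (a • c)
    rw [map_smul]
    induction C.comul c using induction_on with
    | h0 => simp
    | ht m n => rfl
    | ha x y hx hy => simp only [smul_add, map_add, hx, hy]

/-- The morphism `c' ↦ c ⊗ c'` from `C` to `C ⊗_A C` in `M^C`. -/
def Coring.tmulLeft (C : Coring A) (c : C) : C.toRComod ⟶ C.tensorSelf where
  lin := tmulL A C c
  colin := fun (c' : C) => (rho_tmul (A := A) (M := C) (N := C) C c c').symm

/-- `Δ` as a morphism from `C` to `C ⊗_A C` in `M^C`. -/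
def Coring.comulHom (C : Coring A) : C.toRComod ⟶ C.tensorSelf where
  lin := C.comulR
  colin := fun (c : C) => by
    refine (assoc A C A C C).injective ?_
    exact (C.coassoc c).symm.trans (AddEquiv.apply_symm_apply _ _).symm

/-- An isomorphism of `C`-`D`-bicomodules `X ≅ F(C)`, for a functor `F : M^C ⥤ M^D`. Here `A` acts
on the left of `F(C)` through the endomorphisms `F(c ↦ a c)`, and the left coaction
`F(C) → C ⊗_A F(C)` is the map corresponding to `F(Δ) : F(C) → F(C ⊗_A C)` under the canonical map
`Υ : C ⊗_A F(C) → F(C ⊗_A C)`, `c ⊗ y ↦ F(c' ↦ c ⊗ c')(y)`, which is an isomorphism whenever `F`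
is a left adjoint. The field `upsilon` is the composite of `Υ` with `C ⊗_A X ≅ C ⊗_A F(C)`. -/
structure BicomodIsoValue (F : RComod C ⥤ RComod D) (X : Bicomod C D) where
  iso : X.toRComod ≅ F.obj C.toRComod
  smul : ∀ (a : A) (x : X), RComodHom.lin iso.hom (a • x : X) =
    RComodHom.lin (F.map (C.mulLeft a)) (RComodHom.lin iso.hom x)
  upsilon : BTensor A C X →+ F.obj C.tensorSelf
  upsilon_tmul : ∀ (c : C) (x : X), upsilon (tmul A c x) =
    RComodHom.lin (F.map (C.tmulLeft c)) (RComodHom.lin iso.hom x)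
  colin : ∀ x : X, upsilon (lam C x) =
    RComodHom.lin (F.map C.comulHom) (RComodHom.lin iso.hom x)

/-- `F` is a co-hom functor `h_C(Λ, -) : M^C ⥤ M^D`, i.e. a left adjoint of `- □_D Λ`. -/
def IsCohom [LFlat A C] (Λ : Bicomod D C) (F : RComod C ⥤ RComod D) : Prop :=
  Nonempty (F ⊣ cotensorRight Λ)

/-- `- □_C X` is left adjoint to `- □_D Λ`. -/
def RightAdjunction [LFlat A C] [LFlat B D] (X : Bicomod C D) (Λ : Bicomod D C) : Prop :=
  Nonempty (cotensorRight X ⊣ cotensorRight Λ)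

/-- `Λ □_C -` is left adjoint to `X □_D -`. -/
def LeftAdjunction [RFlat A C] [RFlat B D] (X : Bicomod C D) (Λ : Bicomod D C) : Prop :=
  Nonempty (cotensorLeft Λ ⊣ cotensorLeft X)

/-- `Λ` is quasi-finite as a right `C`-comodule and `- □_C X ≅ h_C(Λ, -)`. -/
def CohomFunctorIso [LFlat A C] [LFlat B D] (X : Bicomod C D) (Λ : Bicomod D C) : Prop :=
  QuasiFinite Λ ∧ ∃ F : RComod C ⥤ RComod D, IsCohom Λ F ∧ Nonempty (cotensorRight X ≅ F)

/-- `Λ` is quasi-finite as a right `C`-comodule and `X ≅ h_C(Λ, C)` as bicomodules. -/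
def CohomValueIso [LFlat A C] (X : Bicomod C D) (Λ : Bicomod D C) : Prop :=
  QuasiFinite Λ ∧ ∃ F : RComod C ⥤ RComod D, IsCohom Λ F ∧ Nonempty (BicomodIsoValue F X)

/-- The elements `w ∈ (M □_C X) □_D N` and `w' ∈ M □_C (X □_D N)` have the same image in
`M ⊗_A X ⊗_B N`, i.e. they correspond to each other under `(M □_C X) □_D N ≅ M □_C (X □_D N)`
(when that associativity isomorphism exists). -/
def Corresponds [LFlat B D] [RFlat A C] {M N : Type u} [AddCommGroup M] [Module Aᵐᵒᵖ M]
    [RComodule C M] [AddCommGroup N] [Module B N] [LComodule D N] {X : Bicomod C D}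
    (w : Cotensor D (Cotensor C M X) N) (w' : Cotensor C M (Cotensor D X N)) : Prop :=
  assoc A M B X N (rTensor N (inclR B) (incl w)) = lTensor M (inclL A) (incl w')

/-- There are bicolinear maps `ψ : C → X □_D Λ` and `ω : Λ □_C X → D` such that
`(ω □_D Λ) ∘ (Λ □_C ψ) = Λ` and `(X □_D ω) ∘ (ψ □_C X) = X`, where `Λ □_C C`, `D □_D Λ` are
identified with `Λ`, `C □_C X`, `X □_D D` with `X`, and `(Λ □_C X) □_D Λ`, `(X □_D Λ) □_C X` with
`Λ □_C (X □_D Λ)`, `X □_D (Λ □_C X)`. -/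
def UnitCounit [LFlat A C] [RFlat A C] [LFlat B D] [RFlat B D] (X : Bicomod C D)
    (Λ : Bicomod D C) : Prop :=
  ∃ (ψ : BicomodHom C C C (Cotensor D X Λ)) (ω : BicomodHom D D (Cotensor C Λ X) D),
    (∀ l : Λ, ∃ w : Cotensor D (Cotensor C Λ X) Λ,
      Corresponds w (mapR Λ ψ.left (unitR l)) ∧ mapL Λ ω.right w = unitL l) ∧
    (∀ x : X, ∃ w : Cotensor D X (Cotensor C Λ X),
      Corresponds (mapL X ψ.right (unitL x)) w ∧ mapR X ω.left w = unitR x)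

/-- `X` is flat over `A`, `Λ` is flat over `B`, and the maps `ω_{X,Λ} : X ⊗_B Λ → X ⊗_B D ⊗_B Λ`
and `ω_{Λ,X} : Λ ⊗_A X → Λ ⊗_A C ⊗_A X` are pure as maps of left `A`-modules and of left
`B`-modules, respectively. -/
def FlatPure (X : Bicomod C D) (Λ : Bicomod D C) : Prop :=
  LFlat A X ∧ LFlat B Λ ∧ LPure (omegaL D X Λ A) ∧ LPure (omegaL C Λ X B)

end Conditions

end Comodules

end

end Corings

open Corings

open CategoryTheory MulOpposite

namespace Corings

noncomputable section

open BTensor Cotensor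

/-! ### Flatness for balanced tensor products over noncommutative rings. -/

section ModuleTheory

variable {A : Type u} [Ring A] {B : Type u} [Ring B]

/-! ### Right exactness of the balanced tensor product -/

section RightExact

variable {M M' M'' N N' N'' : Type u}
  [AddCommGroup M] [Module Aᵐᵒᵖ M] [AddCommGroup M'] [Module Aᵐᵒᵖ M']
  [AddCommGroup M''] [Module Aᵐᵒᵖ M'']
  [AddCommGroup N] [Module A N] [AddCommGroup N'] [Module A N']
  [AddCommGroup N''] [Module A N'']

/-! Everything is governed by two comparison maps between tensor and cotensor products, Z ⊗ (M □ N)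
→ (Z ⊗ M) □ N (`tensorCotensor`) and (M □ N) ⊗ Z → M □ (N ⊗ Z) (`cotensorTensor`). Up to
associativity ω_{Z⊗M,N} is Z ⊗ ω_{M,N}, so bijectivity of the first map for all Z is exactly purity
of ω_{M,N} (`lPure_omegaL_iff`). For a single Z it holds if Z is flat. For all Z it holds if the
coring is coseparable, because then M □ N is a natural direct summand of M ⊗ N
(`Coseparable.tensorCotensor_bijective`), and also if N is coflat and M is flat over the ring that
acts on it, by comparison with a free presentation of Z (`LCoflat.tensorCotensor_bijective`). Coflat
comodules are flat modules, and all modules over a von Neumann regular ring are flat. The second map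
is treated symmetrically. When these maps behave well, cotensor products are associative in the
elementwise sense of `Corresponds` (`exists_corresponds_right`, `exists_corresponds_left`).

From (4) to (1) (`UnitCounit.rightAdjunction`): the unit sends m to m₀ ⊗ ψ(m₁), and the counit is
the restriction to (N □ Λ) □ X of (N ⊗ Λ) □ X ≅ N ⊗ (Λ □ X) → N ⊗ D → N, where the middle map is N ⊗
ω. Both triangle identities extend from cotensor products to the ambient tensor products M ⊗ X and N
⊗ Λ. There they may be checked on pure tensors, where they become the two identities of (4).

From (1) to (4) (`RightAdjunction.unitCounit`): ψ is the unit at C and ω is the counit at D,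
transported along C □ X ≅ X and D □ Λ ≅ Λ. Linearity on the other side is naturality for
multiplications by ring elements. Naturality along the coaction M → M ⊗ C and along the maps c ↦ m ⊗
c recovers the unit at every M from ψ, and similarly for the counit; colinearity on the other side
is the case M = C (or N = D) of this. The identities of (4) are then the triangle identities at D
and at C. The equivalence of (4) and (5) is the mirror image of these two arguments, with the same ψ
and ω.

The equivalence of (1) and (2) is transport of an adjunction along an isomorphism of functors.
Quasi-finiteness comes from - ⊗ Λ ≅ (- ⊗ D) □ Λ, a composite of right adjoints. Evaluating - □ X at
C gives (3). For the converse, let F be left adjoint to - □ Λ with F(C) ≅ X as bicomodules. The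
adjunction forces F(W ⊗ C) ≅ W ⊗ X for all modules W, and the condition on the left coaction makes
F(M) → F(M ⊗ C) ≅ M ⊗ X land in M □ X. If C is coseparable, each M is a natural retract of M ⊗ C,
and this map F(M) → M □ X is bijective (`cohomToCotensor_bijective`). -/

theorem rTensor_surjective (N : Type u) [AddCommGroup N] [Module A N] (g : M →ₗ[Aᵐᵒᵖ] M')
    (hg : Function.Surjective g) : Function.Surjective (rTensor N g) := fun t => by
  induction t using induction_on with
  | h0 => exact ⟨0, map_zero _⟩
  | ht m n =>
    obtain ⟨m, rfl⟩ := hg m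
    exact ⟨tmul A m n, rfl⟩
  | ha x y hx hy =>
    obtain ⟨x, rfl⟩ := hx
    obtain ⟨y, rfl⟩ := hy
    exact ⟨x + y, map_add _ _ _⟩

theorem lTensor_surjective (M : Type u) [AddCommGroup M] [Module Aᵐᵒᵖ M] (g : N →ₗ[A] N')
    (hg : Function.Surjective g) : Function.Surjective (lTensor M g) := fun t => by
  induction t using induction_on with
  | h0 => exact ⟨0, map_zero _⟩
  | ht m n =>
    obtain ⟨n, rfl⟩ := hg n
    exact ⟨tmul A m n, rfl⟩
  | ha x y hx hy =>
    obtain ⟨x, rfl⟩ := hx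
    obtain ⟨y, rfl⟩ := hy
    exact ⟨x + y, map_add _ _ _⟩

/-- Modulo the image of `rTensor N f`, the class of x ⊗ n depends only on g x. Choosing preimages
under g therefore gives a well-defined map from M'' ⊗ N to the cokernel, and its composite with
`rTensor N g` is the quotient map. -/
theorem rTensor_exact (N : Type u) [AddCommGroup N] [Module A N] (f : M →ₗ[Aᵐᵒᵖ] M')
    (g : M' →ₗ[Aᵐᵒᵖ] M'') (h : Function.Exact f g) (hg : Function.Surjective g) :
    Function.Exact (rTensor N f) (rTensor N g) := by
  let s := Function.surjInv hg
  let q := QuotientAddGroup.mk' (rTensor N f).range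
  have key : ∀ x y n, g x = g y → q (tmul A x n) = q (tmul A y n) := fun x y n hxy => by
    obtain ⟨m, hm⟩ := (h (x - y)).1 (by rw [map_sub, hxy, sub_self])
    rw [← sub_eq_zero, ← map_sub, ← AddMonoidHom.mem_ker, QuotientAddGroup.ker_mk']
    refine ⟨tmul A m n, ?_⟩
    rw [rTensor_tmul, hm]
    exact eq_sub_of_add_eq (by rw [← add_tmul, sub_add_cancel])
  have hs : ∀ m, g (s m) = m := Function.surjInv_eq hg
  let k : BTensor A M'' N →+ (BTensor A M' N ⧸ (rTensor N f).range) :=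
    lift (fun m n => q (tmul A (s m) n))
      (fun m m' n => by
        rw [← map_add, ← add_tmul]
        exact key _ _ _ (by rw [map_add, hs, hs, hs]))
      (fun m n n' => by rw [tmul_add, map_add])
      (fun m a n => by
        rw [← smul_tmul]
        exact key _ _ _ (by rw [map_smul, hs, hs]))
  have hk : k.comp (rTensor N g) = q := hom_ext fun m n => key _ _ _ (hs _)
  intro t
  constructor
  · intro ht
    have h1 : q t = 0 := by rw [← hk, AddMonoidHom.comp_apply, ht, map_zero]
    rwa [← AddMonoidHom.mem_ker, QuotientAddGroup.ker_mk'] at h1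
  · rintro ⟨z, rfl⟩
    rw [← rTensor_comp_apply, h.linearMap_comp_eq_zero, rTensor_zero_apply]

theorem lTensor_exact (M : Type u) [AddCommGroup M] [Module Aᵐᵒᵖ M] (f : N →ₗ[A] N')
    (g : N' →ₗ[A] N'') (h : Function.Exact f g) (hg : Function.Surjective g) :
    Function.Exact (lTensor M f) (lTensor M g) := by
  let s := Function.surjInv hg
  let q := QuotientAddGroup.mk' (lTensor M f).range
  have key : ∀ m x y, g x = g y → q (tmul A m x) = q (tmul A m y) := fun m x y hxy => by
    obtain ⟨n, hn⟩ := (h (x - y)).1 (by rw [map_sub, hxy, sub_self])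
    rw [← sub_eq_zero, ← map_sub, ← AddMonoidHom.mem_ker, QuotientAddGroup.ker_mk']
    refine ⟨tmul A m n, ?_⟩
    rw [lTensor_tmul, hn]
    exact eq_sub_of_add_eq (by rw [← tmul_add, sub_add_cancel])
  have hs : ∀ n, g (s n) = n := Function.surjInv_eq hg
  let k : BTensor A M N'' →+ (BTensor A M N' ⧸ (lTensor M f).range) :=
    lift (fun m n => q (tmul A m (s n)))
      (fun m m' n => by rw [add_tmul, map_add])
      (fun m n n' => by
        rw [← map_add, ← tmul_add]
        exact key _ _ _ (by rw [map_add, hs, hs, hs]))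
      (fun m a n => by
        rw [smul_tmul]
        exact key _ _ _ (by rw [map_smul, hs, hs]))
  have hk : k.comp (lTensor M g) = q := hom_ext fun m n => key _ _ _ (hs _)
  intro t
  constructor
  · intro ht
    have h1 : q t = 0 := by rw [← hk, AddMonoidHom.comp_apply, ht, map_zero]
    rwa [← AddMonoidHom.mem_ker, QuotientAddGroup.ker_mk'] at h1
  · rintro ⟨z, rfl⟩
    rw [← lTensor_comp_apply, h.linearMap_comp_eq_zero, lTensor_zero_apply]

end RightExact

/-! ### Criteria for flatness -/

/-- Right exactness is automatic, so it suffices to factor g through its range: exactness holds for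
the surjection onto the range, and injectivity is preserved for the inclusion of the range. -/
theorem LFlat.of_injective {N : Type u} [AddCommGroup N] [Module A N]
    (h : ∀ {M M' : Type u} [AddCommGroup M] [Module Aᵐᵒᵖ M] [AddCommGroup M'] [Module Aᵐᵒᵖ M']
      (f : M →ₗ[Aᵐᵒᵖ] M'), Function.Injective f → Function.Injective (rTensor N f)) :
    LFlat A N where
  exact f g hfg := by
    have h1 : Function.Exact f g.rangeRestrict := fun x => by
      rw [← hfg x, ← LinearMap.mem_ker, ← LinearMap.mem_ker, LinearMap.ker_rangeRestrict]
    have h2 := rTensor_exact N f _ h1 g.surjective_rangeRestrict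
    have h3 := h _ (Submodule.subtype_injective (LinearMap.range g))
    intro t
    rw [← h2 t, ← h3.eq_iff, map_zero, ← rTensor_comp_apply]
    rfl

theorem RFlat.of_injective {M : Type u} [AddCommGroup M] [Module Aᵐᵒᵖ M]
    (h : ∀ {N N' : Type u} [AddCommGroup N] [Module A N] [AddCommGroup N'] [Module A N']
      (f : N →ₗ[A] N'), Function.Injective f → Function.Injective (lTensor M f)) :
    RFlat A M where
  exact f g hfg := by
    have h1 : Function.Exact f g.rangeRestrict := fun x => by
      rw [← hfg x, ← LinearMap.mem_ker, ← LinearMap.mem_ker, LinearMap.ker_rangeRestrict]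
    have h2 := lTensor_exact M f _ h1 g.surjective_rangeRestrict
    have h3 := h _ (Submodule.subtype_injective (LinearMap.range g))
    intro t
    rw [← h2 t, ← h3.eq_iff, map_zero, ← lTensor_comp_apply]
    rfl

/-- `D ⊗_B N` is flat over `A` if `D` is flat over `A` and `N` is flat over `B`. -/
theorem LFlat.tensor (D N : Type u) [AddCommGroup D] [Module A D] [Module Bᵐᵒᵖ D]
    [SMulCommClass A Bᵐᵒᵖ D] [AddCommGroup N] [Module B N] [LFlat A D] [LFlat B N] :
    LFlat A (BTensor B D N) :=
  LFlat.of_injective fun {M M'} _ _ _ _ f hf => by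
    have h := LFlat.injective N (rTensorLin B D f) (LFlat.injective D f hf)
    intro x y hxy
    refine (assoc A M B D N).symm.injective (h ((assoc A M' B D N).injective ?_))
    simpa only [assoc_rTensor_rTensor, AddEquiv.apply_symm_apply] using hxy

/-- `N ⊗_B D` is flat over `A` if `N` is flat over `B` and `D` is flat over `A`. -/
theorem RFlat.tensor (N D : Type u) [AddCommGroup D] [Module B D] [Module Aᵐᵒᵖ D]
    [SMulCommClass B Aᵐᵒᵖ D] [AddCommGroup N] [Module Bᵐᵒᵖ N] [RFlat A D] [RFlat B N] :
    RFlat A (BTensor B N D) :=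
  RFlat.of_injective fun {M M'} _ _ _ _ f hf => by
    have h := RFlat.injective N (lTensorLin B D f) (RFlat.injective D f hf)
    intro x y hxy
    refine (assoc B N A D M).injective (h ?_)
    rw [← assoc_lTensor, ← assoc_lTensor, hxy]

/-! ### Free modules -/

/-- Tensoring with a free module gives finitely supported families, naturally in the other factor,
and injectivity of a map on families is checked entrywise. Only the injectivity of the comparison
`φ` is needed, so a left inverse `χ` suffices. These modules provide the presentations used for
coflat comodules. -/
instance RFlat.finsupp (ι : Type u) : RFlat A (ι →₀ Aᵐᵒᵖ) :=
  RFlat.of_injective fun {N N'} _ _ _ _ f hf => by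
    classical
    let φ : ∀ (P : Type u) [AddCommGroup P] [Module A P],
        BTensor A (ι →₀ Aᵐᵒᵖ) P →+ (ι →₀ P) := fun P _ _ =>
      lift (fun x n => x.mapRange (fun a => unop a • n) (by simp))
        (fun x y n => by ext; simp [add_smul]) (fun x n n' => by ext; simp)
        (fun x a n => by ext; simp [mul_smul])
    let χ : (ι →₀ N) →+ BTensor A (ι →₀ Aᵐᵒᵖ) N := Finsupp.liftAddHom fun i =>
      AddMonoidHom.mk' (fun n => tmul A (Finsupp.single i 1) n) (tmul_add A _)
    have h1 : χ.comp (φ N) = AddMonoidHom.id _ := hom_ext fun x n => by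
      change χ (x.mapRange (fun a => unop a • n) (by simp)) = tmul A x n
      induction x using Finsupp.induction_linear with
      | zero => simp [zero_tmul]
      | add x y hx hy =>
        rw [add_tmul, ← hx, ← hy, ← map_add]
        congr 1
        ext; simp [add_smul]
      | single i a =>
        rw [Finsupp.mapRange_single]
        change Finsupp.liftAddHom _ _ = _
        rw [Finsupp.liftAddHom_apply_single]
        change tmul A _ _ = _
        rw [← smul_tmul]
        simp
    have h2 : ∀ t, φ N' (lTensor _ f t) = (φ N t).mapRange f (map_zero f) := fun t => by
      induction t using induction_on with
      | h0 => simp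
      | ht x n => ext i; exact (map_smul f (unop (x i)) n).symm
      | ha x y hx hy =>
        rw [map_add, map_add, map_add, hx, hy, Finsupp.mapRange_add (map_add f)]
    have h3 : Function.Injective (φ N) := fun x y hxy => by
      rw [← AddMonoidHom.id_apply _ x, ← AddMonoidHom.id_apply _ y, ← h1]
      exact congrArg χ hxy
    intro x y hxy
    refine h3 (Finsupp.mapRange_injective f (map_zero f) hf ?_)
    rw [← h2, ← h2, hxy]

instance LFlat.finsupp (ι : Type u) : LFlat A (ι →₀ A) :=
  LFlat.of_injective fun {N N'} _ _ _ _ f hf => by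
    classical
    let φ : ∀ (P : Type u) [AddCommGroup P] [Module Aᵐᵒᵖ P],
        BTensor A P (ι →₀ A) →+ (ι →₀ P) := fun P _ _ =>
      lift (fun n x => x.mapRange (fun a => op a • n) (by simp))
        (fun x y n => by ext; simp) (fun x n n' => by ext; simp [add_smul])
        (fun x a n => by ext; simp [mul_smul])
    let χ : (ι →₀ N) →+ BTensor A N (ι →₀ A) := Finsupp.liftAddHom fun i =>
      AddMonoidHom.mk' (fun n => tmul A n (Finsupp.single i 1)) (fun n n' => add_tmul A n n' _)
    have h1 : χ.comp (φ N) = AddMonoidHom.id _ := hom_ext fun n x => by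
      change χ (x.mapRange (fun a => op a • n) (by simp)) = tmul A n x
      induction x using Finsupp.induction_linear with
      | zero => simp [tmul_zero]
      | add x y hx hy =>
        rw [tmul_add, ← hx, ← hy, ← map_add]
        congr 1
        ext; simp [add_smul]
      | single i a =>
        rw [Finsupp.mapRange_single]
        change Finsupp.liftAddHom _ _ = _
        rw [Finsupp.liftAddHom_apply_single]
        change tmul A _ _ = _
        rw [smul_tmul]
        simp
    have h2 : ∀ t, φ N' (rTensor _ f t) = (φ N t).mapRange f (map_zero f) := fun t => by
      induction t using induction_on with
      | h0 => simp
      | ht n x => ext i; exact (map_smul f (op (x i)) n).symm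
      | ha x y hx hy =>
        rw [map_add, map_add, map_add, hx, hy, Finsupp.mapRange_add (map_add f)]
    have h3 : Function.Injective (φ N) := fun x y hxy => by
      rw [← AddMonoidHom.id_apply _ x, ← AddMonoidHom.id_apply _ y, ← h1]
      exact congrArg χ hxy
    intro x y hxy
    refine h3 (Finsupp.mapRange_injective f (map_zero f) hf ?_)
    rw [← h2, ← h2, hxy]

/-- The universal property of `M ⊗_A N` for groups in the lowest universe. -/
def liftSmall {M N : Type u} [AddCommGroup M] [Module Aᵐᵒᵖ M] [AddCommGroup N] [Module A N]
    {P : Type} [AddCommGroup P] (f : M → N → P) (hl : ∀ m m' n, f (m + m') n = f m n + f m' n)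
    (hr : ∀ m n n', f m (n + n') = f m n + f m n')
    (hb : ∀ (m : M) (a : A) (n : N), f (op a • m) n = f m (a • n)) : BTensor A M N →+ P :=
  (AddEquiv.ulift (α := P)).toAddMonoidHom.comp
    (lift (P := ULift.{u} P) (fun m n => ⟨f m n⟩)
      (fun m m' n => congrArg ULift.up (hl m m' n)) (fun m n n' => congrArg ULift.up (hr m n n'))
      (fun m a n => congrArg ULift.up (hb m a n)))

/-! ### Modules over von Neumann regular rings -/

/-- This is the inductive step in the classical proof that a finitely generated right ideal of a von
Neumann regular ring is generated by an idempotent. Here submodules over the opposite ring are right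
ideals. -/
theorem VonNeumannRegular.exists_left_unit (hA : VonNeumannRegular A) (I : Submodule Aᵐᵒᵖ A) {e : A}
    (he : e ∈ I) (hee : e * e = e) {a : A} (ha : a ∈ I) :
    ∃ e' ∈ I, e' * e' = e' ∧ e' * e = e ∧ e' * a = a := by
  have hm : ∀ {x : A} (y : A), x ∈ I → x * y ∈ I := fun y hx => I.smul_mem (op y) hx
  obtain ⟨c, hc⟩ := hA (a - e * a)
  set b := a - e * a with hb
  have hbI : b ∈ I := I.sub_mem ha (hm a he)
  have heb : e * b = 0 := by rw [hb, mul_sub, ← mul_assoc, hee, sub_self]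
  -- Since b c b = b and e b = 0, the element b c fixes b on the left and e kills b. The correction
  -- - b c e is chosen so that the new idempotent also fixes e on the left.
  have h1 : (e + b * c - b * c * e) * e = e := by
    rw [sub_mul, add_mul, hee, mul_assoc (b * c), hee, add_sub_cancel_right]
  have h2 : (e + b * c - b * c * e) * b = b := by
    rw [sub_mul, add_mul, heb, mul_assoc (b * c), heb, hc, zero_add, mul_zero, sub_zero]
  refine ⟨e + b * c - b * c * e, I.sub_mem (I.add_mem he (hm c hbI)) (hm e (hm c hbI)), ?_, h1, ?_⟩
  · rw [mul_sub, mul_add, h1, ← mul_assoc, h2, ← mul_assoc, ← mul_assoc, h2]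
  · have h3 : a = b + e * a := by rw [hb, sub_add_cancel]
    nth_rewrite 1 [h3]
    rw [mul_add, h2, ← mul_assoc, h1, ← h3]

/-- Every left module over a von Neumann regular ring is flat. -/
theorem VonNeumannRegular.lFlat (hA : VonNeumannRegular A) (N : Type u) [AddCommGroup N]
    [Module A N] : LFlat A N := by
  -- Lambek's argument: N is flat once its character module Hom(N, ℚ/ℤ) is injective as a right
  -- module, and injectivity follows from Baer's criterion.
  let _ : Module Aᵐᵒᵖ (N →+ AddCircle (1 : ℚ)) :=
    { smul := fun a χ => χ.comp (DistribSMul.toAddMonoidHom N (unop a))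
      one_smul := fun χ => by ext n; exact congrArg χ (one_smul A n)
      mul_smul := fun a b χ => by ext n; exact congrArg χ (mul_smul (unop b) (unop a) n)
      smul_zero := fun a => rfl
      smul_add := fun a χ χ' => rfl
      add_smul := fun a b χ => by
        ext n; exact (congrArg χ (add_smul (unop a) (unop b) n)).trans (map_add χ _ _)
      zero_smul := fun χ => by ext n; exact (congrArg χ (zero_smul A n)).trans (map_zero χ) }
  have hsm : ∀ (a : Aᵐᵒᵖ) (χ : N →+ AddCircle (1 : ℚ)) (n : N), (a • χ) n = χ (unop a • n) :=
    fun _ _ _ => rfl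
  -- Any element of I ⊗ N involves finitely many elements of I, which have a common idempotent left
  -- unit e in I. Moving all scalars across the tensor sign writes the element as e ⊗ n, where n is
  -- its image in N under multiplication. Hence I ⊗ N → N is injective.
  have hI : ∀ (I : Submodule Aᵐᵒᵖ A) (s : BTensor A I N), ∃ e : I, (e : A) * e = e ∧
      ∀ r : BTensor A I N →+ N, (∀ a n, r (tmul A a n) = (a : A) • n) → s = tmul A e (r s) :=
    fun I s => by
    induction s using induction_on with
    | h0 => exact ⟨0, by simp, fun r _ => by simp [zero_tmul]⟩
    | ht a n =>
      obtain ⟨e, he, hee, -, hea⟩ :=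
        hA.exists_left_unit I I.zero_mem (mul_zero 0) a.2
      refine ⟨⟨e, he⟩, hee, fun r hr => ?_⟩
      rw [hr, ← smul_tmul]
      congr 1
      exact Subtype.ext hea.symm
    | ha x y hx hy =>
      obtain ⟨e, hee, hx⟩ := hx
      obtain ⟨e', hee', hy⟩ := hy
      obtain ⟨f, hf, hff, hfe, hfe'⟩ := hA.exists_left_unit I e.2 hee e'.2
      refine ⟨⟨f, hf⟩, hff, fun r hr => ?_⟩
      have key : ∀ (d : I) (z : BTensor A I N), f * d = d → z = tmul A d (r z) →
          z = tmul A ⟨f, hf⟩ (r z) := fun d z hd hz => by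
        have h1 : r z = (d : A) • r z := by
          conv_lhs => rw [hz, hr]
        rw [h1, ← smul_tmul]
        conv_lhs => rw [hz]
        congr 1
        exact Subtype.ext hd.symm
      rw [map_add, tmul_add, ← key e x hfe (hx r hr), ← key e' y hfe' (hy r hr)]
  have hbaer : Module.Baer Aᵐᵒᵖ (N →+ AddCircle (1 : ℚ)) := fun I g => by
    -- Baer's criterion is stated for ideals of the opposite ring; `J` is the same ideal viewed as a
    -- right ideal of A.
    let J : Submodule Aᵐᵒᵖ A :=
      { carrier := {a | op a ∈ I}
        add_mem' := fun h h' => I.add_mem h h'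
        zero_mem' := I.zero_mem
        smul_mem' := fun c x h => I.smul_mem c h }
    let r : BTensor A J N →+ N := lift (fun a n => (a : A) • n)
      (fun a a' n => add_smul _ _ _) (fun a n n' => smul_add _ _ _)
      (fun a b n => by rw [smul_smul]; rfl)
    have hr : Function.Injective r := by
      rw [injective_iff_map_eq_zero]
      intro s hs
      obtain ⟨e, -, h⟩ := hI J s
      rw [h r (fun _ _ => rfl), hs, tmul_zero]
    let k : BTensor A J N →+ AddCircle (1 : ℚ) := liftSmall (fun a n => g ⟨op a, a.2⟩ n)
      (fun a a' n => by
        rw [← AddMonoidHom.add_apply, ← map_add]; rfl)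
      (fun a n n' => map_add _ _ _)
      (fun a b n => by
        change g (op b • (⟨op a, a.2⟩ : I)) n = _
        rw [map_smul]; rfl)
    -- A linear map from the ideal to the character module is the same as a character of J ⊗ N. As J
    -- ⊗ N embeds in N and ℚ/ℤ is divisible, it extends to a character of N, which is the element
    -- representing the extended linear map.
    obtain ⟨χ, hχ⟩ := (Module.Baer.of_divisible (AddCircle (1 : ℚ))).extension_property_addMonoidHom
      r hr k
    refine ⟨LinearMap.toSpanSingleton Aᵐᵒᵖ _ χ, fun x hx => ?_⟩
    ext n
    exact DFunLike.congr_fun hχ (tmul A (⟨unop x, hx⟩ : J) n)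
  have hinj := hbaer.injective
  refine LFlat.of_injective fun {M M'} _ _ _ _ f hf => ?_
  rw [injective_iff_map_eq_zero]
  intro t ht
  -- Characters separate points. A character of M ⊗ N is a linear map from M to the character module
  -- of N; it extends to M' by injectivity, so every character of M ⊗ N factors through `rTensor N
  -- f`.
  refine CharacterModule.eq_zero_of_character_apply fun c => ?_
  let c' : M →ₗ[Aᵐᵒᵖ] (N →+ AddCircle (1 : ℚ)) :=
    { toFun := fun m => AddMonoidHom.mk' (fun n => c (tmul A m n)) fun n n' => by
        rw [tmul_add, map_add]
      map_add' := fun m m' => by ext n; exact (congrArg c (add_tmul A m m' n)).trans (map_add c _ _)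
      map_smul' := fun a m => by ext n; exact congrArg c (smul_tmul A m (unop a) n) }
  obtain ⟨d, hd⟩ := hinj.out f hf c'
  let d' : BTensor A M' N →+ AddCircle (1 : ℚ) := liftSmall (fun m n => d m n)
    (fun m m' n => by rw [map_add]; rfl) (fun m n n' => map_add _ _ _)
    (fun m a n => by rw [map_smul]; rfl)
  have h1 : ∀ z, d' (rTensor N f z) = c z := fun z => by
    induction z using induction_on with
    | h0 => rw [map_zero, map_zero, map_zero]
    | ht m n => exact DFunLike.congr_fun (hd m) n
    | ha x y hx hy => rw [map_add, map_add, map_add, hx, hy]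
  rw [← h1, ht, map_zero]

/-- If all left modules are flat, then so are all quotients of flat right modules. -/
theorem RFlat.of_surjective (hA : ∀ (N : Type u) [AddCommGroup N] [Module A N], LFlat A N)
    {F M : Type u} [AddCommGroup F] [Module Aᵐᵒᵖ F] [RFlat A F] [AddCommGroup M] [Module Aᵐᵒᵖ M]
    (p : F →ₗ[Aᵐᵒᵖ] M) (hp : Function.Surjective p) : RFlat A M := by
  refine RFlat.of_injective fun {N N'} _ _ _ _ f hf => ?_
  have _ := hA N'
  have _ := hA (N' ⧸ LinearMap.range f)
  have hi : Function.Injective (LinearMap.ker p).subtype := Submodule.subtype_injective _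
  have hip : Function.Exact (LinearMap.ker p).subtype p := LinearMap.exact_subtype_ker_map p
  have hfq : Function.Exact f (LinearMap.range f).mkQ := LinearMap.exact_map_mkQ_range f
  have hq : Function.Surjective (LinearMap.range f).mkQ := Submodule.mkQ_surjective _
  generalize (LinearMap.ker p).subtype = i at hi hip
  generalize (LinearMap.range f).mkQ = q at hfq hq
  rw [injective_iff_map_eq_zero]
  intro z hz
  -- A chase in the three by three diagram built from ker p → F → M and N → N' → N'/N. A lift x of z
  -- to F ⊗ N has image in F ⊗ N' coming from some k' in ker p ⊗ N'. Flatness of N'/N shows that k'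
  -- comes from ker p ⊗ N, and flatness of F shows that x does too, so z vanishes.
  obtain ⟨x, rfl⟩ := rTensor_surjective N p hp z
  rw [← rTensor_lTensor] at hz
  obtain ⟨k', hk'⟩ := (rTensor_exact N' i p hip hp _).1 hz
  have h1 : lTensor _ q k' = 0 := by
    refine LFlat.injective _ i hi ?_
    rw [rTensor_lTensor, hk', map_zero, ← lTensor_comp_apply, hfq.linearMap_comp_eq_zero,
      lTensor_zero_apply]
  obtain ⟨k, rfl⟩ := (lTensor_exact _ f q hfq hq _).1 h1
  rw [rTensor_lTensor] at hk'
  rw [← RFlat.injective _ f hf hk']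
  exact (rTensor_exact N i p hip hp _).2 ⟨k, rfl⟩

/-- Every right module over a von Neumann regular ring is flat. -/
theorem VonNeumannRegular.rFlat (hA : VonNeumannRegular A) (M : Type u) [AddCommGroup M]
    [Module Aᵐᵒᵖ M] : RFlat A M :=
  RFlat.of_surjective (fun N _ _ => hA.lFlat N) (Finsupp.linearCombination Aᵐᵒᵖ (id : M → M))
    (Finsupp.linearCombination_id_surjective Aᵐᵒᵖ M)

end ModuleTheory

/-! ### Comparison of tensor and cotensor products, and associativity. -/

section ComoduleTheory

variable {A : Type u} [Ring A] {B : Type u} [Ring B]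

/-! ### Morphisms of comodules -/

section Homs

variable {C : Coring A}

/-- The composition of morphisms of right comodules. -/
def RComodHom.comp {M M' M'' : Type u} [AddCommGroup M] [Module Aᵐᵒᵖ M] [RComodule C M]
    [AddCommGroup M'] [Module Aᵐᵒᵖ M'] [RComodule C M']
    [AddCommGroup M''] [Module Aᵐᵒᵖ M''] [RComodule C M'']
    (g : RComodHom C M' M'') (f : RComodHom C M M') : RComodHom C M M'' where
  lin := g.lin.comp f.lin
  colin m := by rw [rTensor_comp_apply, f.colin, g.colin]; rfl

/-- The composition of morphisms of left comodules. -/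
def LComodHom.comp {M M' M'' : Type u} [AddCommGroup M] [Module A M] [LComodule C M]
    [AddCommGroup M'] [Module A M'] [LComodule C M']
    [AddCommGroup M''] [Module A M''] [LComodule C M'']
    (g : LComodHom C M' M'') (f : LComodHom C M M') : LComodHom C M M'' where
  lin := g.lin.comp f.lin
  colin m := by rw [lTensor_comp_apply, f.colin, g.colin]; rfl

/-- A linear map into `M` is colinear if its composite with an injective morphism is. -/
theorem RComodHom.colin_of_comp [LFlat A C] {K M M' : Type u}
    [AddCommGroup K] [Module Aᵐᵒᵖ K] [RComodule C K] [AddCommGroup M] [Module Aᵐᵒᵖ M]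
    [RComodule C M] [AddCommGroup M'] [Module Aᵐᵒᵖ M'] [RComodule C M']
    (i : RComodHom C M M') (hi : Function.Injective i.lin) (f : RComodHom C K M')
    (g : K →ₗ[Aᵐᵒᵖ] M) (h : ∀ k, i.lin (g k) = f.lin k) (k : K) :
    rTensor C g (rho C k) = rho C (g k) := by
  refine LFlat.injective C i.lin hi ?_
  rw [i.colin, h, ← f.colin, ← rTensor_comp_apply]
  congr 2
  exact LinearMap.ext h

/-- A linear map into `M` is colinear if its composite with an injective morphism is. -/
theorem LComodHom.colin_of_comp [RFlat A C] {K M M' : Type u}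
    [AddCommGroup K] [Module A K] [LComodule C K] [AddCommGroup M] [Module A M]
    [LComodule C M] [AddCommGroup M'] [Module A M'] [LComodule C M']
    (i : LComodHom C M M') (hi : Function.Injective i.lin) (f : LComodHom C K M')
    (g : K →ₗ[A] M) (h : ∀ k, i.lin (g k) = f.lin k) (k : K) :
    lTensor C g (lam C k) = lam C (g k) := by
  refine RFlat.injective C i.lin hi ?_
  rw [i.colin, h, ← f.colin, ← lTensor_comp_apply]
  congr 2
  exact LinearMap.ext h

section Tmul

variable (M N : Type u) [AddCommGroup M] [Module Aᵐᵒᵖ M] [RComodule C M]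
  [AddCommGroup N] [Module A N] [LComodule C N]

/-- `m ↦ z ⊗ m` as a morphism `M → Z ⊗ M` of right comodules. -/
def tmulHomR {S Z : Type u} [Ring S] [Module S M] [SMulCommClass S Aᵐᵒᵖ M] [RCoactLin C S M]
    [AddCommGroup Z] [Module Sᵐᵒᵖ Z] (z : Z) : RComodHom C M (BTensor S Z M) where
  lin := tmulL A M z
  colin m := (rho_tmul C z m).symm

/-- `n ↦ n ⊗ z` as a morphism `N → N ⊗ Z` of left comodules. -/
def tmulHomL {T Z : Type u} [Ring T] [Module Tᵐᵒᵖ N] [SMulCommClass A Tᵐᵒᵖ N] [LCoactLin C T N]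
    [AddCommGroup Z] [Module T Z] (z : Z) : LComodHom C N (BTensor T N Z) where
  lin := tmulR A N z
  colin n := (lam_tmul C n z).symm

/-- The coaction as a morphism `M → M ⊗ C` of right comodules. -/
def rhoHom : RComodHom C M (BTensor A M C) where
  lin := rho C
  colin m := by
    refine (assoc A M A C C).injective ?_
    refine (RComodule.coassoc (C := C) m).symm.trans ?_
    exact (AddEquiv.apply_symm_apply (assoc A M A C C) _).symm

/-- The coaction as a morphism `N → C ⊗ N` of left comodules. -/
def lamHom : LComodHom C N (BTensor A C N) where
  lin := lam C
  colin n := (LComodule.coassoc (C := C) n).symm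

/-- `f ⊗ M : Z ⊗ M → Z' ⊗ M` as a morphism of right comodules. -/
def rTensorHom {S Z Z' : Type u} [Ring S] [Module S M] [SMulCommClass S Aᵐᵒᵖ M] [RCoactLin C S M]
    [AddCommGroup Z] [Module Sᵐᵒᵖ Z] [AddCommGroup Z'] [Module Sᵐᵒᵖ Z'] (f : Z →ₗ[Sᵐᵒᵖ] Z') :
    RComodHom C (BTensor S Z M) (BTensor S Z' M) where
  lin := rTensorLin A M f
  colin t := by
    induction t using induction_on with
    | h0 => simp only [map_zero]
    | ht z m =>
      rw [rho_tmul, ← rTensor_comp_apply]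
      exact (rho_tmul C (f z) m).symm
    | ha x y hx hy => simp only [map_add, hx, hy]

/-- `N ⊗ f : N ⊗ Z → N ⊗ Z'` as a morphism of left comodules. -/
def lTensorHom {T Z Z' : Type u} [Ring T] [Module Tᵐᵒᵖ N] [SMulCommClass A Tᵐᵒᵖ N] [LCoactLin C T N]
    [AddCommGroup Z] [Module T Z] [AddCommGroup Z'] [Module T Z'] (f : Z →ₗ[T] Z') :
    LComodHom C (BTensor T N Z) (BTensor T N Z') where
  lin := lTensorLin A N f
  colin t := by
    induction t using induction_on with
    | h0 => simp only [map_zero]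
    | ht n z =>
      rw [lam_tmul, ← lTensor_comp_apply]
      exact (lam_tmul C n (f z)).symm
    | ha x y hx hy => simp only [map_add, hx, hy]

end Tmul

/-- `Z ⊗ f : Z ⊗ M → Z ⊗ M'` as a morphism of right comodules. -/
def lTensorHomR {S M M' : Type u} (Z : Type u) [Ring S] [AddCommGroup M] [Module Aᵐᵒᵖ M]
    [RComodule C M] [Module S M] [SMulCommClass S Aᵐᵒᵖ M] [RCoactLin C S M]
    [AddCommGroup M'] [Module Aᵐᵒᵖ M'] [RComodule C M'] [Module S M'] [SMulCommClass S Aᵐᵒᵖ M']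
    [RCoactLin C S M'] [AddCommGroup Z] [Module Sᵐᵒᵖ Z] (f : RComodHom C M M')
    (g : M →ₗ[S] M') (h : ∀ m, g m = f.lin m) :
    RComodHom C (BTensor S Z M) (BTensor S Z M') where
  lin :=
    { toFun := lTensor Z g
      map_add' := map_add _
      map_smul' := lTensor_rsmul g fun s m => by rw [h, h, map_smul] }
  colin t := by
    induction t using induction_on with
    | h0 => simp only [map_zero]
    | ht z m =>
      rw [rho_tmul, ← rTensor_comp_apply]
      change _ = rho C (tmul S z (g m))
      rw [rho_tmul, h, ← f.colin, ← rTensor_comp_apply]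
      congr 2
      exact LinearMap.ext fun m => congrArg (tmul S z) (h m)
    | ha x y hx hy => simp only [map_add, hx, hy]

/-- `f ⊗ Z : N ⊗ Z → N' ⊗ Z` as a morphism of left comodules. -/
def rTensorHomL {T N N' : Type u} (Z : Type u) [Ring T] [AddCommGroup N] [Module A N]
    [LComodule C N] [Module Tᵐᵒᵖ N] [SMulCommClass A Tᵐᵒᵖ N] [LCoactLin C T N]
    [AddCommGroup N'] [Module A N'] [LComodule C N'] [Module Tᵐᵒᵖ N'] [SMulCommClass A Tᵐᵒᵖ N']
    [LCoactLin C T N'] [AddCommGroup Z] [Module T Z] (f : LComodHom C N N')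
    (g : N →ₗ[Tᵐᵒᵖ] N') (h : ∀ m, g m = f.lin m) :
    LComodHom C (BTensor T N Z) (BTensor T N' Z) where
  lin :=
    { toFun := rTensor Z g
      map_add' := map_add _
      map_smul' := rTensor_lsmul g fun s m => by rw [h, h, map_smul] }
  colin t := by
    induction t using induction_on with
    | h0 => simp only [map_zero]
    | ht m z =>
      rw [lam_tmul, ← lTensor_comp_apply]
      change _ = lam C (tmul T (g m) z)
      rw [lam_tmul, h, ← f.colin, ← lTensor_comp_apply]
      congr 2
      exact LinearMap.ext fun m => congrArg (fun x => tmul T x z) (h m)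
    | ha x y hx hy => simp only [map_add, hx, hy]

end Homs

/-! ### Bimodule structures on cotensor products -/

section Bimodule

variable {C : Coring A}

instance {M N S T : Type u} [AddCommGroup M] [Module Aᵐᵒᵖ M] [RComodule C M] [AddCommGroup N]
    [Module A N] [LComodule C N] [Ring S] [Module S M] [SMulCommClass S Aᵐᵒᵖ M] [RCoactLin C S M]
    [Ring T] [Module Tᵐᵒᵖ N] [SMulCommClass A Tᵐᵒᵖ N] [LCoactLin C T N] :
    SMulCommClass S Tᵐᵒᵖ (Cotensor C M N) where
  smul_comm s t k := incl_injective (smul_comm s t (incl k))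

variable {D : Coring B}

/-- The inclusion `M □ X → M ⊗ X` as a morphism of right comodules. -/
def inclHomR (M : Type u) [AddCommGroup M] [Module Aᵐᵒᵖ M] [RComodule C M] (X : Bicomod C D)
    [LFlat B D] : RComodHom D (Cotensor C M X) (BTensor A M X) where
  lin := inclR B
  colin := rho_incl M X

/-- The inclusion `X □ N → X ⊗ N` as a morphism of left comodules. -/
def inclHomL (X : Bicomod C D) (N : Type u) [AddCommGroup N] [Module B N] [LComodule D N]
    [RFlat A C] : LComodHom C (Cotensor D X N) (BTensor B X N) where
  lin := inclL A
  colin := lam_incl X N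

/-- This makes Z ⊗ (M □ X) a right comodule for every right S-module Z. Flatness of D over B allows
the check to be made inside M ⊗ X, where the coaction is linear. -/
instance {M S : Type u} [AddCommGroup M] [Module Aᵐᵒᵖ M] [RComodule C M] [Ring S] [Module S M]
    [SMulCommClass S Aᵐᵒᵖ M] [RCoactLin C S M] (X : Bicomod C D) [LFlat B D] :
    RCoactLin D S (Cotensor C M X) where
  rho_smul s k := by
    refine LFlat.injective D (inclR (C := C) (M := M) (N := X) B) incl_injective ?_
    rw [rho_incl, rTensor_lsmul _ (fun _ _ => rfl), rho_incl]
    exact RCoactLin.rho_smul s (incl k)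

instance {N T : Type u} [AddCommGroup N] [Module B N] [LComodule D N] [Ring T] [Module Tᵐᵒᵖ N]
    [SMulCommClass B Tᵐᵒᵖ N] [LCoactLin D T N] (X : Bicomod C D) [RFlat A C] :
    LCoactLin C T (Cotensor D X N) where
  lam_smul s k := by
    refine RFlat.injective C (inclL (C := D) (M := X) (N := N) A) incl_injective ?_
    rw [lam_incl, lTensor_rsmul _ (fun _ _ => rfl), lam_incl]
    exact LCoactLin.lam_smul s (incl k)

end Bimodule

/-! ### Tensoring a cotensor product with a module -/

section TensorCotensor

variable {C : Coring A} {S T : Type u} [Ring S] [Ring T]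
  {M N : Type u} [AddCommGroup M] [Module Aᵐᵒᵖ M] [RComodule C M]
  [AddCommGroup N] [Module A N] [LComodule C N]

/-- For a fixed z the map m ↦ z ⊗ m is colinear, and ω is natural for colinear maps. This gives the
claim on z ⊗ t. -/
theorem omega_assoc_symm [Module S M] [SMulCommClass S Aᵐᵒᵖ M] [RCoactLin C S M] {Z : Type u}
    [AddCommGroup Z] [Module Sᵐᵒᵖ Z] (t : BTensor S Z (BTensor A M N)) :
    omega C (BTensor S Z M) N ((assoc S Z A M N).symm t) =
      (assoc S Z A M (BTensor A C N)).symm (lTensor Z (omegaL C M N S) t) := by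
  induction t using induction_on with
  | h0 => simp only [map_zero]
  | ht z t =>
    rw [assoc_symm_eq, lTensor_tmul, assoc_symm_eq]
    exact omega_rTensor C (tmulHomR M z) t
  | ha x y hx hy => simp only [map_add, hx, hy]

theorem omega_assoc [Module Tᵐᵒᵖ N] [SMulCommClass A Tᵐᵒᵖ N] [LCoactLin C T N] {Z : Type u}
    [AddCommGroup Z] [Module T Z] (t : BTensor T (BTensor A M N) Z) :
    omega C M (BTensor T N Z) (assoc A M T N Z t) =
      lTensor M
        ({ toFun := assoc A C T N Z, map_add' := map_add _, map_smul' := assoc_lsmul } :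
          BTensor T (BTensor A C N) Z →ₗ[A] BTensor A C (BTensor T N Z))
        (assoc A M T (BTensor A C N) Z (rTensor Z (omegaR C M N T) t)) := by
  induction t using induction_on with
  | h0 => simp only [map_zero]
  | ht t z =>
    rw [assoc_tmul_eq, rTensor_tmul, assoc_tmul_eq, ← lTensor_comp_apply]
    refine (omega_lTensor C (tmulHomL N z) t).trans ?_
    exact congrArg (fun g => lTensor M g (omega C M N t))
      (LinearMap.ext fun u => (assoc_tmul_eq u z).symm)
  | ha x y hx hy => simp only [map_add, hx, hy]

theorem omega_assoc_symm_eq_zero_iff [Module S M] [SMulCommClass S Aᵐᵒᵖ M] [RCoactLin C S M]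
    {Z : Type u} [AddCommGroup Z] [Module Sᵐᵒᵖ Z] (t : BTensor S Z (BTensor A M N)) :
    omega C (BTensor S Z M) N ((assoc S Z A M N).symm t) = 0 ↔
      lTensor Z (omegaL C M N S) t = 0 := by
  rw [omega_assoc_symm, EmbeddingLike.map_eq_zero_iff]

/-- By `omega_assoc` the two maps differ only by associativity isomorphisms. One of these appears
inside M ⊗ -, where its inverse still supplies a left inverse. -/
theorem omega_assoc_eq_zero_iff [Module Tᵐᵒᵖ N] [SMulCommClass A Tᵐᵒᵖ N] [LCoactLin C T N]
    {Z : Type u} [AddCommGroup Z] [Module T Z] (t : BTensor T (BTensor A M N) Z) :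
    omega C M (BTensor T N Z) (assoc A M T N Z t) = 0 ↔ rTensor Z (omegaR C M N T) t = 0 := by
  have h : Function.Injective (lTensor M
      ({ toFun := assoc A C T N Z, map_add' := map_add _, map_smul' := assoc_lsmul } :
        BTensor T (BTensor A C N) Z →ₗ[A] BTensor A C (BTensor T N Z))) := by
    refine Function.LeftInverse.injective (g := lTensor M
      ({ toFun := (assoc A C T N Z).symm, map_add' := map_add _, map_smul' := assoc_symm_lsmul } :
        BTensor A C (BTensor T N Z) →ₗ[A] BTensor T (BTensor A C N) Z)) fun t => ?_
    rw [← lTensor_comp_apply]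
    refine Eq.trans ?_ (lTensor_id_apply t)
    congr 2
    exact LinearMap.ext fun u => (assoc A C T N Z).symm_apply_apply u
  rw [omega_assoc, map_eq_zero_iff _ h, EmbeddingLike.map_eq_zero_iff]

variable (M N) in
/-- The canonical map `Z ⊗ (M □ N) → (Z ⊗ M) □ N`. -/
def tensorCotensor [Module S M] [SMulCommClass S Aᵐᵒᵖ M] [RCoactLin C S M] (Z : Type u)
    [AddCommGroup Z] [Module Sᵐᵒᵖ Z] :
    BTensor S Z (Cotensor C M N) →+ Cotensor C (BTensor S Z M) N where
  toFun t := mk ((assoc S Z A M N).symm (lTensor Z (inclL S) t)) (by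
    rw [omega_assoc_symm_eq_zero_iff, ← lTensor_comp_apply]
    refine Eq.trans ?_ (lTensor_zero_apply t)
    congr 2
    exact LinearMap.ext omega_incl)
  map_zero' := incl_injective (by simp)
  map_add' x y := incl_injective (by simp)

variable (M N) in
/-- The canonical map `(M □ N) ⊗ Z → M □ (N ⊗ Z)`. -/
def cotensorTensor [Module Tᵐᵒᵖ N] [SMulCommClass A Tᵐᵒᵖ N] [LCoactLin C T N] (Z : Type u)
    [AddCommGroup Z] [Module T Z] :
    BTensor T (Cotensor C M N) Z →+ Cotensor C M (BTensor T N Z) where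
  toFun t := mk (assoc A M T N Z (rTensor Z (inclR T) t)) (by
    rw [omega_assoc_eq_zero_iff, ← rTensor_comp_apply]
    refine Eq.trans ?_ (rTensor_zero_apply t)
    congr 2
    exact LinearMap.ext omega_incl)
  map_zero' := incl_injective (by simp)
  map_add' x y := incl_injective (by simp)

section Left

variable [Module S M] [SMulCommClass S Aᵐᵒᵖ M] [RCoactLin C S M] {Z : Type u} [AddCommGroup Z]
  [Module Sᵐᵒᵖ Z]

theorem incl_tensorCotensor (t : BTensor S Z (Cotensor C M N)) :
    incl (tensorCotensor M N Z t) = (assoc S Z A M N).symm (lTensor Z (inclL S) t) := rfl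

theorem tensorCotensor_tmul (z : Z) (k : Cotensor C M N) :
    tensorCotensor M N Z (tmul S z k) = mapL N (tmulHomR M z) k :=
  incl_injective (assoc_symm_eq z (incl k))

theorem tensorCotensor_injective_iff : Function.Injective (tensorCotensor (C := C) (S := S) M N Z) ↔
    Function.Injective (lTensor Z (inclL (C := C) (M := M) (N := N) S)) := by
  rw [← incl_injective.of_comp_iff, ← (assoc S Z A M N).symm.injective.of_comp_iff]
  rfl

/-- The kernel of Z ⊗ ω_{M,N} is (Z ⊗ M) □ N, so being onto says that this kernel is the image of Z
⊗ (M □ N). -/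
theorem tensorCotensor_surjective_iff :
    Function.Surjective (tensorCotensor (C := C) (S := S) M N Z) ↔
    Function.Exact (lTensor Z (inclL (C := C) (M := M) (N := N) S))
      (lTensor Z (omegaL C M N S)) := by
  constructor
  · intro h t
    rw [← omega_assoc_symm_eq_zero_iff]
    constructor
    · intro ht
      obtain ⟨y, hy⟩ := h (mk _ ht)
      exact ⟨y, (assoc S Z A M N).symm.injective (congrArg incl hy)⟩
    · rintro ⟨y, rfl⟩
      exact omega_incl (tensorCotensor M N Z y)
  · intro h k
    obtain ⟨y, hy⟩ := (h (assoc S Z A M N (incl k))).1 (by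
      rw [← omega_assoc_symm_eq_zero_iff, AddEquiv.symm_apply_apply, omega_incl])
    refine ⟨y, incl_injective ?_⟩
    rw [incl_tensorCotensor, hy, AddEquiv.symm_apply_apply]

/-- M □ N is a kernel, and tensoring with a flat module preserves kernels. -/
theorem tensorCotensor_bijective_of_flat [RFlat S Z] :
    Function.Bijective (tensorCotensor (C := C) (S := S) M N Z) :=
  ⟨tensorCotensor_injective_iff.2 (RFlat.injective Z _ incl_injective),
    tensorCotensor_surjective_iff.2 (RFlat.exact _ _ fun t =>
      ⟨fun ht => ⟨mk t ht, rfl⟩, by rintro ⟨k, rfl⟩; exact omega_incl k⟩)⟩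

/-- The dictionary between purity and comparison maps: `tensorCotensor` is bijective precisely when
tensoring with Z preserves the kernel of ω. The equivalence `e` only identifies the cotensor product
with the kernel as a submodule. -/
theorem lPure_omegaL_iff : LPure (omegaL C M N S) ↔
    ∀ (Z : Type u) [AddCommGroup Z] [Module Sᵐᵒᵖ Z],
      Function.Bijective (tensorCotensor (C := C) (S := S) M N Z) := by
  let e : Cotensor C M N ≃ₗ[S] LinearMap.ker (omegaL C M N S) :=
    { toFun := fun k => ⟨incl k, omega_incl k⟩
      map_add' := fun _ _ => rfl
      map_smul' := fun _ _ => rfl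
      invFun := fun k => mk k.1 k.2
      left_inv := fun _ => rfl
      right_inv := fun _ => rfl }
  have h1 : inclL S = (LinearMap.ker (omegaL C M N S)).subtype.comp e.toLinearMap := rfl
  refine forall_congr' fun Z => forall_congr' fun _ => forall_congr' fun _ => ?_
  have h2 : Function.Bijective (lTensor Z e.toLinearMap) := by
    refine Function.bijective_iff_has_inverse.2 ⟨lTensor Z e.symm.toLinearMap, fun t => ?_,
      fun t => ?_⟩
    · rw [← lTensor_comp_apply]; exact lTensor_id_apply t
    · rw [← lTensor_comp_apply]; exact lTensor_id_apply t
  have h3 : ⇑(lTensor Z (inclL (C := C) (M := M) (N := N) S)) =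
      lTensor Z (LinearMap.ker (omegaL C M N S)).subtype ∘ lTensor Z e.toLinearMap := by
    ext t
    rw [h1, lTensor_comp_apply]; rfl
  rw [Function.Bijective, tensorCotensor_injective_iff, tensorCotensor_surjective_iff]
  unfold Function.Exact
  rw [h3, Function.Injective.of_comp_iff' _ h2, h2.surjective.range_comp]

end Left

section Right

variable [Module Tᵐᵒᵖ N] [SMulCommClass A Tᵐᵒᵖ N] [LCoactLin C T N] {Z : Type u} [AddCommGroup Z]
  [Module T Z]

theorem incl_cotensorTensor (t : BTensor T (Cotensor C M N) Z) :
    incl (cotensorTensor M N Z t) = assoc A M T N Z (rTensor Z (inclR T) t) := rfl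

theorem cotensorTensor_tmul (k : Cotensor C M N) (z : Z) :
    cotensorTensor M N Z (tmul T k z) = mapR M (tmulHomL N z) k :=
  incl_injective (assoc_tmul_eq (incl k) z)

theorem cotensorTensor_injective_iff : Function.Injective (cotensorTensor (C := C) (T := T) M N Z) ↔
    Function.Injective (rTensor Z (inclR (C := C) (M := M) (N := N) T)) := by
  rw [← incl_injective.of_comp_iff, ← (assoc A M T N Z).injective.of_comp_iff]
  rfl

theorem cotensorTensor_surjective_iff :
    Function.Surjective (cotensorTensor (C := C) (T := T) M N Z) ↔
    Function.Exact (rTensor Z (inclR (C := C) (M := M) (N := N) T))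
      (rTensor Z (omegaR C M N T)) := by
  constructor
  · intro h t
    rw [← omega_assoc_eq_zero_iff]
    constructor
    · intro ht
      obtain ⟨y, hy⟩ := h (mk _ ht)
      exact ⟨y, (assoc A M T N Z).injective (congrArg incl hy)⟩
    · rintro ⟨y, rfl⟩
      exact omega_incl (cotensorTensor M N Z y)
  · intro h k
    obtain ⟨y, hy⟩ := (h ((assoc A M T N Z).symm (incl k))).1 (by
      rw [← omega_assoc_eq_zero_iff, AddEquiv.apply_symm_apply, omega_incl])
    refine ⟨y, incl_injective ?_⟩
    rw [incl_cotensorTensor, hy, AddEquiv.apply_symm_apply]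

theorem cotensorTensor_bijective_of_flat [LFlat T Z] :
    Function.Bijective (cotensorTensor (C := C) (T := T) M N Z) :=
  ⟨cotensorTensor_injective_iff.2 (LFlat.injective Z _ incl_injective),
    cotensorTensor_surjective_iff.2 (LFlat.exact _ _ fun t =>
      ⟨fun ht => ⟨mk t ht, rfl⟩, by rintro ⟨k, rfl⟩; exact omega_incl k⟩)⟩

end Right

end TensorCotensor

/-! ### Associativity of the cotensor product -/

section Associativity

variable {C : Coring A} {D : Coring B} [LFlat B D] [RFlat A C]
  {M N : Type u} [AddCommGroup M] [Module Aᵐᵒᵖ M] [RComodule C M]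
  [AddCommGroup N] [Module B N] [LComodule D N] {X : Bicomod C D}

/-- Half of the associativity of the cotensor product. Enlarging M □ X to M ⊗ X sends w to (M ⊗ X) □
N, and `h1` lifts the result to y in M ⊗ (X □ N). It remains to see that y lies in M □ (X □ N), and
`h2` permits this to be tested inside (M ⊗ C) ⊗ X ⊗ N, where it follows from w having come from M □
X. -/
theorem exists_corresponds_right
    (h1 : Function.Surjective (tensorCotensor (C := D) (S := A) X N M))
    (h2 : Function.Injective (tensorCotensor (C := D) (S := A) X N (BTensor A M C)))
    (w : Cotensor D (Cotensor C M X) N) :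
    ∃ w' : Cotensor C M (Cotensor D X N), Corresponds w w' := by
  obtain ⟨y, hy⟩ := h1 (mapL N (inclHomR M X) w)
  have hy' : (assoc A M B X N).symm (lTensor M (inclL A) y) = rTensor N (inclR B) (incl w) :=
    congrArg incl hy
  refine ⟨mk y ?_, ?_⟩
  · rw [omega_apply, sub_eq_zero, ← AddEquiv.eq_symm_apply]
    refine h2 (incl_injective ?_)
    -- The map M ⊗ λ_X with its target reassociated. By `hl` it agrees with ρ_M ⊗ X on M □ X, and
    -- `key` identifies the coaction M ⊗ λ_{X⊗N} with `l` ⊗ N; together they give the required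
    -- equation.
    let l : BTensor A M X →ₗ[Bᵐᵒᵖ] BTensor A (BTensor A M C) X :=
      { toFun := fun t => (assoc A M A C X).symm (lTensor M (lam C) t)
        map_add' := fun x y => by rw [map_add, map_add]
        map_smul' := fun s x => by
          rw [lTensor_rsmul (lam C) (LCoactLin.lam_smul (C := C) (T := B)), assoc_symm_rsmul]
          rfl }
    have hl : l.comp (inclR B) = (rTensorLin B X (rho C)).comp (inclR B) :=
      LinearMap.ext fun k =>
        (assoc A M A C X).symm_apply_eq.2 (sub_eq_zero.1 (omega_incl k)).symm
    have key : ∀ t, (assoc A (BTensor A M C) B X N).symm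
        ((assoc A M A C (BTensor B X N)).symm (lTensor M (lam C) (assoc A M B X N t))) =
        rTensor N l t := fun t => by
      refine DFunLike.congr_fun (f := (assoc A (BTensor A M C) B X N).symm.toAddMonoidHom.comp
        ((assoc A M A C (BTensor B X N)).symm.toAddMonoidHom.comp ((lTensor M (lam C)).comp
          (assoc A M B X N).toAddMonoidHom))) (g := rTensor N l) (hom_ext₃ fun m x n => ?_) t
      change (assoc A (BTensor A M C) B X N).symm ((assoc A M A C (BTensor B X N)).symm
        (tmul A m (lam C (tmul B x n)))) = tmul B ((assoc A M A C X).symm (tmul A m (lam C x))) n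
      rw [lam_tmul]
      induction lam C x using induction_on with
      | h0 => simp [tmul_zero, zero_tmul]
      | ht c x => rfl
      | ha x y hx hy => simp only [map_add, tmul_add, add_tmul, hx, hy]
    have e1 : lTensor M (lTensorLin A C (inclL A)) (lTensor M (lam C) y) =
        lTensor M (lam C) (lTensor M (inclL (C := D) (M := X) (N := N) A) y) := by
      rw [← lTensor_comp_apply, ← lTensor_comp_apply]
      congr 2
      exact LinearMap.ext (lam_incl X N)
    have e2 : (assoc A M A C (BTensor B X N)).symm
        (lTensor M (lTensorLin A C (inclL A)) (lTensor M (lam C) y)) =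
        lTensor (BTensor A M C) (inclL (C := D) (M := X) (N := N) A)
          ((assoc A M A C (Cotensor D X N)).symm (lTensor M (lam C) y)) := by
      rw [AddEquiv.symm_apply_eq, assoc_lTensor, AddEquiv.apply_symm_apply]
    rw [incl_tensorCotensor, incl_tensorCotensor, ← e2, e1, ← rTensor_lTensor,
      ← AddEquiv.apply_symm_apply (assoc A M B X N) (lTensor M (inclL A) y), key,
      ← assoc_rTensor_rTensor, AddEquiv.symm_apply_apply, hy', ← rTensor_comp_apply,
      ← rTensor_comp_apply, hl]
  · exact ((AddEquiv.symm_apply_eq _).1 hy').symm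

/-- The mirror of `exists_corresponds_right`: now X □ N is enlarged to X ⊗ N, the lift y lies in (M
□ X) ⊗ N, and the defining equation of X □ N gives that of (M □ X) □ N. -/
theorem exists_corresponds_left
    (h1 : Function.Surjective (cotensorTensor (C := C) (T := B) M X N))
    (h2 : Function.Injective (cotensorTensor (C := C) (T := B) M X (BTensor B D N)))
    (w' : Cotensor C M (Cotensor D X N)) :
    ∃ w : Cotensor D (Cotensor C M X) N, Corresponds w w' := by
  obtain ⟨y, hy⟩ := h1 (mapR M (inclHomL X N) w')
  have hy' : assoc A M B X N (rTensor N (inclR B) y) = lTensor M (inclL A) (incl w') :=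
    congrArg incl hy
  refine ⟨mk y ?_, hy'⟩
  rw [omega_apply, sub_eq_zero]
  refine h2 (incl_injective ?_)
  let l : BTensor B X N →ₗ[A] BTensor B X (BTensor B D N) :=
    { toFun := fun t => assoc B X B D N (rTensor N (rho D) t)
      map_add' := fun x y => by rw [map_add, map_add]
      map_smul' := fun s x => by
        rw [rTensor_lsmul (rho D) (RCoactLin.rho_smul (C := D) (S := A)), assoc_lsmul]
        rfl }
  have hl : l.comp (inclL A) = (lTensorLin A X (lam D)).comp (inclL A) :=
    LinearMap.ext fun k => sub_eq_zero.1 (omega_incl k)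
  have key : ∀ t, assoc A M B X (BTensor B D N)
      (assoc B (BTensor A M X) B D N (rTensor N (rho D) t)) =
      lTensor M l (assoc A M B X N t) := fun t => by
    refine DFunLike.congr_fun (f := (assoc A M B X (BTensor B D N)).toAddMonoidHom.comp
      ((assoc B (BTensor A M X) B D N).toAddMonoidHom.comp (rTensor N (rho D))))
      (g := (lTensor M l).comp (assoc A M B X N).toAddMonoidHom) (hom_ext₃ fun m x n => ?_) t
    change assoc A M B X (BTensor B D N) (assoc B (BTensor A M X) B D N
      (tmul B (rho D (tmul A m x)) n)) = tmul A m (assoc B X B D N (tmul B (rho D x) n))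
    rw [rho_tmul]
    induction rho D x using induction_on with
    | h0 => simp [tmul_zero, zero_tmul]
    | ht c x => rfl
    | ha x y hx hy => simp only [map_add, tmul_add, add_tmul, hx, hy]
  have e1 : rTensor N (rTensorLin B D (inclR B)) (rTensor N (rho D) y) =
      rTensor N (rho D) (rTensor N (inclR (C := C) (M := M) (N := X) B) y) := by
    rw [← rTensor_comp_apply, ← rTensor_comp_apply]
    congr 2
    exact LinearMap.ext (rho_incl M X)
  rw [incl_cotensorTensor, incl_cotensorTensor, ← assoc_rTensor_rTensor, e1, key, hy',
    rTensor_lTensor, assoc_lTensor, hy', ← lTensor_comp_apply, ← lTensor_comp_apply, hl]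

end Associativity

end ComoduleTheory

/-! ### From the maps ψ and ω to an adjunction on right comodules. -/

section Adjunction

variable {A : Type u} [Ring A] {B : Type u} [Ring B] {C : Coring A} {D : Coring B}

/-! ### Constructions of morphisms of right comodules -/

section RightHoms

/-- The lift of a morphism along an injective morphism. -/
def RComodHom.lift [LFlat A C] {K M M' : Type u}
    [AddCommGroup K] [Module Aᵐᵒᵖ K] [RComodule C K] [AddCommGroup M] [Module Aᵐᵒᵖ M]
    [RComodule C M] [AddCommGroup M'] [Module Aᵐᵒᵖ M'] [RComodule C M']
    (i : RComodHom C M M') (hi : Function.Injective i.lin) (f : RComodHom C K M')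
    (g : K → M) (h : ∀ k, i.lin (g k) = f.lin k) : RComodHom C K M where
  lin :=
    { toFun := g
      map_add' := fun x y => hi (by rw [map_add, h, h, h, map_add])
      map_smul' := fun s x => hi (by rw [map_smul, h, h, map_smul]; rfl) }
  colin := RComodHom.colin_of_comp i hi f _ h

/-- The inverse of a bijective morphism. -/
def RComodHom.inverse {M M' : Type u} [AddCommGroup M] [Module Aᵐᵒᵖ M] [RComodule C M]
    [AddCommGroup M'] [Module Aᵐᵒᵖ M'] [RComodule C M'] (f : RComodHom C M M')
    (hf : Function.Bijective f.lin) : RComodHom C M' M where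
  lin := (LinearEquiv.ofBijective f.lin hf).symm.toLinearMap
  colin m := by
    obtain ⟨m, rfl⟩ := hf.2 m
    have h : ∀ m, (LinearEquiv.ofBijective f.lin hf).symm.toLinearMap (f.lin m) = m :=
      (LinearEquiv.ofBijective f.lin hf).symm_apply_apply
    have h' : (LinearEquiv.ofBijective f.lin hf).symm.toLinearMap.comp f.lin =
      LinearMap.id (R := Aᵐᵒᵖ) := LinearMap.ext h
    rw [← f.colin, ← rTensor_comp_apply, h', h, rTensor_id_apply]

@[simp]
theorem RComodHom.inverse_apply {M M' : Type u} [AddCommGroup M] [Module Aᵐᵒᵖ M] [RComodule C M]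
    [AddCommGroup M'] [Module Aᵐᵒᵖ M'] [RComodule C M'] (f : RComodHom C M M')
    (hf : Function.Bijective f.lin) (m : M) : (f.inverse hf).lin (f.lin m) = m :=
  (LinearEquiv.ofBijective f.lin hf).symm_apply_apply m

/-- A map on `Z ⊗ M` whose composites with the maps `m ↦ z ⊗ m` are morphisms is a morphism. -/
def RComodHom.ofTensor {S Z M P : Type u} [Ring S] [AddCommGroup Z] [Module Sᵐᵒᵖ Z]
    [AddCommGroup M] [Module Aᵐᵒᵖ M] [RComodule C M] [Module S M] [SMulCommClass S Aᵐᵒᵖ M]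
    [RCoactLin C S M] [AddCommGroup P] [Module Aᵐᵒᵖ P] [RComodule C P]
    (f : BTensor S Z M →+ P) (g : Z → RComodHom C M P)
    (h : ∀ z m, f (tmul S z m) = (g z).lin m) : RComodHom C (BTensor S Z M) P where
  lin :=
    { toFun := f
      map_add' := map_add f
      map_smul' := fun s t => by
        induction t using induction_on with
        | h0 => simp
        | ht z m => rw [rsmul_tmul, h, h, map_smul]; rfl
        | ha x y hx hy => simp only [smul_add, map_add, hx, hy] }
  colin t := by
    induction t using induction_on with
    | h0 => simp only [map_zero]
    | ht z m =>
      change _ = rho C (f (tmul S z m))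
      rw [rho_tmul, ← rTensor_comp_apply, h, ← (g z).colin]
      congr 2
      exact LinearMap.ext (h z)
    | ha x y hx hy => simp only [map_add, hx, hy]

theorem mapL_comp {M M' M'' N : Type u} [AddCommGroup M] [Module Aᵐᵒᵖ M] [RComodule C M]
    [AddCommGroup M'] [Module Aᵐᵒᵖ M'] [RComodule C M']
    [AddCommGroup M''] [Module Aᵐᵒᵖ M''] [RComodule C M''] [AddCommGroup N] [Module A N]
    [LComodule C N] (g : RComodHom C M' M'') (f : RComodHom C M M') (k : Cotensor C M N) :
    mapL N g (mapL N f k) = mapL N (g.comp f) k :=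
  incl_injective (rTensor_comp_apply g.lin f.lin (incl k)).symm

end RightHoms

/-! ### Contraction with the counit -/

section Contraction

variable (C) (M : Type u) [AddCommGroup M] [Module Aᵐᵒᵖ M]

/-- The map `M ⊗ C → M` given by the counit. -/
def contractR : BTensor A M C →ₗ[Aᵐᵒᵖ] M where
  toFun := lift (fun m c => op (C.counit c) • m) (fun m m' c => smul_add _ _ _)
    (fun m c c' => by rw [map_add, MulOpposite.op_add, add_smul])
    (fun m a c => by rw [map_smul, smul_smul]; rfl)
  map_add' := map_add _
  map_smul' s t := by
    induction t using induction_on with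
    | h0 => simp
    | ht m c =>
      change op (C.counit (s • c)) • m = s • op (C.counit c) • m
      rw [C.counit_rsmul, smul_smul]
      rfl
    | ha x y hx hy => simp only [smul_add, map_add, hx, hy]

variable {C M}

@[simp]
theorem contractR_tmul (m : M) (c : C) : contractR C M (tmul A m c) = op (C.counit c) • m := rfl

theorem contractR_rTensor {M' : Type u} [AddCommGroup M'] [Module Aᵐᵒᵖ M'] (f : M →ₗ[Aᵐᵒᵖ] M')
    (t : BTensor A M C) : contractR C M' (rTensor C f t) = f (contractR C M t) := by
  induction t using induction_on with
  | h0 => simp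
  | ht m c => simp
  | ha x y hx hy => simp only [map_add, hx, hy]

theorem contractR_lsmul {S : Type u} [Ring S] [Module S M] [SMulCommClass S Aᵐᵒᵖ M] (s : S)
    (t : BTensor A M C) : contractR C M (s • t) = s • contractR C M t := by
  induction t using induction_on with
  | h0 => simp
  | ht m c => exact (smul_comm s (op (C.counit c)) m).symm
  | ha x y hx hy => simp only [smul_add, map_add, hx, hy]

variable [RComodule C M]

@[simp]
theorem contractR_rho (m : M) : contractR C M (rho C m) = m := by
  obtain ⟨r, -, hr⟩ := tmul_one_surjective (A := A) (M := M)
  have h : ∀ t : BTensor A M C, contractR C M t = r (lTensor M C.counit t) := fun t => by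
    induction t using induction_on with
    | h0 => simp
    | ht m c => rw [lTensor_tmul, hr]; rfl
    | ha x y hx hy => simp only [map_add, hx, hy]
  have h1 : lTensor M C.counit (rho C m) = tmul A m (1 : A) := RComodule.counit (C := C) m
  rw [h, h1, hr, op_one, one_smul]

theorem rho_injective : Function.Injective (rho C : M →ₗ[Aᵐᵒᵖ] BTensor A M C) :=
  Function.LeftInverse.injective (g := contractR C M) contractR_rho

/-- Contracting the last factor of M ⊗ C ⊗ C turns ρ_M ⊗ C into ρ after contraction, and M ⊗ Δ into
the identity. The two agree on M □ C. Thus the coaction identifies M with M □ C, and the counit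
gives the inverse. -/
theorem rho_contractR (k : Cotensor C M C) : rho C (contractR C M (incl k)) = incl k := by
  let p : BTensor A C C →ₗ[A] C :=
    { toFun := contractR C C, map_add' := map_add _, map_smul' := contractR_lsmul }
  have h1 : ∀ t : BTensor A M C, lTensor M p (assoc A M A C C (rTensor C (rho C) t)) =
      rho C (contractR C M t) := fun t => by
    induction t using induction_on with
    | h0 => simp
    | ht m c =>
      rw [rTensor_tmul, contractR_tmul, map_smul]
      induction rho C m using induction_on with
      | h0 => simp [zero_tmul]
      | ht m c' => rfl
      | ha x y hx hy => simp only [map_add, add_tmul, smul_add, hx, hy]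
    | ha x y hx hy => simp only [map_add, hx, hy]
  have h2 : p.comp (lam C) = LinearMap.id := LinearMap.ext fun c => contractR_rho (C := C) c
  have h3 : assoc A M A C C (rTensor C (rho C) (incl k)) = lTensor M (lam C) (incl k) :=
    sub_eq_zero.1 (omega_incl k)
  rw [← h1, h3, ← lTensor_comp_apply, h2, lTensor_id_apply]

end Contraction

/-! ### The adjunction of the cotensor functors on right comodules -/

section RightAdjunction

variable [LFlat A C] [RFlat A C] [LFlat B D] [RFlat B D] {X : Bicomod C D} {Λ : Bicomod D C}

/-- The canonical map `Z ⊗ (M □ X) → (Z ⊗ M) □ X` as a morphism of right comodules. -/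
def tensorCotensorHom (M : Type u) [AddCommGroup M] [Module Aᵐᵒᵖ M] [RComodule C M] {S : Type u}
    [Ring S] [Module S M] [SMulCommClass S Aᵐᵒᵖ M] [RCoactLin C S M] (X : Bicomod C D)
    (Z : Type u) [AddCommGroup Z] [Module Sᵐᵒᵖ Z] :
    RComodHom D (BTensor S Z (Cotensor C M X)) (Cotensor C (BTensor S Z M) X) :=
  RComodHom.ofTensor (tensorCotensor M X Z) (fun z => mapLHom X (tmulHomR M z))
    tensorCotensor_tmul

/-- A correspondence through associativity becomes an equation in (M ⊗ X) □ N, the form suited to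
the counit, which is defined by inverting `tensorCotensor`. -/
theorem Corresponds.tensorCotensor_eq {M N : Type u} [AddCommGroup M] [Module Aᵐᵒᵖ M]
    [RComodule C M] [AddCommGroup N] [Module B N] [LComodule D N]
    {w : Cotensor D (Cotensor C M X) N} {w' : Cotensor C M (Cotensor D X N)}
    (h : Corresponds w w') : tensorCotensor X N M (incl w') = mapL N (inclHomR M X) w :=
  incl_injective ((AddEquiv.symm_apply_eq _).2 h.symm)

/-- For a bicolinear map `ψ : C → X □ Λ`, the morphism `W ⊗ C → (W ⊗ X) □ Λ` that maps `w ⊗ c` to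
`w ⊗ ψ(c)`. -/
def tensorUnit (ψ : RComodHom C C (Cotensor D X Λ))
    (hψ : ∀ (a : A) (c : C), ψ.lin (a • c) = a • ψ.lin c) (W : Type u) [AddCommGroup W]
    [Module Aᵐᵒᵖ W] : RComodHom C (BTensor A W C) (Cotensor D (BTensor A W X) Λ) :=
  RComodHom.comp (tensorCotensorHom X Λ W) (lTensorHomR W ψ
    { toFun := ψ.lin, map_add' := map_add _, map_smul' := hψ } fun _ => rfl)

theorem tensorUnit_tmul (ψ : RComodHom C C (Cotensor D X Λ))
    (hψ : ∀ (a : A) (c : C), ψ.lin (a • c) = a • ψ.lin c) {W : Type u} [AddCommGroup W]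
    [Module Aᵐᵒᵖ W] (w : W) (c : C) :
    (tensorUnit ψ hψ W).lin (tmul A w c) = mapL Λ (tmulHomR X w) (ψ.lin c) :=
  tensorCotensor_tmul w _

/-- Replaces the associativity in `Corresponds` by the explicit formula m ↦ m₀ ⊗ ψ(m₁) with values
in (M ⊗ X) □ Λ. The left and right linear versions of ψ are the same map. -/
theorem corresponds_iff (ψ : BicomodHom C C C (Cotensor D X Λ))
    (hψ : ∀ (a : A) (c : C), ψ.right.lin (a • c) = a • ψ.right.lin c) {M : Type u} [AddCommGroup M]
    [Module Aᵐᵒᵖ M] [RComodule C M] (w : Cotensor D (Cotensor C M X) Λ) (m : M) :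
    Corresponds w (mapR M ψ.left (unitR m)) ↔
      mapL Λ (inclHomR M X) w = (tensorUnit ψ.right hψ M).lin (rho C m) := by
  have h : ψ.left.lin = { toFun := ψ.right.lin, map_add' := map_add _, map_smul' := hψ } :=
    LinearMap.ext ψ.eq
  rw [← incl_injective.eq_iff]
  unfold Corresponds
  rw [← AddEquiv.eq_symm_apply, incl_mapR, h]
  rfl

/-- The counit of the adjunction between tensor and cotensor products, for a bicolinear map
`ω : Λ □ X → D`: the composite `(N ⊗ Λ) □ X ≅ N ⊗ (Λ □ X) → N ⊗ D`. -/
def tensorCounit (ω : BicomodHom D D (Cotensor C Λ X) D) (N : Type u) [AddCommGroup N]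
    [Module Bᵐᵒᵖ N] (hN : Function.Bijective (tensorCotensor (C := C) (S := B) Λ X N)) :
    RComodHom D (Cotensor C (BTensor B N Λ) X) (BTensor B N D) :=
  (lTensorHomR N ω.right ω.left.lin ω.eq).comp ((tensorCotensorHom Λ X N).inverse hN)

theorem tensorCounit_tensorCotensor (ω : BicomodHom D D (Cotensor C Λ X) D) {N : Type u}
    [AddCommGroup N] [Module Bᵐᵒᵖ N]
    (hN : Function.Bijective (tensorCotensor (C := C) (S := B) Λ X N))
    (y : BTensor B N (Cotensor C Λ X)) :
    (tensorCounit ω N hN).lin (tensorCotensor Λ X N y) = lTensor N ω.left.lin y :=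
  congrArg (lTensor N ω.left.lin)
    (RComodHom.inverse_apply (tensorCotensorHom Λ X N) hN y)

theorem mapL_rTensorHom_tensorCotensor {N N' : Type u} [AddCommGroup N] [Module Bᵐᵒᵖ N]
    [AddCommGroup N'] [Module Bᵐᵒᵖ N'] (f : N →ₗ[Bᵐᵒᵖ] N') (y : BTensor B N (Cotensor C Λ X)) :
    mapL X (rTensorHom Λ f) (tensorCotensor Λ X N y) =
      tensorCotensor Λ X N' (rTensor (Cotensor C Λ X) f y) := by
  induction y using induction_on with
  | h0 => simp only [map_zero]
  | ht n k =>
    rw [rTensor_tmul, tensorCotensor_tmul, tensorCotensor_tmul, mapL_comp]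
    rfl
  | ha x y hx hy => simp only [map_add, hx, hy]

/-- Naturality holds for all linear maps, not only for colinear ones. This is what allows the
triangle identities to be moved to tensor products and reduced to pure tensors. -/
theorem tensorCounit_naturality (ω : BicomodHom D D (Cotensor C Λ X) D) {N N' : Type u}
    [AddCommGroup N] [Module Bᵐᵒᵖ N] [AddCommGroup N'] [Module Bᵐᵒᵖ N']
    (hN : Function.Bijective (tensorCotensor (C := C) (S := B) Λ X N))
    (hN' : Function.Bijective (tensorCotensor (C := C) (S := B) Λ X N')) (f : N →ₗ[Bᵐᵒᵖ] N')
    (k : Cotensor C (BTensor B N Λ) X) :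
    (tensorCounit ω N' hN').lin (mapL X (rTensorHom Λ f) k) =
      rTensor D f ((tensorCounit ω N hN).lin k) := by
  obtain ⟨y, rfl⟩ := hN.2 k
  rw [mapL_rTensorHom_tensorCotensor, tensorCounit_tensorCotensor, tensorCounit_tensorCotensor,
    rTensor_lTensor]

/-- The map `M ⊗ X → (M ⊗ C) □ X` given by the left coaction of `X`. -/
def tensorLam (M : Type u) [AddCommGroup M] [Module Aᵐᵒᵖ M] (X : Type u) [AddCommGroup X]
    [Module A X] [LComodule C X] : BTensor A M X →+ Cotensor C (BTensor A M C) X where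
  toFun t := mk ((assoc A M A C X).symm (lTensor M (lam C) t)) (by
    induction t using induction_on with
    | h0 => simp only [map_zero]
    | ht m x =>
      rw [lTensor_tmul, assoc_symm_eq]
      exact omega_incl (mapL X (tmulHomR C m) (unitL x))
    | ha x y hx hy => simp only [map_add, hx, hy, add_zero])
  map_zero' := incl_injective (by simp)
  map_add' x y := incl_injective (by simp)

theorem tensorLam_tmul {M X : Type u} [AddCommGroup M] [Module Aᵐᵒᵖ M] [AddCommGroup X]
    [Module A X] [LComodule C X] (m : M) (x : X) :
    tensorLam (C := C) M X (tmul A m x) = mapL X (tmulHomR C m) (unitL x) :=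
  incl_injective (assoc_symm_eq m _)

/-- On M □ X the maps M ⊗ λ_X and ρ_M ⊗ X agree; this is the defining equation of the cotensor
product. -/
theorem tensorLam_incl {M X : Type u} [AddCommGroup M] [Module Aᵐᵒᵖ M] [RComodule C M]
    [AddCommGroup X] [Module A X] [LComodule C X] (k : Cotensor C M X) :
    tensorLam M X (incl k) = mapL X (rhoHom M) k :=
  incl_injective ((AddEquiv.symm_apply_eq _).2 (sub_eq_zero.1 (omega_incl k)).symm)

/-- The maps `ψ` and `ω` of the unit-counit condition are the unit and the counit of an adjunction
if the cotensor products `Λ □ X` and `M □ X` are compatible with the relevant tensor products. -/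
theorem UnitCounit.rightAdjunction (h : UnitCounit X Λ)
    (hX : ∀ (Z : Type u) [AddCommGroup Z] [Module Bᵐᵒᵖ Z],
      Function.Bijective (tensorCotensor (C := C) (S := B) Λ X Z))
    (hΛ : ∀ (M : Type u) [AddCommGroup M] [Module Aᵐᵒᵖ M] [RComodule C M],
      Function.Bijective (cotensorTensor (C := C) (T := B) M X Λ))
    (hDΛ : ∀ (M : Type u) [AddCommGroup M] [Module Aᵐᵒᵖ M] [RComodule C M],
      Function.Injective (cotensorTensor (C := C) (T := B) M X (BTensor B D Λ))) :
    RightAdjunction X Λ := by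
  obtain ⟨ψ, ω, h1, h2⟩ := h
  have hψ : ∀ (a : A) (c : C), ψ.right.lin (a • c) = a • ψ.right.lin c := fun a c => by
    rw [← ψ.eq, ← ψ.eq, map_smul]
  -- Injectivity of the comparison map makes (M □ X) □ Λ → (M ⊗ X) □ Λ injective. The unit may
  -- therefore be prescribed, and equations for it checked, in the larger comodule.
  have hj : ∀ (M : Type u) [AddCommGroup M] [Module Aᵐᵒᵖ M] [RComodule C M],
      Function.Injective (mapL (C := D) Λ (inclHomR M X)) := fun M _ _ _ x y hxy =>
    incl_injective (cotensorTensor_injective_iff.1 (hΛ M).1 (congrArg incl hxy))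
  -- The value m₀ ⊗ ψ(m₁) lies in M □ (X □ Λ); associativity moves it to (M □ X) □ Λ.
  have hη := fun (M : RComod C) (m : M) =>
    exists_corresponds_left (hΛ M).2 (hDΛ M) (mapR M ψ.left (unitR m))
  let η : ∀ M : RComod C, RComodHom C M (Cotensor D (Cotensor C M X) Λ) := fun M =>
    RComodHom.lift (mapLHom Λ (inclHomR M X)) (hj M) ((tensorUnit ψ.right hψ M).comp (rhoHom M))
      (fun m => (hη M m).choose) (fun m => (corresponds_iff ψ hψ _ m).1 (hη M m).choose_spec)
  have hηj : ∀ (M : RComod C) (m : M), mapL Λ (inclHomR M X) ((η M).lin m) =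
      (tensorUnit ψ.right hψ M).lin (rho C m) := fun M m =>
    (corresponds_iff ψ hψ _ m).1 (hη M m).choose_spec
  have ηnat : ∀ {M M' : RComod C} (f : RComodHom C M M') (m : M),
      (η M').lin (f.lin m) = mapL Λ (mapLHom X f) ((η M).lin m) := fun {M M'} f m => by
    refine hj M' ?_
    have e : (inclHomR M' X).comp (mapLHom X f) =
        (rTensorHom X f.lin).comp (inclHomR M X) := rfl
    rw [hηj, mapL_comp, e, ← mapL_comp, hηj, ← f.colin]
    generalize rho C m = t
    induction t using induction_on with
    | h0 => simp only [map_zero]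
    | ht m c =>
      rw [rTensor_tmul, tensorUnit_tmul, tensorUnit_tmul, mapL_comp]
      rfl
    | ha x y hx hy => simp only [map_add, hx, hy]
  -- The counit before restriction from N ⊗ Λ to N □ Λ. It needs no coaction on N and is natural for
  -- all linear maps.
  let θ : ∀ (N : Type u) [AddCommGroup N] [Module Bᵐᵒᵖ N],
      Cotensor C (BTensor B N Λ) X →ₗ[Bᵐᵒᵖ] N := fun N _ _ =>
    (contractR D N).comp (tensorCounit ω N (hX N)).lin
  have θnat : ∀ {N N' : Type u} [AddCommGroup N] [Module Bᵐᵒᵖ N] [AddCommGroup N']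
      [Module Bᵐᵒᵖ N'] (f : N →ₗ[Bᵐᵒᵖ] N') (k : Cotensor C (BTensor B N Λ) X),
      θ N' (mapL X (rTensorHom Λ f) k) = f (θ N k) := fun {N N'} _ _ _ _ f k => by
    change contractR D N' ((tensorCounit ω N' (hX N')).lin (mapL X (rTensorHom Λ f) k)) =
      f (contractR D N ((tensorCounit ω N (hX N)).lin k))
    rw [tensorCounit_naturality ω (hX N) (hX N'), contractR_rTensor]
  have hθ : ∀ {N : Type u} [AddCommGroup N] [Module Bᵐᵒᵖ N] [RComodule D N]
      {w : Cotensor C (Cotensor D N Λ) X} {w' : Cotensor D N (Cotensor C Λ X)},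
      Corresponds w w' → (tensorCounit ω N (hX N)).lin (mapL X (inclHomR N Λ) w) =
        incl (mapR N ω.left w') := fun {N} _ _ _ w w' hw => by
    rw [← hw.tensorCotensor_eq, tensorCounit_tensorCotensor]; rfl
  let ε : ∀ N : RComod D, RComodHom D (Cotensor C (Cotensor D N Λ) X) N := fun N =>
    RComodHom.lift (rhoHom N) rho_injective
      ((tensorCounit ω N (hX N)).comp (mapLHom X (inclHomR N Λ)))
      (fun k => θ N (mapL X (inclHomR N Λ) k)) (fun k => by
        -- Colinearity of the counit: by associativity the image of `tensorCounit` on (N □ Λ) □ X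
        -- lies in N □ D, where contracting and applying ρ is the identity. So ρ_N composed with the
        -- candidate is the morphism `tensorCounit`.
        obtain ⟨w', hw⟩ := exists_corresponds_right (hX N).2 (hX (BTensor B N D)).1 k
        change rho D (contractR D N ((tensorCounit ω N (hX N)).lin (mapL X (inclHomR N Λ) k))) =
          (tensorCounit ω N (hX N)).lin (mapL X (inclHomR N Λ) k)
        rw [hθ hw, rho_contractR])
  have hε : ∀ (N : RComod D) (k : Cotensor C (Cotensor D N Λ) X),
      (ε N).lin k = θ N (mapL X (inclHomR N Λ) k) := fun _ _ => rfl
  have εnat : ∀ {N N' : RComod D} (f : RComodHom D N N') (k : Cotensor C (Cotensor D N Λ) X),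
      (ε N').lin (mapL X (mapLHom Λ f) k) = f.lin ((ε N).lin k) := fun {N N'} f k => by
    rw [hε, hε, ← θnat, mapL_comp, mapL_comp]
    rfl
  have tri1 : ∀ (M : RComod C) (k : Cotensor C M X),
      (ε ⟨Cotensor C M X⟩).lin (mapL X (η M) k) = k := fun M k => by
    refine incl_injective ?_
    have e : (rTensorHom Λ (inclR B)).comp ((inclHomR (Cotensor C M X) Λ).comp (η M)) =
        (inclHomR (BTensor A M X) Λ).comp ((tensorUnit ψ.right hψ M).comp (rhoHom M)) :=
      RComodHom.ext fun m => congrArg incl (hηj M m)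
    -- The right side makes sense with any element of M ⊗ X in place of `incl k`. After this
    -- extension the triangle identity is additive and can be checked on pure tensors.
    have e1 : incl ((ε ⟨Cotensor C M X⟩).lin (mapL X (η M) k)) =
        θ (BTensor A M X) (mapL X (inclHomR (BTensor A M X) Λ)
          (mapL X (tensorUnit ψ.right hψ M) (tensorLam M X (incl k)))) := by
      rw [tensorLam_incl, mapL_comp (tensorUnit ψ.right hψ M), mapL_comp, ← e,
        ← mapL_comp, θnat, ← mapL_comp]
      rfl
    rw [e1]
    generalize incl k = t
    induction t using induction_on with
    | h0 => simp only [map_zero]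
    | ht m x =>
      obtain ⟨w, hw, hw'⟩ := h2 x
      have e2 : (tensorUnit ψ.right hψ M).comp (tmulHomR C m) =
          (mapLHom Λ (tmulHomR X m)).comp ψ.right :=
        RComodHom.ext fun c => tensorUnit_tmul ψ.right hψ m c
      have e3 : (inclHomR (BTensor A M X) Λ).comp ((mapLHom Λ (tmulHomR X m)).comp ψ.right) =
          (rTensorHom Λ (tmulL B X m)).comp ((inclHomR X Λ).comp ψ.right) := rfl
      -- This is the second identity of (4), followed by the counit of D. Naturality of `θ` along x
      -- ↦ m ⊗ x carries it to m ⊗ x.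
      have e4 : θ X (mapL X (inclHomR X Λ) (mapL X ψ.right (unitL x))) = x := by
        change contractR D X ((tensorCounit ω X (hX X)).lin
          (mapL X (inclHomR X Λ) (mapL X ψ.right (unitL x)))) = x
        rw [hθ hw, hw']
        exact contractR_rho x
      rw [tensorLam_tmul, mapL_comp (tensorUnit ψ.right hψ M), e2,
        mapL_comp, e3, ← mapL_comp, θnat, ← mapL_comp, e4]
      rfl
    | ha x y hx hy => rw [map_add, map_add, map_add, map_add, hx, hy]
  have tri2 : ∀ (N : RComod D) (y : Cotensor D N Λ),
      mapL Λ (ε N) ((η ⟨Cotensor D N Λ⟩).lin y) = y := fun N y => by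
    refine incl_injective ?_
    -- Naturality of the unit along N □ Λ → N ⊗ Λ again extends the identity to a full tensor
    -- product, where pure tensors n ⊗ l suffice.
    have e1 : incl (mapL Λ (ε N) ((η ⟨Cotensor D N Λ⟩).lin y)) =
        rTensor Λ (θ N) (incl ((η ⟨BTensor B N Λ⟩).lin (incl y))) := by
      have e2 := ηnat (M := ⟨Cotensor D N Λ⟩) (M' := ⟨BTensor B N Λ⟩) (inclHomR N Λ) y
      change (η ⟨BTensor B N Λ⟩).lin (incl y) = _ at e2
      rw [e2, incl_mapL, incl_mapL, ← rTensor_comp_apply]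
      rfl
    rw [e1]
    generalize incl y = t
    induction t using induction_on with
    | h0 => simp only [map_zero]
    | ht n l =>
      obtain ⟨w, hw, hw'⟩ := h1 l
      have e2 := ηnat (M := ⟨Λ⟩) (M' := ⟨BTensor B N Λ⟩) (tmulHomR Λ n) l
      change (η ⟨BTensor B N Λ⟩).lin (tmul B n l) = _ at e2
      -- The unit at Λ is the element w that the first identity of (4) provides, since both have the
      -- same image in (Λ ⊗ X) □ Λ.
      have e3 : (η ⟨Λ⟩).lin l = w :=
        hj Λ ((hηj ⟨Λ⟩ l).trans ((corresponds_iff ψ hψ w l).1 hw).symm)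
      -- On n ⊗ k with k in Λ □ X, `θ` is n acted on by the counit of ω(k). The factor
      -- `opLinearEquiv` identifies the regular right module B with the opposite ring, the domain of
      -- `toSpanSingleton`.
      have e4 : (θ N).comp (mapLHom X (tmulHomR Λ n)).lin =
          (LinearMap.toSpanSingleton Bᵐᵒᵖ N n).comp
            ((MulOpposite.opLinearEquiv Bᵐᵒᵖ).toLinearMap.comp (D.counitR.comp ω.right.lin)) :=
        LinearMap.ext fun k => by
          change contractR D N ((tensorCounit ω N (hX N)).lin (mapL X (tmulHomR Λ n) k)) =
            op (D.counit (ω.right.lin k)) • n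
          rw [← tensorCotensor_tmul, tensorCounit_tensorCotensor, lTensor_tmul, ω.eq]
          rfl
      have e5 : rTensor Λ ω.right.lin (incl w) = lam D l := congrArg incl hw'
      have e6 : rTensor Λ D.counitR (lam D l) = tmul B (1 : B) l := LComodule.counit (C := D) l
      rw [e2, incl_mapL, ← rTensor_comp_apply, e3, e4, rTensor_comp_apply, rTensor_comp_apply,
        rTensor_comp_apply, e5, e6]
      change tmul B (op (1 : B) • n) l = _
      rw [op_one, one_smul]
    | ha x y hx hy => rw [map_add, map_add, map_add, hx, hy]
  exact ⟨Adjunction.mkOfUnitCounit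
    { unit := { app := η, naturality := fun _ _ f => RComodHom.ext (ηnat f) }
      counit := { app := ε, naturality := fun _ _ f => RComodHom.ext (εnat f) }
      left_triangle := NatTrans.ext (funext fun M => RComodHom.ext (tri1 M))
      right_triangle := NatTrans.ext (funext fun N => RComodHom.ext (tri2 N)) }⟩

end RightAdjunction

end Adjunction

/-! ### From the maps ψ and ω to an adjunction on left comodules. -/

section Adjunction

variable {A : Type u} [Ring A] {B : Type u} [Ring B] {C : Coring A} {D : Coring B}

/-! ### Constructions of morphisms of left comodules -/

section LeftHoms

/-- The lift of a morphism along an injective morphism. -/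
def LComodHom.lift [RFlat A C] {K M M' : Type u}
    [AddCommGroup K] [Module A K] [LComodule C K] [AddCommGroup M] [Module A M]
    [LComodule C M] [AddCommGroup M'] [Module A M'] [LComodule C M']
    (i : LComodHom C M M') (hi : Function.Injective i.lin) (f : LComodHom C K M')
    (g : K → M) (h : ∀ k, i.lin (g k) = f.lin k) : LComodHom C K M where
  lin :=
    { toFun := g
      map_add' := fun x y => hi (by rw [map_add, h, h, h, map_add])
      map_smul' := fun s x => hi (by rw [map_smul, h, h, map_smul]; rfl) }
  colin := LComodHom.colin_of_comp i hi f _ h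

/-- The inverse of a bijective morphism. -/
def LComodHom.inverse {M M' : Type u} [AddCommGroup M] [Module A M] [LComodule C M]
    [AddCommGroup M'] [Module A M'] [LComodule C M'] (f : LComodHom C M M')
    (hf : Function.Bijective f.lin) : LComodHom C M' M where
  lin := (LinearEquiv.ofBijective f.lin hf).symm.toLinearMap
  colin m := by
    obtain ⟨m, rfl⟩ := hf.2 m
    have h : ∀ m, (LinearEquiv.ofBijective f.lin hf).symm.toLinearMap (f.lin m) = m :=
      (LinearEquiv.ofBijective f.lin hf).symm_apply_apply
    have h' : (LinearEquiv.ofBijective f.lin hf).symm.toLinearMap.comp f.lin =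
      LinearMap.id (R := A) := LinearMap.ext h
    rw [← f.colin, ← lTensor_comp_apply, h', h, lTensor_id_apply]

@[simp]
theorem LComodHom.inverse_apply {M M' : Type u} [AddCommGroup M] [Module A M] [LComodule C M]
    [AddCommGroup M'] [Module A M'] [LComodule C M'] (f : LComodHom C M M')
    (hf : Function.Bijective f.lin) (m : M) : (f.inverse hf).lin (f.lin m) = m :=
  (LinearEquiv.ofBijective f.lin hf).symm_apply_apply m

/-- A map on `M ⊗ Z` whose composites with the maps `m ↦ m ⊗ z` are morphisms is a morphism. -/
def LComodHom.ofTensor {S Z M P : Type u} [Ring S] [AddCommGroup Z] [Module S Z]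
    [AddCommGroup M] [Module A M] [LComodule C M] [Module Sᵐᵒᵖ M] [SMulCommClass A Sᵐᵒᵖ M]
    [LCoactLin C S M] [AddCommGroup P] [Module A P] [LComodule C P]
    (f : BTensor S M Z →+ P) (g : Z → LComodHom C M P)
    (h : ∀ z m, f (tmul S m z) = (g z).lin m) : LComodHom C (BTensor S M Z) P where
  lin :=
    { toFun := f
      map_add' := map_add f
      map_smul' := fun s t => by
        induction t using induction_on with
        | h0 => simp
        | ht m z => rw [lsmul_tmul, h, h, map_smul]; rfl
        | ha x y hx hy => simp only [smul_add, map_add, hx, hy] }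
  colin t := by
    induction t using induction_on with
    | h0 => simp only [map_zero]
    | ht m z =>
      change _ = lam C (f (tmul S m z))
      rw [lam_tmul, ← lTensor_comp_apply, h, ← (g z).colin]
      congr 2
      exact LinearMap.ext (h z)
    | ha x y hx hy => simp only [map_add, hx, hy]

theorem mapR_comp {M M' M'' N : Type u} [AddCommGroup M] [Module A M] [LComodule C M]
    [AddCommGroup M'] [Module A M'] [LComodule C M']
    [AddCommGroup M''] [Module A M''] [LComodule C M''] [AddCommGroup N] [Module Aᵐᵒᵖ N]
    [RComodule C N] (g : LComodHom C M' M'') (f : LComodHom C M M') (k : Cotensor C N M) :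
    mapR N g (mapR N f k) = mapR N (g.comp f) k :=
  incl_injective (lTensor_comp_apply g.lin f.lin (incl k)).symm

end LeftHoms

/-! ### Contraction with the counit -/

section Contraction

variable (C) (M : Type u) [AddCommGroup M] [Module A M]

/-- The map `C ⊗ M → M` given by the counit. -/
def contractL : BTensor A C M →ₗ[A] M where
  toFun := lift (fun c m => C.counit c • m)
    (fun c c' m => by rw [map_add, add_smul]) (fun m c c' => smul_add _ _ _)
    (fun c a m => by rw [C.counit_rsmul, smul_smul]; rfl)
  map_add' := map_add _
  map_smul' s t := by
    induction t using induction_on with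
    | h0 => simp
    | ht c m =>
      change C.counit (s • c) • m = s • C.counit c • m
      rw [map_smul, smul_smul]
      rfl
    | ha x y hx hy => simp only [smul_add, map_add, hx, hy]

variable {C M}

@[simp]
theorem contractL_tmul (m : M) (c : C) : contractL C M (tmul A c m) = C.counit c • m := rfl

theorem contractL_lTensor {M' : Type u} [AddCommGroup M'] [Module A M'] (f : M →ₗ[A] M')
    (t : BTensor A C M) : contractL C M' (lTensor C f t) = f (contractL C M t) := by
  induction t using induction_on with
  | h0 => simp
  | ht c m => simp
  | ha x y hx hy => simp only [map_add, hx, hy]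

theorem contractL_rsmul {T : Type u} [Ring T] [Module Tᵐᵒᵖ M] [SMulCommClass A Tᵐᵒᵖ M] (s : Tᵐᵒᵖ)
    (t : BTensor A C M) : contractL C M (s • t) = s • contractL C M t := by
  induction t using induction_on with
  | h0 => simp
  | ht c m => exact smul_comm (C.counit c) s m
  | ha x y hx hy => simp only [smul_add, map_add, hx, hy]

variable [LComodule C M]

@[simp]
theorem contractL_lam (m : M) : contractL C M (lam C m) = m := by
  obtain ⟨r, -, hr⟩ := one_tmul_surjective (A := A) (N := M)
  have h : ∀ t : BTensor A C M, contractL C M t = r (rTensor M C.counitR t) := fun t => by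
    induction t using induction_on with
    | h0 => simp
    | ht c m => rw [rTensor_tmul, hr]; rfl
    | ha x y hx hy => simp only [map_add, hx, hy]
  have h1 : rTensor M C.counitR (lam C m) = tmul A (1 : A) m := LComodule.counit (C := C) m
  rw [h, h1, hr, one_smul]

theorem lam_injective : Function.Injective (lam C : M →ₗ[A] BTensor A C M) :=
  Function.LeftInverse.injective (g := contractL C M) contractL_lam

/-- The mirror of `rho_contractR`: the coaction identifies M with C □ M, and the counit gives the
inverse. -/
theorem lam_contractL (k : Cotensor C C M) : lam C (contractL C M (incl k)) = incl k := by
  let p : BTensor A C C →ₗ[Aᵐᵒᵖ] C :=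
    { toFun := contractL C C, map_add' := map_add _, map_smul' := contractL_rsmul }
  have h1 : ∀ t : BTensor A C M, rTensor M p ((assoc A C A C M).symm (lTensor C (lam C) t)) =
      lam C (contractL C M t) := fun t => by
    induction t using induction_on with
    | h0 => simp
    | ht c m =>
      rw [lTensor_tmul, contractL_tmul, map_smul]
      induction lam C m using induction_on with
      | h0 => simp [tmul_zero]
      | ht c' m => rfl
      | ha x y hx hy => simp only [map_add, tmul_add, smul_add, hx, hy]
    | ha x y hx hy => simp only [map_add, hx, hy]
  have h2 : p.comp (rho C) = LinearMap.id (R := Aᵐᵒᵖ) :=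
    LinearMap.ext fun c => contractL_lam (C := C) c
  have h3 : (assoc A C A C M).symm (lTensor C (lam C) (incl k)) = rTensor M (rho C) (incl k) :=
    (assoc A C A C M).symm_apply_eq.2 (sub_eq_zero.1 (omega_incl k)).symm
  rw [← h1, h3, ← rTensor_comp_apply, h2, rTensor_id_apply]

end Contraction

/-! ### The adjunction of the cotensor functors on left comodules -/

section LeftAdjunction

variable [RFlat A C] [LFlat A C] [RFlat B D] [LFlat B D] {X : Bicomod C D} {Λ : Bicomod D C}

/-- The canonical map `(Λ □ M) ⊗ Z → Λ □ (M ⊗ Z)` as a morphism of left comodules. -/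
def cotensorTensorHom (M : Type u) [AddCommGroup M] [Module A M] [LComodule C M] {S : Type u}
    [Ring S] [Module Sᵐᵒᵖ M] [SMulCommClass A Sᵐᵒᵖ M] [LCoactLin C S M] (Λ : Bicomod D C)
    (Z : Type u) [AddCommGroup Z] [Module S Z] :
    LComodHom D (BTensor S (Cotensor C Λ M) Z) (Cotensor C Λ (BTensor S M Z)) :=
  LComodHom.ofTensor (cotensorTensor Λ M Z) (fun z => mapRHom Λ (tmulHomL M z))
    fun z k => cotensorTensor_tmul k z

theorem Corresponds.cotensorTensor_eq {M N : Type u} [AddCommGroup M] [Module A M]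
    [LComodule C M] [AddCommGroup N] [Module Bᵐᵒᵖ N] [RComodule D N]
    {w : Cotensor D N (Cotensor C Λ M)} {w' : Cotensor C (Cotensor D N Λ) M}
    (h : Corresponds w' w) : cotensorTensor N Λ M (incl w') = mapR N (inclHomL Λ M) w :=
  incl_injective h

/-- For a bicolinear map `ψ : C → X □ Λ`, the morphism `C ⊗ W → X □ (Λ ⊗ W)` that maps `c ⊗ w` to
`ψ(c) ⊗ w`. -/
def unitTensor (ψ : LComodHom C C (Cotensor D X Λ))
    (hψ : ∀ (a : Aᵐᵒᵖ) (c : C), ψ.lin (a • c) = a • ψ.lin c) (W : Type u) [AddCommGroup W]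
    [Module A W] : LComodHom C (BTensor A C W) (Cotensor D X (BTensor A Λ W)) :=
  LComodHom.comp (cotensorTensorHom Λ X W) (rTensorHomL W ψ
    { toFun := ψ.lin, map_add' := map_add _, map_smul' := hψ } fun _ => rfl)

theorem unitTensor_tmul (ψ : LComodHom C C (Cotensor D X Λ))
    (hψ : ∀ (a : Aᵐᵒᵖ) (c : C), ψ.lin (a • c) = a • ψ.lin c) {W : Type u} [AddCommGroup W]
    [Module A W] (w : W) (c : C) :
    (unitTensor ψ hψ W).lin (tmul A c w) = mapR X (tmulHomL Λ w) (ψ.lin c) :=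
  cotensorTensor_tmul _ w

theorem corresponds_iff_left (ψ : BicomodHom C C C (Cotensor D X Λ))
    (hψ : ∀ (a : Aᵐᵒᵖ) (c : C), ψ.left.lin (a • c) = a • ψ.left.lin c) {M : Type u} [AddCommGroup M]
    [Module A M] [LComodule C M] (w : Cotensor D X (Cotensor C Λ M)) (m : M) :
    Corresponds (mapL M ψ.right (unitL m)) w ↔
      mapR X (inclHomL Λ M) w = (unitTensor ψ.left hψ M).lin (lam C m) := by
  have h : ψ.right.lin = { toFun := ψ.left.lin, map_add' := map_add _, map_smul' := hψ } :=
    LinearMap.ext fun c => (ψ.eq c).symm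
  rw [← incl_injective.eq_iff]
  unfold Corresponds
  rw [incl_mapL, h]
  exact eq_comm

/-- The counit of the adjunction between tensor and cotensor products, for a bicolinear map
`ω : Λ □ X → D`: the composite `Λ □ (X ⊗ N) ≅ (Λ □ X) ⊗ N → D ⊗ N`. -/
def counitTensor (ω : BicomodHom D D (Cotensor C Λ X) D) (N : Type u) [AddCommGroup N]
    [Module B N] (hN : Function.Bijective (cotensorTensor (C := C) (T := B) Λ X N)) :
    LComodHom D (Cotensor C Λ (BTensor B X N)) (BTensor B D N) :=
  (rTensorHomL N ω.left ω.right.lin fun k => (ω.eq k).symm).comp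
    ((cotensorTensorHom X Λ N).inverse hN)

theorem counitTensor_cotensorTensor (ω : BicomodHom D D (Cotensor C Λ X) D) {N : Type u}
    [AddCommGroup N] [Module B N]
    (hN : Function.Bijective (cotensorTensor (C := C) (T := B) Λ X N))
    (y : BTensor B (Cotensor C Λ X) N) :
    (counitTensor ω N hN).lin (cotensorTensor Λ X N y) = rTensor N ω.right.lin y :=
  congrArg (rTensor N ω.right.lin)
    (LComodHom.inverse_apply (cotensorTensorHom X Λ N) hN y)

theorem mapR_lTensorHom_cotensorTensor {N N' : Type u} [AddCommGroup N] [Module B N]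
    [AddCommGroup N'] [Module B N'] (f : N →ₗ[B] N') (y : BTensor B (Cotensor C Λ X) N) :
    mapR Λ (lTensorHom X f) (cotensorTensor Λ X N y) =
      cotensorTensor Λ X N' (lTensor (Cotensor C Λ X) f y) := by
  induction y using induction_on with
  | h0 => simp only [map_zero]
  | ht k n =>
    rw [lTensor_tmul, cotensorTensor_tmul, cotensorTensor_tmul, mapR_comp]
    rfl
  | ha x y hx hy => simp only [map_add, hx, hy]

/-- As on the other side, naturality for arbitrary linear maps permits the reduction to pure
tensors. -/
theorem counitTensor_naturality (ω : BicomodHom D D (Cotensor C Λ X) D) {N N' : Type u}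
    [AddCommGroup N] [Module B N] [AddCommGroup N'] [Module B N']
    (hN : Function.Bijective (cotensorTensor (C := C) (T := B) Λ X N))
    (hN' : Function.Bijective (cotensorTensor (C := C) (T := B) Λ X N')) (f : N →ₗ[B] N')
    (k : Cotensor C Λ (BTensor B X N)) :
    (counitTensor ω N' hN').lin (mapR Λ (lTensorHom X f) k) =
      lTensor D f ((counitTensor ω N hN).lin k) := by
  obtain ⟨y, rfl⟩ := hN.2 k
  rw [mapR_lTensorHom_cotensorTensor, counitTensor_cotensorTensor, counitTensor_cotensorTensor,
    ← rTensor_lTensor]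

/-- The map `Λ ⊗ M → Λ □ (C ⊗ M)` given by the right coaction of `Λ`. -/
def rhoTensor (Λ : Type u) [AddCommGroup Λ] [Module Aᵐᵒᵖ Λ] (M : Type u) [AddCommGroup M]
    [Module A M] [RComodule C Λ] : BTensor A Λ M →+ Cotensor C Λ (BTensor A C M) where
  toFun t := mk (assoc A Λ A C M (rTensor M (rho C) t)) (by
    induction t using induction_on with
    | h0 => simp only [map_zero]
    | ht x m =>
      rw [rTensor_tmul, assoc_tmul_eq]
      exact omega_incl (mapR Λ (tmulHomL C m) (unitR x))
    | ha x y hx hy => simp only [map_add, hx, hy, add_zero])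
  map_zero' := incl_injective (by simp)
  map_add' x y := incl_injective (by simp)

theorem rhoTensor_tmul {M Λ : Type u} [AddCommGroup M] [Module A M] [AddCommGroup Λ]
    [Module Aᵐᵒᵖ Λ] [RComodule C Λ] (m : M) (x : Λ) :
    rhoTensor (C := C) Λ M (tmul A x m) = mapR Λ (tmulHomL C m) (unitR x) :=
  incl_injective (assoc_tmul_eq _ m)

theorem rhoTensor_incl {M Λ : Type u} [AddCommGroup M] [Module A M] [LComodule C M]
    [AddCommGroup Λ] [Module Aᵐᵒᵖ Λ] [RComodule C Λ] (k : Cotensor C Λ M) :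
    rhoTensor Λ M (incl k) = mapR Λ (lamHom M) k :=
  incl_injective (sub_eq_zero.1 (omega_incl k))

/-- The maps `ψ` and `ω` of the unit-counit condition are the unit and the counit of an adjunction
if the cotensor products `Λ □ X` and `Λ □ M` are compatible with the relevant tensor products. -/
theorem UnitCounit.leftAdjunction (h : UnitCounit X Λ)
    (hΛ : ∀ (Z : Type u) [AddCommGroup Z] [Module B Z],
      Function.Bijective (cotensorTensor (C := C) (T := B) Λ X Z))
    (hX : ∀ (M : Type u) [AddCommGroup M] [Module A M] [LComodule C M],
      Function.Bijective (tensorCotensor (C := C) (S := B) Λ M X))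
    (hXD : ∀ (M : Type u) [AddCommGroup M] [Module A M] [LComodule C M],
      Function.Injective (tensorCotensor (C := C) (S := B) Λ M (BTensor B X D))) :
    LeftAdjunction X Λ := by
  -- The identities exchange roles in passing to left comodules: the one on Λ now gives the left
  -- triangle, and the one on X gives the right triangle.
  obtain ⟨ψ, ω, h2, h1⟩ := h
  have hψ : ∀ (a : Aᵐᵒᵖ) (c : C), ψ.left.lin (a • c) = a • ψ.left.lin c := fun a c => by
    rw [ψ.eq, ψ.eq, map_smul]
  have hj : ∀ (M : Type u) [AddCommGroup M] [Module A M] [LComodule C M],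
      Function.Injective (mapR (C := D) X (inclHomL Λ M)) := fun M _ _ _ x y hxy =>
    incl_injective (tensorCotensor_injective_iff.1 (hX M).1 (congrArg incl hxy))
  have hη := fun (M : LComod C) (m : M) =>
    exists_corresponds_right (hX M).2 (hXD M) (mapL M ψ.right (unitL m))
  let η : ∀ M : LComod C, LComodHom C M (Cotensor D X (Cotensor C Λ M)) := fun M =>
    LComodHom.lift (mapRHom X (inclHomL Λ M)) (hj M) ((unitTensor ψ.left hψ M).comp (lamHom M))
      (fun m => (hη M m).choose) (fun m => (corresponds_iff_left ψ hψ _ m).1 (hη M m).choose_spec)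
  have hηj : ∀ (M : LComod C) (m : M), mapR X (inclHomL Λ M) ((η M).lin m) =
      (unitTensor ψ.left hψ M).lin (lam C m) := fun M m =>
    (corresponds_iff_left ψ hψ _ m).1 (hη M m).choose_spec
  have ηnat : ∀ {M M' : LComod C} (f : LComodHom C M M') (m : M),
      (η M').lin (f.lin m) = mapR X (mapRHom Λ f) ((η M).lin m) := fun {M M'} f m => by
    refine hj M' ?_
    have e : (inclHomL Λ M').comp (mapRHom Λ f) =
        (lTensorHom Λ f.lin).comp (inclHomL Λ M) := rfl
    rw [hηj, mapR_comp, e, ← mapR_comp, hηj, ← f.colin]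
    generalize lam C m = t
    induction t using induction_on with
    | h0 => simp only [map_zero]
    | ht c m =>
      rw [lTensor_tmul, unitTensor_tmul, unitTensor_tmul, mapR_comp]
      rfl
    | ha x y hx hy => simp only [map_add, hx, hy]
  -- As for right comodules, the counit is first defined on Λ □ (X ⊗ N) for an arbitrary module N
  -- and then restricted to Λ □ (X □ N).
  let θ : ∀ (N : Type u) [AddCommGroup N] [Module B N],
      Cotensor C Λ (BTensor B X N) →ₗ[B] N := fun N _ _ =>
    (contractL D N).comp (counitTensor ω N (hΛ N)).lin
  have θnat : ∀ {N N' : Type u} [AddCommGroup N] [Module B N] [AddCommGroup N']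
      [Module B N'] (f : N →ₗ[B] N') (k : Cotensor C Λ (BTensor B X N)),
      θ N' (mapR Λ (lTensorHom X f) k) = f (θ N k) := fun {N N'} _ _ _ _ f k => by
    change contractL D N' ((counitTensor ω N' (hΛ N')).lin (mapR Λ (lTensorHom X f) k)) =
      f (contractL D N ((counitTensor ω N (hΛ N)).lin k))
    rw [counitTensor_naturality ω (hΛ N) (hΛ N'), contractL_lTensor]
  have hθ : ∀ {N : Type u} [AddCommGroup N] [Module B N] [LComodule D N]
      {w : Cotensor C Λ (Cotensor D X N)} {w' : Cotensor D (Cotensor C Λ X) N},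
      Corresponds w' w → (counitTensor ω N (hΛ N)).lin (mapR Λ (inclHomL X N) w) =
        incl (mapL N ω.right w') := fun {N} _ _ _ w w' hw => by
    rw [← hw.cotensorTensor_eq, counitTensor_cotensorTensor]; rfl
  let ε : ∀ N : LComod D, LComodHom D (Cotensor C Λ (Cotensor D X N)) N := fun N =>
    LComodHom.lift (lamHom N) lam_injective
      ((counitTensor ω N (hΛ N)).comp (mapRHom Λ (inclHomL X N)))
      (fun k => θ N (mapR Λ (inclHomL X N) k)) (fun k => by
        obtain ⟨w', hw⟩ := exists_corresponds_left (hΛ N).2 (hΛ (BTensor B D N)).1 k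
        change lam D (contractL D N ((counitTensor ω N (hΛ N)).lin (mapR Λ (inclHomL X N) k))) =
          (counitTensor ω N (hΛ N)).lin (mapR Λ (inclHomL X N) k)
        rw [hθ hw, lam_contractL])
  have hε : ∀ (N : LComod D) (k : Cotensor C Λ (Cotensor D X N)),
      (ε N).lin k = θ N (mapR Λ (inclHomL X N) k) := fun _ _ => rfl
  have εnat : ∀ {N N' : LComod D} (f : LComodHom D N N') (k : Cotensor C Λ (Cotensor D X N)),
      (ε N').lin (mapR Λ (mapRHom X f) k) = f.lin ((ε N).lin k) := fun {N N'} f k => by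
    rw [hε, hε, ← θnat, mapR_comp, mapR_comp]
    rfl
  have tri1 : ∀ (M : LComod C) (k : Cotensor C Λ M),
      (ε ⟨Cotensor C Λ M⟩).lin (mapR Λ (η M) k) = k := fun M k => by
    refine incl_injective ?_
    have e : (lTensorHom X (inclL B)).comp ((inclHomL X (Cotensor C Λ M)).comp (η M)) =
        (inclHomL X (BTensor A Λ M)).comp ((unitTensor ψ.left hψ M).comp (lamHom M)) :=
      LComodHom.ext fun m => congrArg incl (hηj M m)
    -- The right side extends from Λ □ M to all of Λ ⊗ M, so pure tensors suffice.
    have e1 : incl ((ε ⟨Cotensor C Λ M⟩).lin (mapR Λ (η M) k)) =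
        θ (BTensor A Λ M) (mapR Λ (inclHomL X (BTensor A Λ M))
          (mapR Λ (unitTensor ψ.left hψ M) (rhoTensor Λ M (incl k)))) := by
      rw [rhoTensor_incl, mapR_comp (unitTensor ψ.left hψ M), mapR_comp, ← e,
        ← mapR_comp, θnat, ← mapR_comp]
      rfl
    rw [e1]
    generalize incl k = t
    induction t using induction_on with
    | h0 => simp only [map_zero]
    | ht x m =>
      obtain ⟨w, hw, hw'⟩ := h2 x
      have e2 : (unitTensor ψ.left hψ M).comp (tmulHomL C m) =
          (mapRHom X (tmulHomL Λ m)).comp ψ.left :=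
        LComodHom.ext fun c => unitTensor_tmul ψ.left hψ m c
      have e3 : (inclHomL X (BTensor A Λ M)).comp ((mapRHom X (tmulHomL Λ m)).comp ψ.left) =
          (lTensorHom X (tmulR B Λ m)).comp ((inclHomL X Λ).comp ψ.left) := rfl
      have e4 : θ Λ (mapR Λ (inclHomL X Λ) (mapR Λ ψ.left (unitR x))) = x := by
        change contractL D Λ ((counitTensor ω Λ (hΛ Λ)).lin
          (mapR Λ (inclHomL X Λ) (mapR Λ ψ.left (unitR x)))) = x
        rw [hθ hw, hw']
        exact contractL_lam x
      rw [rhoTensor_tmul, mapR_comp (unitTensor ψ.left hψ M), e2,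
        mapR_comp, e3, ← mapR_comp, θnat, ← mapR_comp, e4]
      rfl
    | ha x y hx hy => rw [map_add, map_add, map_add, map_add, hx, hy]
  have tri2 : ∀ (N : LComod D) (y : Cotensor D X N),
      mapR X (ε N) ((η ⟨Cotensor D X N⟩).lin y) = y := fun N y => by
    refine incl_injective ?_
    have e1 : incl (mapR X (ε N) ((η ⟨Cotensor D X N⟩).lin y)) =
        lTensor X (θ N) (incl ((η ⟨BTensor B X N⟩).lin (incl y))) := by
      have e2 := ηnat (M := ⟨Cotensor D X N⟩) (M' := ⟨BTensor B X N⟩) (inclHomL X N) y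
      change (η ⟨BTensor B X N⟩).lin (incl y) = _ at e2
      rw [e2, incl_mapR, incl_mapR, ← lTensor_comp_apply]
      rfl
    rw [e1]
    generalize incl y = t
    induction t using induction_on with
    | h0 => simp only [map_zero]
    | ht l n =>
      obtain ⟨w, hw, hw'⟩ := h1 l
      have e2 := ηnat (M := ⟨X⟩) (M' := ⟨BTensor B X N⟩) (tmulHomL X n) l
      change (η ⟨BTensor B X N⟩).lin (tmul B l n) = _ at e2
      have e3 : (η ⟨X⟩).lin l = w :=
        hj X ((hηj ⟨X⟩ l).trans ((corresponds_iff_left ψ hψ w l).1 hw).symm)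
      have e4 : (θ N).comp (mapRHom Λ (tmulHomL X n)).lin =
          (LinearMap.toSpanSingleton B N n).comp (D.counit.comp ω.left.lin) :=
        LinearMap.ext fun k => by
          change contractL D N ((counitTensor ω N (hΛ N)).lin (mapR Λ (tmulHomL X n) k)) =
            D.counit (ω.left.lin k) • n
          rw [← cotensorTensor_tmul, counitTensor_cotensorTensor, rTensor_tmul, ← ω.eq]
          rfl
      have e5 : lTensor X ω.left.lin (incl w) = rho D l := congrArg incl hw'
      have e6 : lTensor X D.counit (rho D l) = tmul B l (1 : B) := RComodule.counit (C := D) l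
      rw [e2, incl_mapR, ← lTensor_comp_apply, e3, e4, lTensor_comp_apply, lTensor_comp_apply,
        e5, e6]
      change tmul B l ((1 : B) • n) = _
      rw [one_smul]
    | ha x y hx hy => rw [map_add, map_add, map_add, hx, hy]
  exact ⟨Adjunction.mkOfUnitCounit
    { unit := { app := η, naturality := fun _ _ f => LComodHom.ext (ηnat f) }
      counit := { app := ε, naturality := fun _ _ f => LComodHom.ext (εnat f) }
      left_triangle := NatTrans.ext (funext fun M => LComodHom.ext (tri1 M))
      right_triangle := NatTrans.ext (funext fun N => LComodHom.ext (tri2 N)) }⟩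

end LeftAdjunction

end Adjunction

/-! ### From an adjunction on right comodules to the maps ψ and ω. -/

section AdjunctionToUnit

variable {A : Type u} [Ring A] {B : Type u} [Ring B] {C : Coring A} {D : Coring B}

section RightAdjunction

/-- Left multiplication by an element as a morphism of right comodules. -/
def mulLeftHom (C : Coring A) (a : A) : RComodHom C C C := C.mulLeft a

/-- The left coaction of a bicomodule as a morphism of right comodules. -/
def lamHomR (X : Bicomod C D) : RComodHom D X (BTensor A C X) where
  lin := lamLin C B
  colin := rho_lam X

variable [LFlat B D]

/-- The isomorphism `X → C □ X` as a morphism of right comodules. -/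
def unitLHom (X : Bicomod C D) : RComodHom D X (Cotensor C C X) :=
  RComodHom.lift (inclHomR C X) incl_injective (lamHomR X) unitL fun _ => rfl

theorem unitL_bijective (X : Type u) [AddCommGroup X] [Module A X] [LComodule C X] :
    Function.Bijective (unitL (C := C) : X → Cotensor C C X) :=
  Function.bijective_iff_has_inverse.2 ⟨fun k => contractL C X (incl k), contractL_lam,
    fun k => incl_injective (lam_contractL k)⟩

/-- The isomorphism `C □ X → X` as a morphism of right comodules. -/
def unitLInv (X : Bicomod C D) : RComodHom D (Cotensor C C X) X :=
  (unitLHom X).inverse (unitL_bijective X)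

@[simp]
theorem unitLInv_unitL (X : Bicomod C D) (x : X) : (unitLInv X).lin (unitL x) = x :=
  (unitLHom X).inverse_apply (unitL_bijective X) x

theorem unitLInv_apply (X : Bicomod C D) (k : Cotensor C C X) :
    (unitLInv X).lin k = contractL C X (incl k) := by
  obtain ⟨x, rfl⟩ := (unitL_bijective X).2 k
  rw [unitLInv_unitL]
  exact (contractL_lam x).symm

theorem lam_unitLInv (X : Bicomod C D) (k : Cotensor C C X) :
    lam C ((unitLInv X).lin k) = incl k := by
  rw [unitLInv_apply, lam_contractL]

theorem rTensor_contractR (M X : Type u) [AddCommGroup M] [Module Aᵐᵒᵖ M] [AddCommGroup X]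
    [Module A X] (m : M) (t : BTensor A C X) :
    rTensor X ((contractR C M).comp (tmulL A C m)) t = tmul A m (contractL C X t) := by
  induction t using induction_on with
  | h0 => simp [tmul_zero]
  | ht c x => exact smul_tmul A m (C.counit c) x
  | ha x y hx hy => rw [map_add, map_add, tmul_add, hx, hy]

theorem rTensor_toModuleEnd {M N : Type u} [AddCommGroup M] [Module Aᵐᵒᵖ M] [AddCommGroup N]
    [Module A N] {S : Type u} [Ring S] [Module S M] [SMulCommClass S Aᵐᵒᵖ M] (s : S)
    (t : BTensor A M N) : rTensor N (Module.toModuleEnd Aᵐᵒᵖ (S := S) M s) t = s • t := by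
  induction t using induction_on with
  | h0 => simp
  | ht m n => rfl
  | ha x y hx hy => rw [map_add, smul_add, hx, hy]

variable [LFlat A C] [RFlat A C] [RFlat B D] {X : Bicomod C D} {Λ : Bicomod D C}

/-- The map `W ⊗ X → (W ⊗ C) □ X` as a morphism of right comodules. -/
def tensorLamHom (W : Type u) [AddCommGroup W] [Module Aᵐᵒᵖ W] (X : Bicomod C D) :
    RComodHom D (BTensor A W X) (Cotensor C (BTensor A W C) X) :=
  RComodHom.ofTensor (tensorLam W X) (fun w => (mapLHom X (tmulHomR C w)).comp (unitLHom X))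
    tensorLam_tmul

/-- The unit of an adjunction between cotensor functors is given by a bicolinear map. -/
theorem RightAdjunction.unitCounit (h : RightAdjunction X Λ)
    (hX : ∀ (Z : Type u) [AddCommGroup Z] [Module Bᵐᵒᵖ Z],
      Function.Bijective (tensorCotensor (C := C) (S := B) Λ X Z)) :
    UnitCounit X Λ := by
  obtain ⟨adj⟩ := h
  let η : ∀ (M : Type u) [AddCommGroup M] [Module Aᵐᵒᵖ M] [RComodule C M],
      RComodHom C M (Cotensor D (Cotensor C M X) Λ) := fun M _ _ _ => adj.unit.app ⟨M⟩
  let ε : ∀ (N : Type u) [AddCommGroup N] [Module Bᵐᵒᵖ N] [RComodule D N],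
      RComodHom D (Cotensor C (Cotensor D N Λ) X) N := fun N _ _ _ => adj.counit.app ⟨N⟩
  have ηnat : ∀ {M M' : Type u} [AddCommGroup M] [Module Aᵐᵒᵖ M] [RComodule C M]
      [AddCommGroup M'] [Module Aᵐᵒᵖ M'] [RComodule C M'] (f : RComodHom C M M') (m : M),
      (η M').lin (f.lin m) = mapL Λ (mapLHom X f) ((η M).lin m) :=
    fun {M M'} _ _ _ _ _ _ f m =>
      congrArg (fun g : RComodHom C M (Cotensor D (Cotensor C M' X) Λ) => g.lin m)
        (adj.unit.naturality (X := ⟨M⟩) (Y := ⟨M'⟩) f)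
  have εnat : ∀ {N N' : Type u} [AddCommGroup N] [Module Bᵐᵒᵖ N] [RComodule D N]
      [AddCommGroup N'] [Module Bᵐᵒᵖ N'] [RComodule D N'] (f : RComodHom D N N')
      (k : Cotensor C (Cotensor D N Λ) X),
      (ε N').lin (mapL X (mapLHom Λ f) k) = f.lin ((ε N).lin k) :=
    fun {N N'} _ _ _ _ _ _ f k =>
      congrArg (fun g : RComodHom D (Cotensor C (Cotensor D N Λ) X) N' => g.lin k)
        (adj.counit.naturality (X := ⟨N⟩) (Y := ⟨N'⟩) f)
  have tri1 : ∀ (M : Type u) [AddCommGroup M] [Module Aᵐᵒᵖ M] [RComodule C M]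
      (k : Cotensor C M X), (ε (Cotensor C M X)).lin (mapL X (η M) k) = k := fun M _ _ _ k =>
    congrArg (fun g : RComodHom D (Cotensor C M X) (Cotensor C M X) => g.lin k)
      (adj.left_triangle_components ⟨M⟩)
  have tri2 : ∀ (N : Type u) [AddCommGroup N] [Module Bᵐᵒᵖ N] [RComodule D N]
      (y : Cotensor D N Λ), mapL Λ (ε N) ((η (Cotensor D N Λ)).lin y) = y := fun N _ _ _ y =>
    congrArg (fun g : RComodHom C (Cotensor D N Λ) (Cotensor D N Λ) => g.lin y)
      (adj.right_triangle_components ⟨N⟩)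
  -- From here on only naturality and the triangle identities matter.
  clear_value η ε
  -- The unit at C, read through C □ X ≅ X. Its left linearity is naturality of the unit along c ↦ a
  -- c.
  let ψ : RComodHom C C (Cotensor D X Λ) := (mapLHom Λ (unitLInv X)).comp (η C)
  have hψ : ∀ (a : A) (c : C), ψ.lin (a • c) = a • ψ.lin c := fun a c => by
    have e1 := ηnat (mulLeftHom C a) c
    change (η C).lin (a • c) = _ at e1
    change mapL Λ (unitLInv X) ((η C).lin (a • c)) = a • mapL Λ (unitLInv X) ((η C).lin c)
    refine incl_injective ?_
    have e2 : (unitLInv X).lin.comp (mapLHom X (mulLeftHom C a)).lin =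
        (Module.toModuleEnd Bᵐᵒᵖ (S := A) X a).comp (unitLInv X).lin := LinearMap.ext fun k => by
      change (unitLInv X).lin (mapL X (mulLeftHom C a) k) = a • (unitLInv X).lin k
      rw [unitLInv_apply, unitLInv_apply, ← map_smul]
      exact congrArg _ (rTensor_toModuleEnd a (incl k))
    rw [e1, mapL_comp]
    change rTensor Λ ((unitLInv X).lin.comp (mapLHom X (mulLeftHom C a)).lin) _ = _
    rw [e2, rTensor_comp_apply, rTensor_toModuleEnd]
    rfl
  -- The unit at any M is determined by ψ. Naturality along ρ_M moves the question to M ⊗ C;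
  -- additivity and naturality along c ↦ m ⊗ c then move it to C. The map `p` contracts M ⊗ C to M
  -- and undoes ρ_M.
  have hη : ∀ {M : Type u} [AddCommGroup M] [Module Aᵐᵒᵖ M] [RComodule C M] (m : M),
      mapL Λ (inclHomR M X) ((η M).lin m) = (tensorUnit ψ hψ M).lin (rho C m) :=
    fun {M} _ _ _ m => by
    let p : Cotensor C (BTensor A M C) X →ₗ[Bᵐᵒᵖ] BTensor A M X :=
      (rTensorLin B X (contractR C M)).comp (inclR B)
    have e1 : p.comp (mapLHom X (rhoHom M)).lin = inclR B := LinearMap.ext fun k => by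
      change rTensor X (contractR C M) (rTensor X (rho C) (incl k)) = incl k
      rw [← rTensor_comp_apply]
      refine Eq.trans ?_ (rTensor_id_apply _)
      congr 2
      exact LinearMap.ext contractR_rho
    have e2 : ∀ t, rTensor Λ p (incl ((η (BTensor A M C)).lin t)) =
        incl ((tensorUnit ψ hψ M).lin t) := fun t => by
      induction t using induction_on with
      | h0 => simp only [map_zero]
      | ht m c =>
        have e3 := ηnat (tmulHomR (S := A) C m) c
        change (η (BTensor A M C)).lin (tmul A m c) = _ at e3
        have e4 : p.comp (mapLHom X (tmulHomR C m)).lin =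
            (tmulL B X m).comp (unitLInv X).lin := LinearMap.ext fun k => by
          change rTensor X (contractR C M) (rTensor X (tmulL A C m) (incl k)) =
            tmul A m ((unitLInv X).lin k)
          rw [← rTensor_comp_apply, rTensor_contractR, unitLInv_apply]
        rw [e3, tensorUnit_tmul, incl_mapL, incl_mapL, ← rTensor_comp_apply]
        change rTensor Λ (p.comp (mapLHom X (tmulHomR C m)).lin) _ = _
        rw [e4, rTensor_comp_apply]
        rfl
      | ha x y hx hy => simp only [map_add, hx, hy]
    refine incl_injective ?_
    have e3 := ηnat (rhoHom (C := C) M) m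
    change (η (BTensor A M C)).lin (rho C m) = _ at e3
    rw [← e2, e3, incl_mapL, incl_mapL, ← rTensor_comp_apply]
    change _ = rTensor Λ (p.comp (mapLHom X (rhoHom M)).lin) _
    rw [e1]
    rfl
  let ψ' : BicomodHom C C C (Cotensor D X Λ) :=
    { left :=
        { lin := { toFun := ψ.lin, map_add' := map_add _, map_smul' := hψ }
          colin := fun c => by
            refine RFlat.injective C (inclL (C := D) (M := X) (N := Λ) A) incl_injective ?_
            rw [lam_incl]
            change _ = assoc A C B X Λ (rTensor Λ (lamLin C B)
              (rTensor Λ (unitLInv X).lin (incl ((η C).lin c))))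
            have e1 : (lamLin C B).comp (unitLInv X).lin = inclR B :=
              LinearMap.ext (lam_unitLInv X)
            rw [← rTensor_comp_apply, e1]
            -- Left colinearity of ψ is the formula `hη` for M = C, where the coaction is Δ.
            refine Eq.trans ?_ ((assoc A C B X Λ).symm_apply_eq.1 (congrArg incl (hη c)).symm)
            rfl }
      right := ψ
      eq := fun _ => rfl }
  -- The counit at D, read through Λ ≅ D □ Λ. Its left linearity is naturality of the counit along d
  -- ↦ b d.
  let ω : RComodHom D (Cotensor C Λ X) D := (ε D).comp (mapLHom X (unitLHom Λ))
  have hω : ∀ (b : B) (k : Cotensor C Λ X), ω.lin (b • k) = b • ω.lin k := fun b k => by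
    have e1 := εnat (mulLeftHom D b) (mapL X (unitLHom Λ) k)
    change _ = b • ω.lin k at e1
    rw [← e1]
    change (ε D).lin (mapL X (unitLHom Λ) (b • k)) = _
    congr 1
    rw [mapL_comp]
    refine incl_injective ?_
    change rTensor X (unitLHom Λ).lin (b • incl k) =
      rTensor X ((mapLHom Λ (mulLeftHom D b)).lin.comp (unitLHom Λ).lin) (incl k)
    rw [← rTensor_toModuleEnd b, ← rTensor_comp_apply]
    congr 2
    refine LinearMap.ext fun l => incl_injective ?_
    change lam D (b • l) = rTensor Λ (Module.toModuleEnd Bᵐᵒᵖ (S := B) D b) (lam D l)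
    rw [rTensor_toModuleEnd, map_smul]
  let ωl : Cotensor C Λ X →ₗ[B] D :=
    { toFun := ω.lin, map_add' := map_add _, map_smul' := hω }
  -- The counit at any N is determined by ω. After composition with the injective map ρ_N,
  -- naturality along ρ_N : N → N ⊗ D and then along d ↦ n ⊗ d reduces the formula to D.
  have hε : ∀ {N : Type u} [AddCommGroup N] [Module Bᵐᵒᵖ N] [RComodule D N]
      (k : Cotensor C (Cotensor D N Λ) X) (y : BTensor B N (Cotensor C Λ X)),
      tensorCotensor Λ X N y = mapL X (inclHomR N Λ) k →
        rho D ((ε N).lin k) = lTensor N ωl y := fun {N} _ _ _ k y hy => by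
    have e1 : (tensorLamHom N Λ).comp (inclHomR N Λ) = mapLHom Λ (rhoHom N) :=
      RComodHom.ext tensorLam_incl
    have e2 := εnat (rhoHom N) k
    change _ = rho D ((ε N).lin k) at e2
    rw [← e2, ← e1, ← mapL_comp, ← hy]
    clear hy
    induction y using induction_on with
    | h0 => simp only [map_zero]
    | ht n z =>
      have e3 : (tensorLamHom N Λ).comp (tmulHomR Λ n) =
          (mapLHom Λ (tmulHomR D n)).comp (unitLHom Λ) := RComodHom.ext (tensorLam_tmul n)
      rw [tensorCotensor_tmul, mapL_comp, e3, ← mapL_comp, εnat]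
      rfl
    | ha x y hx hy => simp only [map_add, hx, hy]
  let ω' : BicomodHom D D (Cotensor C Λ X) D :=
    { left :=
        { lin := ωl
          colin := fun z => by
            -- Left colinearity of ω is the formula `hε` for N = D.
            refine (hε (mapL X (unitLHom Λ) z) (lam D z) (incl_injective ?_)).symm
            rw [incl_tensorCotensor, AddEquiv.symm_apply_eq]
            refine (lam_incl Λ X z).trans ?_
            change _ = assoc B D A Λ X
              (rTensor X (inclR A) (rTensor X (unitLHom Λ).lin (incl z)))
            rw [← rTensor_comp_apply]
            rfl }
      right := ω
      eq := fun _ => rfl }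
  -- The identity on Λ is the right triangle at D, carried along Λ ≅ D □ Λ by naturality of the
  -- unit. The identity on X is the left triangle at C, carried along C □ X ≅ X by naturality of the
  -- counit. In the second case associativity must be invoked to find the corresponding element.
  refine ⟨ψ', ω', fun l => ⟨(η Λ).lin l, ?_, ?_⟩, fun x => ?_⟩
  · exact (corresponds_iff ψ' hψ _ l).2 (hη l)
  · have e1 := ηnat (unitLHom Λ) l
    change mapL Λ ((ε D).comp (mapLHom X (unitLHom Λ))) ((η Λ).lin l) = unitL l
    rw [← mapL_comp, ← e1]
    exact tri2 D (unitL l)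
  · obtain ⟨w, hw⟩ := exists_corresponds_right (hX X).2 (hX (BTensor B X D)).1
      (mapL X ψ'.right (unitL x))
    refine ⟨w, hw, incl_injective ?_⟩
    have e1 : (ε X).lin (mapL X ψ (unitL x)) = x := by
      rw [← mapL_comp, εnat, tri1 C (unitL x), unitLInv_unitL]
    change lTensor X ωl (incl w) = rho D x
    rw [← hε _ _ hw.tensorCotensor_eq]
    exact congrArg (rho D) e1

end RightAdjunction

end AdjunctionToUnit

/-! ### From an adjunction on left comodules to the maps ψ and ω. -/

section AdjunctionToUnit

variable {A : Type u} [Ring A] {B : Type u} [Ring B] {C : Coring A} {D : Coring B}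

section LeftAdjunction

/-- The right action of an element on a bimodule, as a left linear map. -/
def rightSMul (A M : Type u) [Ring A] [AddCommGroup M] [Module A M] {S : Type u} [Ring S]
    [Module Sᵐᵒᵖ M] [SMulCommClass A Sᵐᵒᵖ M] (s : Sᵐᵒᵖ) : M →ₗ[A] M where
  toFun m := s • m
  map_add' := smul_add s
  map_smul' a m := (smul_comm a s m).symm

/-- Right multiplication by an element as a morphism of left comodules. -/
def mulRightHom (C : Coring A) (a : Aᵐᵒᵖ) : LComodHom C C C where
  lin := rightSMul A C a
  colin c := by
    change lTensor C _ (C.comul c) = C.comulR (a • c)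
    rw [C.comulR.map_smul]
    change _ = a • C.comul c
    induction C.comul c using induction_on with
    | h0 => simp
    | ht m n => rfl
    | ha x y hx hy => simp only [smul_add, map_add, hx, hy]

/-- The right coaction of a bicomodule as a morphism of left comodules. -/
def rhoHomL (Λ : Bicomod D C) : LComodHom D Λ (BTensor A Λ C) where
  lin := rhoLin C B
  colin := lam_rho Λ

variable [RFlat B D]

/-- The isomorphism `Λ → Λ □ C` as a morphism of left comodules. -/
def unitRHom (Λ : Bicomod D C) : LComodHom D Λ (Cotensor C Λ C) :=
  LComodHom.lift (inclHomL Λ C) incl_injective (rhoHomL Λ) unitR fun _ => rfl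

theorem unitR_bijective (Λ : Type u) [AddCommGroup Λ] [Module Aᵐᵒᵖ Λ] [RComodule C Λ] :
    Function.Bijective (unitR (C := C) : Λ → Cotensor C Λ C) :=
  Function.bijective_iff_has_inverse.2 ⟨fun k => contractR C Λ (incl k), contractR_rho,
    fun k => incl_injective (rho_contractR k)⟩

/-- The isomorphism `Λ □ C → Λ` as a morphism of left comodules. -/
def unitRInv (Λ : Bicomod D C) : LComodHom D (Cotensor C Λ C) Λ :=
  (unitRHom Λ).inverse (unitR_bijective Λ)

@[simp]
theorem unitRInv_unitR (Λ : Bicomod D C) (x : Λ) : (unitRInv Λ).lin (unitR x) = x :=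
  (unitRHom Λ).inverse_apply (unitR_bijective Λ) x

theorem unitRInv_apply (Λ : Bicomod D C) (k : Cotensor C Λ C) :
    (unitRInv Λ).lin k = contractR C Λ (incl k) := by
  obtain ⟨x, rfl⟩ := (unitR_bijective Λ).2 k
  rw [unitRInv_unitR]
  exact (contractR_rho x).symm

theorem rho_unitRInv (Λ : Bicomod D C) (k : Cotensor C Λ C) :
    rho C ((unitRInv Λ).lin k) = incl k := by
  rw [unitRInv_apply, rho_contractR]

theorem lTensor_contractL (M Λ : Type u) [AddCommGroup M] [Module A M] [AddCommGroup Λ]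
    [Module Aᵐᵒᵖ Λ] (m : M) (t : BTensor A Λ C) :
    lTensor Λ ((contractL C M).comp (tmulR A C m)) t = tmul A (contractR C Λ t) m := by
  induction t using induction_on with
  | h0 => simp [zero_tmul]
  | ht c x => exact (smul_tmul A c (C.counit x) m).symm
  | ha x y hx hy => rw [map_add, map_add, add_tmul, hx, hy]

theorem lTensor_rightSMul {M N : Type u} [AddCommGroup M] [Module A M] [AddCommGroup N]
    [Module Aᵐᵒᵖ N] {S : Type u} [Ring S] [Module Sᵐᵒᵖ M] [SMulCommClass A Sᵐᵒᵖ M] (s : Sᵐᵒᵖ)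
    (t : BTensor A N M) : lTensor N (rightSMul A M s) t = s • t := by
  induction t using induction_on with
  | h0 => simp
  | ht m n => rfl
  | ha x y hx hy => rw [map_add, smul_add, hx, hy]

variable [RFlat A C] [LFlat A C] [LFlat B D] {X : Bicomod C D} {Λ : Bicomod D C}

/-- The map `Λ ⊗ W → Λ □ (C ⊗ W)` as a morphism of left comodules. -/
def rhoTensorHom (W : Type u) [AddCommGroup W] [Module A W] (Λ : Bicomod D C) :
    LComodHom D (BTensor A Λ W) (Cotensor C Λ (BTensor A C W)) :=
  LComodHom.ofTensor (rhoTensor Λ W) (fun w => (mapRHom Λ (tmulHomL C w)).comp (unitRHom Λ))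
    rhoTensor_tmul

/-- The unit of an adjunction between cotensor functors is given by a bicolinear map. -/
theorem LeftAdjunction.unitCounit (h : LeftAdjunction X Λ)
    (hΛ : ∀ (Z : Type u) [AddCommGroup Z] [Module B Z],
      Function.Bijective (cotensorTensor (C := C) (T := B) Λ X Z)) :
    UnitCounit X Λ := by
  obtain ⟨adj⟩ := h
  let η : ∀ (M : Type u) [AddCommGroup M] [Module A M] [LComodule C M],
      LComodHom C M (Cotensor D X (Cotensor C Λ M)) := fun M _ _ _ => adj.unit.app ⟨M⟩
  let ε : ∀ (N : Type u) [AddCommGroup N] [Module B N] [LComodule D N],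
      LComodHom D (Cotensor C Λ (Cotensor D X N)) N := fun N _ _ _ => adj.counit.app ⟨N⟩
  have ηnat : ∀ {M M' : Type u} [AddCommGroup M] [Module A M] [LComodule C M]
      [AddCommGroup M'] [Module A M'] [LComodule C M'] (f : LComodHom C M M') (m : M),
      (η M').lin (f.lin m) = mapR X (mapRHom Λ f) ((η M).lin m) :=
    fun {M M'} _ _ _ _ _ _ f m =>
      congrArg (fun g : LComodHom C M (Cotensor D X (Cotensor C Λ M')) => g.lin m)
        (adj.unit.naturality (X := ⟨M⟩) (Y := ⟨M'⟩) f)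
  have εnat : ∀ {N N' : Type u} [AddCommGroup N] [Module B N] [LComodule D N]
      [AddCommGroup N'] [Module B N'] [LComodule D N'] (f : LComodHom D N N')
      (k : Cotensor C Λ (Cotensor D X N)),
      (ε N').lin (mapR Λ (mapRHom X f) k) = f.lin ((ε N).lin k) :=
    fun {N N'} _ _ _ _ _ _ f k =>
      congrArg (fun g : LComodHom D (Cotensor C Λ (Cotensor D X N)) N' => g.lin k)
        (adj.counit.naturality (X := ⟨N⟩) (Y := ⟨N'⟩) f)
  have tri1 : ∀ (M : Type u) [AddCommGroup M] [Module A M] [LComodule C M]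
      (k : Cotensor C Λ M), (ε (Cotensor C Λ M)).lin (mapR Λ (η M) k) = k := fun M _ _ _ k =>
    congrArg (fun g : LComodHom D (Cotensor C Λ M) (Cotensor C Λ M) => g.lin k)
      (adj.left_triangle_components ⟨M⟩)
  have tri2 : ∀ (N : Type u) [AddCommGroup N] [Module B N] [LComodule D N]
      (y : Cotensor D X N), mapR X (ε N) ((η (Cotensor D X N)).lin y) = y := fun N _ _ _ y =>
    congrArg (fun g : LComodHom C (Cotensor D X N) (Cotensor D X N) => g.lin y)
      (adj.right_triangle_components ⟨N⟩)
  clear_value η ε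
  -- The unit at C, read through Λ □ C ≅ Λ. Here left colinearity is given, while right linearity
  -- and right colinearity come from naturality.
  let ψ : LComodHom C C (Cotensor D X Λ) := (mapRHom X (unitRInv Λ)).comp (η C)
  have hψ : ∀ (a : Aᵐᵒᵖ) (c : C), ψ.lin (a • c) = a • ψ.lin c := fun a c => by
    have e1 := ηnat (mulRightHom C a) c
    change (η C).lin (a • c) = _ at e1
    change mapR X (unitRInv Λ) ((η C).lin (a • c)) = a • mapR X (unitRInv Λ) ((η C).lin c)
    refine incl_injective ?_
    have e2 : (unitRInv Λ).lin.comp (mapRHom Λ (mulRightHom C a)).lin =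
        (rightSMul B Λ a).comp (unitRInv Λ).lin := LinearMap.ext fun k => by
      change (unitRInv Λ).lin (mapR Λ (mulRightHom C a) k) = a • (unitRInv Λ).lin k
      rw [unitRInv_apply, unitRInv_apply, ← map_smul]
      exact congrArg _ (lTensor_rightSMul a (incl k))
    rw [e1, mapR_comp]
    change lTensor X ((unitRInv Λ).lin.comp (mapRHom Λ (mulRightHom C a)).lin) _ = _
    rw [e2, lTensor_comp_apply, lTensor_rightSMul]
    rfl
  -- Naturality along λ_M and along c ↦ c ⊗ m expresses the unit at M through ψ.
  have hη : ∀ {M : Type u} [AddCommGroup M] [Module A M] [LComodule C M] (m : M),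
      mapR X (inclHomL Λ M) ((η M).lin m) = (unitTensor ψ hψ M).lin (lam C m) :=
    fun {M} _ _ _ m => by
    let p : Cotensor C Λ (BTensor A C M) →ₗ[B] BTensor A Λ M :=
      (lTensorLin B Λ (contractL C M)).comp (inclL B)
    have e1 : p.comp (mapRHom Λ (lamHom M)).lin = inclL B := LinearMap.ext fun k => by
      change lTensor Λ (contractL C M) (lTensor Λ (lam C) (incl k)) = incl k
      rw [← lTensor_comp_apply]
      refine Eq.trans ?_ (lTensor_id_apply _)
      congr 2
      exact LinearMap.ext contractL_lam
    have e2 : ∀ t, lTensor X p (incl ((η (BTensor A C M)).lin t)) =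
        incl ((unitTensor ψ hψ M).lin t) := fun t => by
      induction t using induction_on with
      | h0 => simp only [map_zero]
      | ht c m =>
        have e3 := ηnat (tmulHomL (T := A) C m) c
        change (η (BTensor A C M)).lin (tmul A c m) = _ at e3
        have e4 : p.comp (mapRHom Λ (tmulHomL C m)).lin =
            (tmulR B Λ m).comp (unitRInv Λ).lin := LinearMap.ext fun k => by
          change lTensor Λ (contractL C M) (lTensor Λ (tmulR A C m) (incl k)) =
            tmul A ((unitRInv Λ).lin k) m
          rw [← lTensor_comp_apply, lTensor_contractL, unitRInv_apply]
        rw [e3, unitTensor_tmul, incl_mapR, incl_mapR, ← lTensor_comp_apply]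
        change lTensor X (p.comp (mapRHom Λ (tmulHomL C m)).lin) _ = _
        rw [e4, lTensor_comp_apply]
        rfl
      | ha x y hx hy => simp only [map_add, hx, hy]
    refine incl_injective ?_
    have e3 := ηnat (lamHom (C := C) M) m
    change (η (BTensor A C M)).lin (lam C m) = _ at e3
    rw [← e2, e3, incl_mapR, incl_mapR, ← lTensor_comp_apply]
    change _ = lTensor X (p.comp (mapRHom Λ (lamHom M)).lin) _
    rw [e1]
    rfl
  let ψ' : BicomodHom C C C (Cotensor D X Λ) :=
    { right :=
        { lin := { toFun := ψ.lin, map_add' := map_add _, map_smul' := hψ }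
          colin := fun c => by
            refine LFlat.injective C (inclR (C := D) (M := X) (N := Λ) A) incl_injective ?_
            rw [rho_incl]
            change _ = (assoc B X A Λ C).symm (lTensor X (rhoLin C B)
              (lTensor X (unitRInv Λ).lin (incl ((η C).lin c))))
            have e1 : (rhoLin C B).comp (unitRInv Λ).lin = inclL B :=
              LinearMap.ext (rho_unitRInv Λ)
            rw [← lTensor_comp_apply, e1]
            exact (assoc B X A Λ C).eq_symm_apply.2 (congrArg incl (hη c)).symm }
      left := ψ
      eq := fun _ => rfl }
  let ω : LComodHom D (Cotensor C Λ X) D := (ε D).comp (mapRHom Λ (unitRHom X))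
  have hω : ∀ (b : Bᵐᵒᵖ) (k : Cotensor C Λ X), ω.lin (b • k) = b • ω.lin k := fun b k => by
    have e1 := εnat (mulRightHom D b) (mapR Λ (unitRHom X) k)
    change _ = b • ω.lin k at e1
    rw [← e1]
    change (ε D).lin (mapR Λ (unitRHom X) (b • k)) = _
    congr 1
    rw [mapR_comp]
    refine incl_injective ?_
    change lTensor Λ (unitRHom X).lin (b • incl k) =
      lTensor Λ ((mapRHom X (mulRightHom D b)).lin.comp (unitRHom X).lin) (incl k)
    rw [← lTensor_rightSMul b, ← lTensor_comp_apply]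
    congr 2
    refine LinearMap.ext fun l => incl_injective ?_
    change rho D (b • l) = lTensor X (rightSMul B D b) (rho D l)
    rw [lTensor_rightSMul, map_smul]
  let ωl : Cotensor C Λ X →ₗ[Bᵐᵒᵖ] D :=
    { toFun := ω.lin, map_add' := map_add _, map_smul' := hω }
  have hε : ∀ {N : Type u} [AddCommGroup N] [Module B N] [LComodule D N]
      (k : Cotensor C Λ (Cotensor D X N)) (y : BTensor B (Cotensor C Λ X) N),
      cotensorTensor Λ X N y = mapR Λ (inclHomL X N) k →
        lam D ((ε N).lin k) = rTensor N ωl y := fun {N} _ _ _ k y hy => by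
    have e1 : (rhoTensorHom N X).comp (inclHomL X N) = mapRHom X (lamHom N) :=
      LComodHom.ext rhoTensor_incl
    have e2 := εnat (lamHom N) k
    change _ = lam D ((ε N).lin k) at e2
    rw [← e2, ← e1, ← mapR_comp, ← hy]
    clear hy
    induction y using induction_on with
    | h0 => simp only [map_zero]
    | ht z n =>
      have e3 : (rhoTensorHom N X).comp (tmulHomL X n) =
          (mapRHom X (tmulHomL D n)).comp (unitRHom X) := LComodHom.ext (rhoTensor_tmul n)
      rw [cotensorTensor_tmul, mapR_comp, e3, ← mapR_comp, εnat]
      rfl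
    | ha x y hx hy => simp only [map_add, hx, hy]
  let ω' : BicomodHom D D (Cotensor C Λ X) D :=
    { right :=
        { lin := ωl
          colin := fun z => by
            refine (hε (mapR Λ (unitRHom X) z) (rho D z) (incl_injective ?_)).symm
            rw [incl_cotensorTensor]
            refine (assoc A Λ B X D).eq_symm_apply.1 ((rho_incl Λ X z).trans ?_)
            change _ = (assoc A Λ B X D).symm
              (lTensor Λ (inclL A) (lTensor Λ (unitRHom X).lin (incl z)))
            rw [← lTensor_comp_apply]
            rfl }
      left := ω
      eq := fun _ => rfl }
  -- Now the identity on Λ is the left triangle at C and requires associativity, while the identity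
  -- on X is the right triangle at D with the unit at X as witness.
  refine ⟨ψ', ω', fun x => ?_, fun l => ⟨(η X).lin l, ?_, ?_⟩⟩
  · obtain ⟨w, hw⟩ := exists_corresponds_left (hΛ Λ).2 (hΛ (BTensor B D Λ)).1
      (mapR Λ ψ'.left (unitR x))
    refine ⟨w, hw, incl_injective ?_⟩
    have e1 : (ε Λ).lin (mapR Λ ψ (unitR x)) = x := by
      rw [← mapR_comp, εnat, tri1 C (unitR x), unitRInv_unitR]
    change rTensor Λ ωl (incl w) = lam D x
    rw [← hε _ _ hw.cotensorTensor_eq]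
    exact congrArg (lam D) e1
  · exact (corresponds_iff_left ψ' hψ _ l).2 (hη l)
  · have e1 := ηnat (unitRHom X) l
    change mapR X ((ε D).comp (mapRHom Λ (unitRHom X))) ((η X).lin l) = unitR l
    rw [← mapR_comp, ← e1]
    exact tri2 D (unitR l)

end LeftAdjunction

end AdjunctionToUnit

/-! ### Bijectivity of the comparison maps over coseparable corings. -/

section Bijectivity

variable {A : Type u} [Ring A] {B : Type u} [Ring B] {C : Coring A} {D : Coring B}

/-! ### Coseparable corings -/

section Coseparable

/-- The associativity isomorphism `(Z ⊗ Q) ⊗ P → Z ⊗ (Q ⊗ P)` as a morphism of right comodules. -/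
def assocHomR (C : Coring A) {S T : Type u} [Ring S] [Ring T] (Z Q P : Type u) [AddCommGroup Z]
    [Module Sᵐᵒᵖ Z] [AddCommGroup Q] [Module S Q] [Module Tᵐᵒᵖ Q] [SMulCommClass S Tᵐᵒᵖ Q]
    [AddCommGroup P] [Module T P] [Module Aᵐᵒᵖ P] [SMulCommClass T Aᵐᵒᵖ P] [RComodule C P]
    [RCoactLin C T P] :
    RComodHom C (BTensor T (BTensor S Z Q) P) (BTensor S Z (BTensor T Q P)) where
  lin := { toFun := assoc S Z T Q P, map_add' := map_add _, map_smul' := assoc_rsmul }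
  colin t := by
    induction t using induction_on with
    | h0 => simp only [map_zero]
    | ht y p =>
      induction y using induction_on with
      | h0 => simp only [zero_tmul, map_zero]
      | ht z q =>
        change _ = rho C (tmul S z (tmul T q p))
        rw [rho_tmul, rho_tmul, rho_tmul, ← rTensor_comp_apply, ← rTensor_comp_apply]
        rfl
      | ha x y hx hy => simp only [add_tmul, map_add, hx, hy]
    | ha x y hx hy => simp only [map_add, hx, hy]

variable [LFlat A C] [RFlat A C] (π : BicomodHom C C (BTensor A C C) C)

/-- The composite `M ⊗ C → M ⊗ (C ⊗ C) → M ⊗ C` of the coaction and `π`. -/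
def coactRetract (M : Type u) [AddCommGroup M] [Module Aᵐᵒᵖ M] [RComodule C M] :
    RComodHom C (BTensor A M C) (BTensor A M C) :=
  (lTensorHomR M π.right π.left.lin π.eq).comp
    ((assocHomR C M C C).comp (rTensorHom C (rho C)))

/-- The retraction `M ⊗ C → M` of the coaction of a right comodule `M` given by a retraction `π`
of the comultiplication. -/
def rhoRetract (M : Type u) [AddCommGroup M] [Module Aᵐᵒᵖ M] [RComodule C M] :
    RComodHom C (BTensor A M C) M :=
  RComodHom.lift (rhoHom M) rho_injective (coactRetract π M)
    (fun t => contractR C M ((coactRetract π M).lin t))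
    -- The map `coactRetract` sends m ⊗ c to m₀ ⊗ π(m₁ ⊗ c). Its image lies in M □ C because m₀ ⊗ m₁
    -- ⊗ c lies in M □ (C ⊗ C) and π is left colinear. Hence it factors through ρ_M, and contraction
    -- computes the factor.
    (fun t => rho_contractR (mapR M π.left (rhoTensor M C t)))

variable {π} {M M' N N' : Type u} [AddCommGroup M] [Module Aᵐᵒᵖ M] [RComodule C M]
  [AddCommGroup M'] [Module Aᵐᵒᵖ M'] [RComodule C M'] [AddCommGroup N] [Module A N]
  [LComodule C N] [AddCommGroup N'] [Module A N'] [LComodule C N']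

theorem rhoRetract_rho (hπ : ∀ c : C, π.left.lin (C.comul c) = c) (m : M) :
    (rhoRetract π M).lin (rho C m) = m := by
  change contractR C M (lTensor M π.left.lin (assoc A M A C C (rTensor C (rho C) (rho C m)))) = m
  have h : π.left.lin.comp C.comul = LinearMap.id := LinearMap.ext hπ
  have h1 : assoc A M A C C (rTensor C (rho C) (rho C m)) = lTensor M C.comul (rho C m) :=
    (RComodule.coassoc (C := C) m).symm
  rw [h1, ← lTensor_comp_apply, h, lTensor_id_apply, contractR_rho]

/-- Naturality of the retraction in M. Applied to f = ρ_M it also describes ρ_M after the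
retraction, as needed for co-hom functors. -/
theorem rhoRetract_rTensor (f : RComodHom C M M') (t : BTensor A M C) :
    (rhoRetract π M').lin (rTensor C f.lin t) = f.lin ((rhoRetract π M).lin t) := by
  change contractR C M' (lTensor M' π.left.lin (assoc A M' A C C (rTensor C (rho C) _))) =
    f.lin (contractR C M (lTensor M π.left.lin (assoc A M A C C (rTensor C (rho C) t))))
  rw [← contractR_rTensor]
  congr 1
  induction t using induction_on with
  | h0 => simp only [map_zero]
  | ht m c =>
    rw [rTensor_tmul, rTensor_tmul, rTensor_tmul, ← f.colin]
    induction rho C m using induction_on with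
    | h0 => simp only [map_zero, zero_tmul]
    | ht m c' => rfl
    | ha x y hx hy => simp only [map_add, add_tmul, hx, hy]
  | ha x y hx hy => simp only [map_add, hx, hy]

variable (π M N) in
/-- The retraction `M ⊗ N → M □ N` of the inclusion given by a retraction `π` of the
comultiplication. -/
def cotensorRetract : BTensor A M N →+ Cotensor C M N :=
  (mapL N (rhoRetract π M)).comp (tensorLam M N)

/-- On M □ N the map M ⊗ λ_N equals ρ_M ⊗ N, which the retraction M ⊗ C → M undoes. -/
theorem cotensorRetract_incl (hπ : ∀ c : C, π.left.lin (C.comul c) = c) (k : Cotensor C M N) :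
    cotensorRetract π M N (incl k) = k := by
  change mapL N (rhoRetract π M) (tensorLam M N (incl k)) = k
  have h : (rhoRetract π M).comp (rhoHom M) =
      { lin := LinearMap.id (R := Aᵐᵒᵖ), colin := fun _ => rTensor_id_apply _ } :=
    RComodHom.ext (rhoRetract_rho hπ)
  rw [tensorLam_incl, mapL_comp, h]
  exact incl_injective (rTensor_id_apply _)

theorem cotensorRetract_tmul (m : M) (n : N) : cotensorRetract π M N (tmul A m n) =
    mapL N ((rhoRetract π M).comp (tmulHomR C m)) (unitL n) := by
  change mapL N (rhoRetract π M) (tensorLam M N (tmul A m n)) = _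
  rw [tensorLam_tmul, mapL_comp]

theorem cotensorRetract_rTensor (f : RComodHom C M M') (t : BTensor A M N) :
    cotensorRetract π M' N (rTensor N f.lin t) = mapL N f (cotensorRetract π M N t) := by
  induction t using induction_on with
  | h0 => simp only [map_zero]
  | ht m n =>
    rw [rTensor_tmul, cotensorRetract_tmul, cotensorRetract_tmul, mapL_comp]
    congr 2
    exact RComodHom.ext fun c => rhoRetract_rTensor f (tmul A m c)
  | ha x y hx hy => simp only [map_add, hx, hy]

theorem cotensorRetract_lTensor (f : LComodHom C N N') (t : BTensor A M N) :
    cotensorRetract π M N' (lTensor M f.lin t) = mapR M f (cotensorRetract π M N t) := by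
  induction t using induction_on with
  | h0 => simp only [map_zero]
  | ht m n =>
    rw [lTensor_tmul, cotensorRetract_tmul, cotensorRetract_tmul]
    refine incl_injective ?_
    rw [incl_mapR, incl_mapL, incl_mapL, ← rTensor_lTensor]
    exact congrArg _ (f.colin n).symm
  | ha x y hx hy => simp only [map_add, hx, hy]

/-- The inclusion M □ N → M ⊗ N is split by a retraction natural in M. Naturality for the action of
S makes the splitting S-linear, so it survives Z ⊗ -; naturality for m ↦ z ⊗ m shows that it is
compatible with the splitting for Z ⊗ M. -/
theorem Coseparable.tensorCotensor_bijective (hC : Coseparable C) {S : Type u} [Ring S]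
    [Module S M] [SMulCommClass S Aᵐᵒᵖ M] [RCoactLin C S M] {Z : Type u} [AddCommGroup Z]
    [Module Sᵐᵒᵖ Z] : Function.Bijective (tensorCotensor (C := C) (S := S) M N Z) := by
  obtain ⟨π, hπ⟩ := hC
  let r : BTensor A M N →ₗ[S] Cotensor C M N :=
    { toFun := cotensorRetract π M N
      map_add' := map_add _
      map_smul' := fun s t => by
        let f : RComodHom C M M :=
          { lin := Module.toModuleEnd Aᵐᵒᵖ (S := S) M s
            colin := fun m => (rTensor_toModuleEnd s _).trans (RCoactLin.rho_smul s m).symm }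
        have h := cotensorRetract_rTensor (π := π) f t
        rw [rTensor_toModuleEnd] at h
        refine h.trans (incl_injective ?_)
        exact rTensor_toModuleEnd s _ }
  have h1 : r.comp (inclL S) = LinearMap.id := LinearMap.ext (cotensorRetract_incl hπ)
  have h2 : ∀ t, tensorCotensor M N Z (lTensor Z r t) =
      cotensorRetract π (BTensor S Z M) N ((assoc S Z A M N).symm t) := fun t => by
    induction t using induction_on with
    | h0 => simp only [map_zero]
    | ht z x =>
      rw [lTensor_tmul, tensorCotensor_tmul, assoc_symm_eq]
      exact (cotensorRetract_rTensor (tmulHomR M z) x).symm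
    | ha x y hx hy => simp only [map_add, hx, hy]
  refine Function.bijective_iff_has_inverse.2
    ⟨fun k => lTensor Z r (assoc S Z A M N (incl k)), fun y => ?_, fun k => ?_⟩
  · change lTensor Z r (assoc S Z A M N ((assoc S Z A M N).symm _)) = y
    rw [AddEquiv.apply_symm_apply, ← lTensor_comp_apply, h1, lTensor_id_apply]
  · change tensorCotensor M N Z (lTensor Z r (assoc S Z A M N (incl k))) = k
    rw [h2, AddEquiv.symm_apply_apply, cotensorRetract_incl hπ]

/-- The same argument, with naturality of the retraction in N. -/
theorem Coseparable.cotensorTensor_bijective (hC : Coseparable C) {T : Type u} [Ring T]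
    [Module Tᵐᵒᵖ N] [SMulCommClass A Tᵐᵒᵖ N] [LCoactLin C T N] {Z : Type u} [AddCommGroup Z]
    [Module T Z] : Function.Bijective (cotensorTensor (C := C) (T := T) M N Z) := by
  obtain ⟨π, hπ⟩ := hC
  let r : BTensor A M N →ₗ[Tᵐᵒᵖ] Cotensor C M N :=
    { toFun := cotensorRetract π M N
      map_add' := map_add _
      map_smul' := fun s t => by
        let f : LComodHom C N N :=
          { lin := rightSMul A N s
            colin := fun n => (lTensor_rightSMul s _).trans (LCoactLin.lam_smul s n).symm }
        have h := cotensorRetract_lTensor (π := π) f t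
        rw [lTensor_rightSMul] at h
        refine h.trans (incl_injective ?_)
        exact lTensor_rightSMul s _ }
  have h1 : r.comp (inclR T) = LinearMap.id (R := Tᵐᵒᵖ) := LinearMap.ext (cotensorRetract_incl hπ)
  have h2 : ∀ t, cotensorTensor M N Z (rTensor Z r t) =
      cotensorRetract π M (BTensor T N Z) (assoc A M T N Z t) := fun t => by
    induction t using induction_on with
    | h0 => simp only [map_zero]
    | ht x z =>
      rw [rTensor_tmul, cotensorTensor_tmul, assoc_tmul_eq]
      exact (cotensorRetract_lTensor (tmulHomL N z) x).symm
    | ha x y hx hy => simp only [map_add, hx, hy]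
  refine Function.bijective_iff_has_inverse.2
    ⟨fun k => rTensor Z r ((assoc A M T N Z).symm (incl k)), fun y => ?_, fun k => ?_⟩
  · change rTensor Z r ((assoc A M T N Z).symm (assoc A M T N Z _)) = y
    rw [AddEquiv.symm_apply_apply, ← rTensor_comp_apply, h1, rTensor_id_apply]
  · change cotensorTensor M N Z (rTensor Z r ((assoc A M T N Z).symm (incl k))) = k
    rw [h2, AddEquiv.apply_symm_apply, cotensorRetract_incl hπ]

end Coseparable

end Bijectivity

/-! ### Coflat comodules -/

section Coflat

variable {A : Type u} [Ring A] {B : Type u} [Ring B] {C : Coring A} {D : Coring B}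

section

variable [LFlat A C] [RFlat A C]

/-- λ_X has the left A-linear retraction given by the counit, and a split injection stays injective
after M ⊗ -. -/
theorem tensorLam_injective {M X : Type u} [AddCommGroup M] [Module Aᵐᵒᵖ M] [AddCommGroup X]
    [Module A X] [LComodule C X] : Function.Injective (tensorLam (C := C) M X) := fun t t' h => by
  have h1 : (contractL C X).comp (lam C) = LinearMap.id := LinearMap.ext contractL_lam
  have h2 : lTensor M (lam C) t = lTensor M (lam C) t' :=
    (assoc A M A C X).symm.injective (congrArg incl h)
  rw [← lTensor_id_apply t, ← lTensor_id_apply t', ← h1, lTensor_comp_apply, lTensor_comp_apply, h2]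

theorem rhoTensor_injective {X M : Type u} [AddCommGroup M] [Module A M] [AddCommGroup X]
    [Module Aᵐᵒᵖ X] [RComodule C X] : Function.Injective (rhoTensor (C := C) X M) :=
  fun t t' h => by
  have h1 : (contractR C X).comp (rho C) = LinearMap.id (R := Aᵐᵒᵖ) := LinearMap.ext contractR_rho
  have h2 : rTensor M (rho C) t = rTensor M (rho C) t' :=
    (assoc A X A C M).injective (congrArg incl h)
  rw [← rTensor_id_apply t, ← rTensor_id_apply t', ← h1, rTensor_comp_apply, rTensor_comp_apply, h2]

theorem tensorLam_rTensor {M M' X : Type u} [AddCommGroup M] [Module Aᵐᵒᵖ M] [AddCommGroup M']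
    [Module Aᵐᵒᵖ M'] [AddCommGroup X] [Module A X] [LComodule C X] (f : M →ₗ[Aᵐᵒᵖ] M')
    (t : BTensor A M X) :
    tensorLam (C := C) M' X (rTensor X f t) = mapL X (rTensorHom C f) (tensorLam M X t) := by
  induction t using induction_on with
  | h0 => simp only [map_zero]
  | ht m x =>
    rw [rTensor_tmul, tensorLam_tmul, tensorLam_tmul, mapL_comp]
    rfl
  | ha x y hx hy => simp only [map_add, hx, hy]

/-- M ⊗ X embeds naturally in (M ⊗ C) □ X. Since C is flat, an injection f with its cokernel yields
a short exact sequence of comodules after - ⊗ C, to which coflatness applies. -/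
theorem LCoflat.lFlat {X : Type u} [AddCommGroup X] [Module A X] [LComodule C X]
    (h : LCoflat C X) : LFlat A X :=
  LFlat.of_injective fun {M M'} _ _ _ _ f hf => by
    have h1 := (h ⟨BTensor A M C⟩ ⟨BTensor A M' C⟩ ⟨BTensor A (M' ⧸ LinearMap.range f) C⟩
      (rTensorHom C f) (rTensorHom C (LinearMap.range f).mkQ) (LFlat.injective C f hf)
      (LFlat.exact f _ (LinearMap.exact_map_mkQ_range f))
      (rTensor_surjective C _ (Submodule.mkQ_surjective _))).1
    refine Function.Injective.of_comp (f := tensorLam (C := C) M' X) ?_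
    have h3 : tensorLam M' X ∘ rTensor X f = mapL X (rTensorHom C f) ∘ tensorLam M X :=
      funext (tensorLam_rTensor f)
    rw [h3]
    exact h1.comp tensorLam_injective

theorem RCoflat.rFlat {X : Type u} [AddCommGroup X] [Module Aᵐᵒᵖ X] [RComodule C X]
    (h : RCoflat C X) : RFlat A X :=
  RFlat.of_injective fun {M M'} _ _ _ _ f hf => by
    have h1 := (h ⟨BTensor A C M⟩ ⟨BTensor A C M'⟩ ⟨BTensor A C (M' ⧸ LinearMap.range f)⟩
      (lTensorHom C f) (lTensorHom C (LinearMap.range f).mkQ) (RFlat.injective C f hf)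
      (RFlat.exact f _ (LinearMap.exact_map_mkQ_range f))
      (lTensor_surjective C _ (Submodule.mkQ_surjective _))).1
    have h2 : ∀ t, rhoTensor X M' (lTensor X f t) =
        mapR X (lTensorHom C f) (rhoTensor X M t) := fun t => by
      induction t using induction_on with
      | h0 => simp only [map_zero]
      | ht x m =>
        rw [lTensor_tmul, rhoTensor_tmul, rhoTensor_tmul, mapR_comp]
        rfl
      | ha x y hx hy => simp only [map_add, hx, hy]
    refine Function.Injective.of_comp (f := rhoTensor (C := C) X M') ?_
    have h3 : rhoTensor X M' ∘ lTensor X f = mapR X (lTensorHom C f) ∘ rhoTensor X M := funext h2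
    rw [h3]
    exact h1.comp rhoTensor_injective

variable {M N : Type u} [AddCommGroup M] [Module Aᵐᵒᵖ M] [RComodule C M] [AddCommGroup N]
  [Module A N] [LComodule C N] {S : Type u} [Ring S]

section

variable [Module S M] [SMulCommClass S Aᵐᵒᵖ M] [RCoactLin C S M]

theorem tensorCotensor_rTensor {Z Z' : Type u} [AddCommGroup Z] [Module Sᵐᵒᵖ Z] [AddCommGroup Z']
    [Module Sᵐᵒᵖ Z'] (f : Z →ₗ[Sᵐᵒᵖ] Z') (t : BTensor S Z (Cotensor C M N)) :
    tensorCotensor M N Z' (rTensor (Cotensor C M N) f t) =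
      mapL N (rTensorHom M f) (tensorCotensor M N Z t) := by
  induction t using induction_on with
  | h0 => simp only [map_zero]
  | ht z k =>
    rw [rTensor_tmul, tensorCotensor_tmul, tensorCotensor_tmul, mapL_comp]
    rfl
  | ha x y hx hy => simp only [map_add, hx, hy]

/-- Flatness of M over S makes ker p ⊗ M → F ⊗ M → Z ⊗ M a short exact sequence of comodules, so
coflatness of N applies to it. -/
theorem LCoflat.exact_mapL_rTensorHom [LFlat S M] (h : LCoflat C N) {F Z : Type u}
    [AddCommGroup F] [Module Sᵐᵒᵖ F] [AddCommGroup Z] [Module Sᵐᵒᵖ Z] (p : F →ₗ[Sᵐᵒᵖ] Z)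
    (hp : Function.Surjective p) :
    Function.Exact (mapL N (rTensorHom (C := C) M (LinearMap.ker p).subtype))
        (mapL N (rTensorHom (C := C) M p)) ∧
      Function.Surjective (mapL N (rTensorHom (C := C) M p)) :=
  (h ⟨BTensor S (LinearMap.ker p) M⟩ ⟨BTensor S F M⟩ ⟨BTensor S Z M⟩
    (rTensorHom (C := C) M (LinearMap.ker p).subtype) (rTensorHom (C := C) M p)
    (LFlat.injective M _ (Submodule.subtype_injective _))
    (LFlat.exact _ p (LinearMap.exact_subtype_ker_map p)) (rTensor_surjective M p hp)).2

/-- Both sides are right exact in Z, so the comparison with a free module mapping onto Z decides.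
For free modules the map is bijective because they are flat. -/
theorem LCoflat.tensorCotensor_bijective [LFlat S M] (h : LCoflat C N) (Z : Type u)
    [AddCommGroup Z] [Module Sᵐᵒᵖ Z] :
    Function.Bijective (tensorCotensor (C := C) (S := S) M N Z) := by
  have hs : ∀ (Z : Type u) [AddCommGroup Z] [Module Sᵐᵒᵖ Z],
      Function.Surjective (tensorCotensor (C := C) (S := S) M N Z) := fun Z _ _ k => by
    obtain ⟨k, rfl⟩ := (h.exact_mapL_rTensorHom _
      (Finsupp.linearCombination_id_surjective Sᵐᵒᵖ Z)).2 k
    obtain ⟨y, rfl⟩ := (tensorCotensor_bijective_of_flat (S := S)).2 k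
    exact ⟨_, tensorCotensor_rTensor _ y⟩
  refine ⟨(injective_iff_map_eq_zero _).2 fun y hy => ?_, hs Z⟩
  obtain ⟨y, rfl⟩ := rTensor_surjective _ _ (Finsupp.linearCombination_id_surjective Sᵐᵒᵖ Z) y
  rw [tensorCotensor_rTensor] at hy
  obtain ⟨k, hk⟩ := ((h.exact_mapL_rTensorHom _
    (Finsupp.linearCombination_id_surjective Sᵐᵒᵖ Z)).1 _).1 hy
  -- Surjectivity of the comparison map is used here for the kernel of the presentation, which is
  -- why `hs` was proved for all modules before injectivity.
  obtain ⟨w, rfl⟩ := hs _ k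
  rw [← tensorCotensor_rTensor] at hk
  rw [← (tensorCotensor_bijective_of_flat (S := S)).1 hk, ← rTensor_comp_apply]
  refine Eq.trans ?_ (rTensor_zero_apply w)
  congr 2
  exact LinearMap.ext fun z => z.2

end

section

variable [Module Sᵐᵒᵖ N] [SMulCommClass A Sᵐᵒᵖ N] [LCoactLin C S N]

theorem cotensorTensor_lTensor {Z Z' : Type u} [AddCommGroup Z] [Module S Z] [AddCommGroup Z']
    [Module S Z'] (f : Z →ₗ[S] Z') (t : BTensor S (Cotensor C M N) Z) :
    cotensorTensor M N Z' (lTensor (Cotensor C M N) f t) =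
      mapR M (lTensorHom N f) (cotensorTensor M N Z t) := by
  induction t using induction_on with
  | h0 => simp only [map_zero]
  | ht k z =>
    rw [lTensor_tmul, cotensorTensor_tmul, cotensorTensor_tmul, mapR_comp]
    rfl
  | ha x y hx hy => simp only [map_add, hx, hy]

theorem RCoflat.exact_mapR_lTensorHom [RFlat S N] (h : RCoflat C M) {F Z : Type u}
    [AddCommGroup F] [Module S F] [AddCommGroup Z] [Module S Z] (p : F →ₗ[S] Z)
    (hp : Function.Surjective p) :
    Function.Exact (mapR M (lTensorHom (C := C) N (LinearMap.ker p).subtype))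
        (mapR M (lTensorHom (C := C) N p)) ∧
      Function.Surjective (mapR M (lTensorHom (C := C) N p)) :=
  (h ⟨BTensor S N (LinearMap.ker p)⟩ ⟨BTensor S N F⟩ ⟨BTensor S N Z⟩
    (lTensorHom (C := C) N (LinearMap.ker p).subtype) (lTensorHom (C := C) N p)
    (RFlat.injective N _ (Submodule.subtype_injective _))
    (RFlat.exact _ p (LinearMap.exact_subtype_ker_map p)) (lTensor_surjective N p hp)).2

/-- The mirror argument, with a free left module mapping onto Z. -/
theorem RCoflat.cotensorTensor_bijective [RFlat S N] (h : RCoflat C M) (Z : Type u)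
    [AddCommGroup Z] [Module S Z] :
    Function.Bijective (cotensorTensor (C := C) (T := S) M N Z) := by
  have hs : ∀ (Z : Type u) [AddCommGroup Z] [Module S Z],
      Function.Surjective (cotensorTensor (C := C) (T := S) M N Z) := fun Z _ _ k => by
    obtain ⟨k, rfl⟩ := (h.exact_mapR_lTensorHom _ (Finsupp.linearCombination_id_surjective S Z)).2 k
    obtain ⟨y, rfl⟩ := (cotensorTensor_bijective_of_flat (T := S)).2 k
    exact ⟨_, cotensorTensor_lTensor _ y⟩
  refine ⟨(injective_iff_map_eq_zero _).2 fun y hy => ?_, hs Z⟩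
  obtain ⟨y, rfl⟩ := lTensor_surjective _ _ (Finsupp.linearCombination_id_surjective S Z) y
  rw [cotensorTensor_lTensor] at hy
  obtain ⟨k, hk⟩ := ((h.exact_mapR_lTensorHom _
    (Finsupp.linearCombination_id_surjective S Z)).1 _).1 hy
  obtain ⟨w, rfl⟩ := hs _ k
  rw [← cotensorTensor_lTensor] at hk
  rw [← (cotensorTensor_bijective_of_flat (T := S)).1 hk, ← lTensor_comp_apply]
  refine Eq.trans ?_ (lTensor_zero_apply w)
  congr 2
  exact LinearMap.ext fun z => z.2

end

end

end Coflat

/-! ### Quasi-finite comodules and the co-hom functor -/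

section Cohom

variable {A : Type u} [Ring A] {B : Type u} [Ring B] {C : Coring A} {D : Coring B}

section Cofree

variable (D)

/-- The forgetful functor from right comodules to right modules. -/
def forgetRight : RComod D ⥤ ModuleCat.{u} Bᵐᵒᵖ where
  obj N := ModuleCat.of Bᵐᵒᵖ N
  map f := ModuleCat.ofHom (RComodHom.lin f)

/-- The functor `- ⊗ D` from right modules to right comodules. -/
def cofreeRight : ModuleCat.{u} Bᵐᵒᵖ ⥤ RComod D where
  obj N := ⟨BTensor B N D⟩
  map f := rTensorHom D f.hom
  map_id _ := RComodHom.ext fun _ => rTensor_id_apply _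
  map_comp f g := RComodHom.ext fun _ => rTensor_comp_apply g.hom f.hom _

/-- On n ⊗ d this is the left counit law of D, with n carried along. It is one of the triangle
identities of the forgetful-cofree adjunction. -/
theorem rTensor_contractR_rho (N : Type u) [AddCommGroup N] [Module Bᵐᵒᵖ N] (t : BTensor B N D) :
    rTensor D (contractR D N) (rho D t) = t := by
  induction t using induction_on with
  | h0 => simp only [map_zero]
  | ht n d =>
    rw [rho_tmul, ← rTensor_comp_apply]
    refine (rTensor_contractR (C := D) N D n (lam D d)).trans ?_
    rw [contractL_lam]
  | ha x y hx hy => simp only [map_add, hx, hy]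

/-- The forgetful functor is left adjoint to `- ⊗ D`. -/
def forgetCofreeAdjunction : forgetRight D ⊣ cofreeRight D :=
  Adjunction.mkOfUnitCounit
    { unit :=
        { app := fun N : RComod D => rhoHom (C := D) N
          naturality := fun _ _ f => RComodHom.ext fun n => (RComodHom.colin (C := D) f n).symm }
      counit :=
        { app := fun N => ModuleCat.ofHom (contractR D N)
          naturality := fun _ _ f => ModuleCat.hom_ext (LinearMap.ext (contractR_rTensor f.hom)) }
      left_triangle := NatTrans.ext (funext fun N : RComod D =>
        ModuleCat.hom_ext (LinearMap.ext (contractR_rho (C := D) (M := N))))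
      right_triangle := NatTrans.ext (funext fun N => RComodHom.ext (rTensor_contractR_rho D N)) }

end Cofree

variable [LFlat A C] [RFlat A C] [LFlat B D] [RFlat B D] {X : Bicomod C D} {Λ : Bicomod D C}

/-- The isomorphism W ⊗ X ≅ (W ⊗ C) □ X, with inverse contracting C by the counit. -/
theorem tensorLam_bijective {W X : Type u} [AddCommGroup W] [Module Aᵐᵒᵖ W] [AddCommGroup X]
    [Module A X] [LComodule C X] : Function.Bijective (tensorLam (C := C) W X) := by
  refine ⟨tensorLam_injective, fun k => ⟨rTensor X (contractR C W) (incl k), ?_⟩⟩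
  rw [tensorLam_rTensor, tensorLam_incl, mapL_comp]
  have h : (rTensorHom C (contractR C W)).comp (rhoHom (BTensor A W C)) =
      { lin := LinearMap.id (R := Aᵐᵒᵖ), colin := fun _ => rTensor_id_apply _ } :=
    RComodHom.ext (rTensor_contractR_rho C W)
  rw [h]
  exact incl_injective (rTensor_id_apply _)

/-- The functor `- ⊗ Λ` is the composite of `- ⊗ D` and `- □ Λ`. -/
def tensorRightIso (Λ : Bicomod D C) : tensorRight Λ ≅ cofreeRight D ⋙ cotensorRight Λ :=
  NatIso.ofComponents
    (fun W =>
      { hom := tensorLamHom W Λ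
        inv := (tensorLamHom W Λ).inverse tensorLam_bijective
        hom_inv_id := RComodHom.ext
          ((tensorLamHom W Λ).inverse_apply tensorLam_bijective)
        inv_hom_id := RComodHom.ext fun k =>
          (LinearEquiv.ofBijective (tensorLamHom W Λ).lin tensorLam_bijective).apply_symm_apply k })
    (fun f => RComodHom.ext (tensorLam_rTensor f.hom))

/-- - ⊗ Λ is the cofree functor - ⊗ D followed by - □ Λ, and both are right adjoints. -/
theorem RightAdjunction.quasiFinite (h : RightAdjunction X Λ) : QuasiFinite Λ := by
  obtain ⟨adj⟩ := h
  have h1 : (cofreeRight D ⋙ cotensorRight Λ).IsRightAdjoint :=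
    ⟨_, ⟨adj.comp (forgetCofreeAdjunction D)⟩⟩
  exact Functor.isRightAdjoint_of_iso (tensorRightIso Λ).symm

theorem rightAdjunction_iff_cohomFunctorIso : RightAdjunction X Λ ↔ CohomFunctorIso X Λ :=
  ⟨fun h => ⟨h.quasiFinite, _, h, ⟨Iso.refl _⟩⟩,
    fun ⟨_, _, ⟨adj⟩, ⟨i⟩⟩ => ⟨adj.ofNatIsoLeft i.symm⟩⟩

/-- The bicomodule `X` as the value of the functor `- □ X` at `C`. -/
def bicomodIsoValue (X : Bicomod C D) : BicomodIsoValue (cotensorRight X) X where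
  iso :=
    { hom := unitLHom X
      inv := unitLInv X
      hom_inv_id := RComodHom.ext (unitLInv_unitL X)
      inv_hom_id := RComodHom.ext fun k => incl_injective (lam_unitLInv X k) }
  smul a x := incl_injective (by
    change lam C (a • x) = rTensor X (Module.toModuleEnd Aᵐᵒᵖ (S := A) C a) (lam C x)
    rw [map_smul, rTensor_toModuleEnd])
  upsilon := tensorLam C X
  upsilon_tmul c x := tensorLam_tmul c x
  colin x := tensorLam_incl (unitL x)

theorem RightAdjunction.cohomValueIso (h : RightAdjunction X Λ) : CohomValueIso X Λ :=
  ⟨h.quasiFinite, _, h, ⟨bicomodIsoValue X⟩⟩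

end Cohom

/-! ### Co-hom functors over coseparable corings -/

section CohomValue

variable {A : Type u} [Ring A] {B : Type u} [Ring B] {C : Coring A} {D : Coring B}

/-- The image of a morphism of right comodules under a functor. -/
def RComodHom.mapFunctor (F : RComod C ⥤ RComod D) {M M' : Type u} [AddCommGroup M]
    [Module Aᵐᵒᵖ M] [RComodule C M] [AddCommGroup M'] [Module Aᵐᵒᵖ M'] [RComodule C M']
    (f : RComodHom C M M') : RComodHom D (F.obj ⟨M⟩) (F.obj ⟨M'⟩) :=
  F.map (X := ⟨M⟩) (Y := ⟨M'⟩) f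

section

variable {M M' M'' : Type u} [AddCommGroup M] [Module Aᵐᵒᵖ M] [RComodule C M] [AddCommGroup M']
  [Module Aᵐᵒᵖ M'] [RComodule C M'] [AddCommGroup M''] [Module Aᵐᵒᵖ M''] [RComodule C M'']

theorem RComodHom.mapFunctor_comp (F : RComod C ⥤ RComod D) (g : RComodHom C M' M'')
    (f : RComodHom C M M') (y : F.obj ⟨M⟩) :
    (g.mapFunctor F).lin ((f.mapFunctor F).lin y) = ((g.comp f).mapFunctor F).lin y :=
  congrArg (fun h : RComodHom D (F.obj ⟨M⟩) (F.obj ⟨M''⟩) => h.lin y)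
    (F.map_comp (X := ⟨M⟩) (Y := ⟨M'⟩) (Z := ⟨M''⟩) f g).symm

theorem RComodHom.mapFunctor_of_leftInverse (F : RComod C ⥤ RComod D) (g : RComodHom C M' M)
    (f : RComodHom C M M') (h : ∀ m, g.lin (f.lin m) = m) (y : F.obj ⟨M⟩) :
    (g.mapFunctor F).lin ((f.mapFunctor F).lin y) = y := by
  rw [RComodHom.mapFunctor_comp]
  have h1 : g.comp f = 𝟙 (⟨M⟩ : RComod C) := RComodHom.ext h
  rw [h1]
  exact congrArg (fun h : RComodHom D (F.obj ⟨M⟩) (F.obj ⟨M⟩) => h.lin y) (F.map_id ⟨M⟩)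

end

variable [LFlat A C] [RFlat A C] [LFlat B D] [RFlat B D] {X : Bicomod C D} {Λ : Bicomod D C}
  {F : RComod C ⥤ RComod D} (adj : F ⊣ cotensorRight Λ)

section Adjunction

variable {M M' : Type u} [AddCommGroup M] [Module Aᵐᵒᵖ M] [RComodule C M] [AddCommGroup M']
  [Module Aᵐᵒᵖ M'] [RComodule C M'] {N : Type u} [AddCommGroup N] [Module Bᵐᵒᵖ N] [RComodule D N]

variable (M) in
/-- The unit of the adjunction of a co-hom functor. -/
def cohomUnit : RComodHom C M (Cotensor D (F.obj ⟨M⟩) Λ) := adj.unit.app ⟨M⟩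

/-- The morphism `F(M) → N` that corresponds to a morphism `M → N □ Λ`. -/
def cohomDesc (f : RComodHom C M (Cotensor D N Λ)) : RComodHom D (F.obj ⟨M⟩) N :=
  (adj.homEquiv ⟨M⟩ ⟨N⟩).symm f

theorem mapL_cohomDesc (f : RComodHom C M (Cotensor D N Λ)) (m : M) :
    mapL Λ (cohomDesc adj f) ((cohomUnit adj M).lin m) = f.lin m :=
  congrArg (fun h : RComodHom C M (Cotensor D N Λ) => h.lin m)
    (((adj.homEquiv_unit ⟨M⟩ ⟨N⟩ (cohomDesc adj f)).symm).trans
      ((adj.homEquiv ⟨M⟩ ⟨N⟩).apply_symm_apply f))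

/-- Injectivity of the adjunction bijection: a morphism out of F(M) is determined by its effect on
the unit. This replaces elementwise knowledge of F. -/
theorem cohom_hom_ext {f g : RComodHom D (F.obj ⟨M⟩) N}
    (h : ∀ m, mapL Λ f ((cohomUnit adj M).lin m) = mapL Λ g ((cohomUnit adj M).lin m))
    (y : F.obj ⟨M⟩) : f.lin y = g.lin y := by
  have h1 : f = g := (adj.homEquiv ⟨M⟩ ⟨N⟩).injective (by
    rw [adj.homEquiv_unit, adj.homEquiv_unit]
    exact RComodHom.ext h)
  rw [h1]

theorem cohomUnit_naturality (f : RComodHom C M M') (m : M) :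
    (cohomUnit adj M').lin (f.lin m) = mapL Λ (f.mapFunctor F) ((cohomUnit adj M).lin m) :=
  congrArg (fun g : RComodHom C M (Cotensor D (F.obj ⟨M'⟩) Λ) => g.lin m)
    (adj.unit.naturality (X := ⟨M⟩) (Y := ⟨M'⟩) f)

theorem rTensor_add_apply {P P' Q : Type u} [AddCommGroup P] [Module Aᵐᵒᵖ P] [AddCommGroup P']
    [Module Aᵐᵒᵖ P'] [AddCommGroup Q] [Module A Q] (f g : P →ₗ[Aᵐᵒᵖ] P') (t : BTensor A P Q) :
    rTensor Q (f + g) t = rTensor Q f t + rTensor Q g t := by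
  induction t using induction_on with
  | h0 => simp only [map_zero, add_zero]
  | ht m n => exact add_tmul A (f m) (g m) n
  | ha x y hx hy => rw [map_add, map_add, map_add, hx, hy, add_add_add_comm]

/-- A left adjoint of the additive functor - □ Λ is additive. It is needed for F(c ↦ w ⊗ c) to be
additive in w, hence for W ⊗ X → F(W ⊗ C) to exist. -/
theorem mapFunctor_add (adj : F ⊣ cotensorRight Λ) (f g h : RComodHom C M M')
    (H : ∀ m, h.lin m = f.lin m + g.lin m)
    (y : F.obj ⟨M⟩) :
    (h.mapFunctor F).lin y = (f.mapFunctor F).lin y + (g.mapFunctor F).lin y := by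
  let s : RComodHom D (F.obj ⟨M⟩) (F.obj ⟨M'⟩) :=
    { lin := (f.mapFunctor F).lin + (g.mapFunctor F).lin
      colin := fun y => by
        rw [rTensor_add_apply, RComodHom.colin, RComodHom.colin, LinearMap.add_apply, map_add] }
  refine cohom_hom_ext adj (g := s) (fun m => ?_) y
  rw [← cohomUnit_naturality, H, map_add, cohomUnit_naturality, cohomUnit_naturality]
  exact incl_injective (rTensor_add_apply _ _ _).symm

end Adjunction

variable (v : BicomodIsoValue F X)

/-- The isomorphism `X → F(C)`. -/
def valueHom : RComodHom D X (F.obj ⟨C⟩) := v.iso.hom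

/-- The isomorphism `F(C) → X`. -/
def valueInv : RComodHom D (F.obj ⟨C⟩) X := v.iso.inv

theorem valueInv_valueHom (x : X) : (valueInv v).lin ((valueHom v).lin x) = x :=
  congrArg (fun g : RComodHom D X X => g.lin x) v.iso.hom_inv_id

theorem valueHom_valueInv (y : F.obj ⟨C⟩) : (valueHom v).lin ((valueInv v).lin y) = y :=
  congrArg (fun g : RComodHom D (F.obj ⟨C⟩) (F.obj ⟨C⟩) => g.lin y) v.iso.inv_hom_id

theorem valueHom_smul (a : A) (x : X) :
    (valueHom v).lin (a • x) = ((mulLeftHom C a).mapFunctor F).lin ((valueHom v).lin x) :=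
  v.smul a x

/-- The map `C → X □ Λ` that corresponds to the isomorphism `F(C) → X`. -/
def valueUnit : RComodHom C C (Cotensor D X Λ) := (mapLHom Λ (valueInv v)).comp (cohomUnit adj C)

/-- The left action on F(C) is by definition F applied to left multiplications, so naturality of the
unit along them gives linearity. The map W ⊗ C → (W ⊗ X) □ Λ depends on this. -/
theorem valueUnit_smul (a : A) (c : C) :
    (valueUnit adj v).lin (a • c) = a • (valueUnit adj v).lin c := by
  refine incl_injective ?_
  have e1 := cohomUnit_naturality adj (mulLeftHom C a) c
  have e2 : (valueInv v).lin.comp ((mulLeftHom C a).mapFunctor F).lin =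
      (Module.toModuleEnd Bᵐᵒᵖ (S := A) X a).comp (valueInv v).lin := LinearMap.ext fun y => by
    change (valueInv v).lin (((mulLeftHom C a).mapFunctor F).lin y) = a • (valueInv v).lin y
    rw [← valueHom_valueInv v y, ← valueHom_smul, valueInv_valueHom, valueHom_valueInv]
  change rTensor Λ (valueInv v).lin (incl ((cohomUnit adj C).lin ((mulLeftHom C a).lin c))) =
    a • rTensor Λ (valueInv v).lin (incl ((cohomUnit adj C).lin c))
  rw [e1, incl_mapL, ← rTensor_comp_apply, e2, rTensor_comp_apply, rTensor_toModuleEnd]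

variable {W W' : Type u} [AddCommGroup W] [Module Aᵐᵒᵖ W] [AddCommGroup W'] [Module Aᵐᵒᵖ W']

variable (W) in
/-- The map `F(W ⊗ C) → W ⊗ X`. -/
def valueTensorInv : RComodHom D (F.obj ⟨BTensor A W C⟩) (BTensor A W X) :=
  cohomDesc adj (tensorUnit (valueUnit adj v) (valueUnit_smul adj v) W)

theorem valueTensorInv_tmulHomR (w : W) (x : X) : (valueTensorInv adj v W).lin
    (((tmulHomR (S := A) C w).mapFunctor F).lin ((valueHom v).lin x)) = tmul A w x := by
  have h := cohom_hom_ext adj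
    (f := (valueTensorInv adj v W).comp ((tmulHomR (C := C) (S := A) C w).mapFunctor F))
    (g := (tmulHomR (C := D) (S := A) X w).comp (valueInv v)) (fun c => by
      rw [← mapL_comp, ← mapL_comp, ← cohomUnit_naturality]
      refine (mapL_cohomDesc adj _ _).trans ?_
      exact tensorUnit_tmul _ _ w c) ((valueHom v).lin x)
  refine h.trans ?_
  change tmul A w ((valueInv v).lin ((valueHom v).lin x)) = _
  rw [valueInv_valueHom]

variable (W) in
/-- The map `W ⊗ X → F(W ⊗ C)`. -/
def valueTensor : RComodHom D (BTensor A W X) (F.obj ⟨BTensor A W C⟩) :=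
  RComodHom.ofTensor
    (BTensor.lift
      (fun w x => ((tmulHomR (S := A) C w).mapFunctor F).lin ((valueHom v).lin x))
      (fun w w' x => mapFunctor_add adj _ _ _ (fun c => add_tmul A w w' c) _)
      (fun w x x' => by rw [map_add, map_add])
      (fun w a x => by
        rw [valueHom_smul, RComodHom.mapFunctor_comp]
        congr 2
        exact congrArg _ (RComodHom.ext fun c => smul_tmul A w a c)))
    (fun w => ((tmulHomR (S := A) C w).mapFunctor F).comp (valueHom v)) (fun _ _ => rfl)

theorem valueTensor_tmul (w : W) (x : X) : (valueTensor adj v W).lin (tmul A w x) =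
    ((tmulHomR (S := A) C w).mapFunctor F).lin ((valueHom v).lin x) := rfl

theorem valueTensorInv_valueTensor (t : BTensor A W X) :
    (valueTensorInv adj v W).lin ((valueTensor adj v W).lin t) = t := by
  induction t using induction_on with
  | h0 => simp only [map_zero]
  | ht w x => rw [valueTensor_tmul, valueTensorInv_tmulHomR]
  | ha x y hx hy => simp only [map_add, hx, hy]

/-- With the opposite composite this gives F(W ⊗ C) ≅ W ⊗ X. The composite is compared with the
identity on the unit at W ⊗ C, hence on w ⊗ c, where naturality along c ↦ w ⊗ c reduces it to F(C) ≅
X. -/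
theorem valueTensor_valueTensorInv (y : F.obj ⟨BTensor A W C⟩) :
    (valueTensor adj v W).lin ((valueTensorInv adj v W).lin y) = y := by
  refine cohom_hom_ext adj (f := (valueTensor adj v W).comp (valueTensorInv adj v W))
    (g := 𝟙 (F.obj ⟨BTensor A W C⟩)) (fun t => ?_) y
  have e1 : mapL Λ (𝟙 (F.obj ⟨BTensor A W C⟩) : RComodHom D _ _)
      ((cohomUnit adj (BTensor A W C)).lin t) = (cohomUnit adj (BTensor A W C)).lin t :=
    incl_injective (rTensor_id_apply _)
  rw [e1, ← mapL_comp]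
  clear e1
  refine (congrArg _ (mapL_cohomDesc adj _ _)).trans ?_
  induction t using induction_on with
  | h0 => simp only [map_zero]
  | ht w c =>
    have e2 : (valueTensor adj v W).comp (tmulHomR X w) =
        ((tmulHomR (S := A) C w).mapFunctor F).comp (valueHom v) := rfl
    have e4 := cohomUnit_naturality adj (tmulHomR (C := C) (S := A) C w) c
    rw [tensorUnit_tmul, mapL_comp, e2]
    refine Eq.trans ?_ e4.symm
    change mapL Λ _ (mapL Λ (valueInv v) ((cohomUnit adj C).lin c)) = _
    rw [mapL_comp]
    refine incl_injective ?_
    rw [incl_mapL, incl_mapL]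
    congr 2
    exact LinearMap.ext fun y => congrArg _ (valueHom_valueInv v y)
  | ha x y hx hy => simp only [map_add, hx, hy]

theorem valueTensor_rTensor (f : W →ₗ[Aᵐᵒᵖ] W') (t : BTensor A W X) :
    (valueTensor adj v W').lin (rTensor X f t) =
      ((rTensorHom C f).mapFunctor F).lin ((valueTensor adj v W).lin t) := by
  induction t using induction_on with
  | h0 => simp only [map_zero]
  | ht w x =>
    rw [rTensor_tmul, valueTensor_tmul, valueTensor_tmul, RComodHom.mapFunctor_comp]
    rfl
  | ha x y hx hy => simp only [map_add, hx, hy]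

theorem valueTensorInv_mapFunctor (f : W →ₗ[Aᵐᵒᵖ] W') (y : F.obj ⟨BTensor A W C⟩) :
    (valueTensorInv adj v W').lin (((rTensorHom C f).mapFunctor F).lin y) =
      rTensor X f ((valueTensorInv adj v W).lin y) := by
  rw [← valueTensorInv_valueTensor adj v (rTensor X f _), valueTensor_rTensor,
    valueTensor_valueTensorInv]

/-- The left coaction of `X` corresponds to the comultiplication of `C`. -/
theorem valueTensor_lam (x : X) : (valueTensor adj v C).lin (lam C x) =
    ((rhoHom (C := C) C).mapFunctor F).lin ((valueHom v).lin x) := by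
  have h : ∀ t, (valueTensor adj v C).lin t = v.upsilon t := fun t => by
    induction t using induction_on with
    | h0 => exact (map_zero _).trans (map_zero v.upsilon).symm
    | ht c x => exact (v.upsilon_tmul c x).symm
    | ha x y hx hy =>
      exact (map_add _ x y).trans ((congrArg₂ (· + ·) hx hy).trans (map_add v.upsilon x y).symm)
  exact (h _).trans (v.colin x)

/-- Under F(W ⊗ C) ≅ W ⊗ X, the map W ⊗ λ_X corresponds to F applied to the coaction of W ⊗ C.
Naturality along c ↦ w ⊗ c reduces this to `valueTensor_lam`, the condition that F(C) ≅ X respects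
left coactions. -/
theorem valueTensor_assoc_lam (t : BTensor A W X) :
    (valueTensor adj v (BTensor A W C)).lin ((assoc A W A C X).symm (lTensor W (lam C) t)) =
      ((rhoHom (BTensor A W C)).mapFunctor F).lin ((valueTensor adj v W).lin t) := by
  induction t using induction_on with
  | h0 => simp only [map_zero]
  | ht w x =>
    have e : (rhoHom (C := C) (BTensor A W C)).comp (tmulHomR (S := A) C w) =
        (rTensorHom (C := C) C (tmulL A C w)).comp (rhoHom (C := C) C) :=
      RComodHom.ext fun c => rho_tmul C w c
    rw [lTensor_tmul, assoc_symm_eq, valueTensor_rTensor, valueTensor_lam, valueTensor_tmul,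
      RComodHom.mapFunctor_comp, RComodHom.mapFunctor_comp, e]
  | ha x y hx hy => simp only [map_add, hx, hy]

theorem valueTensorInv_rho (y : F.obj ⟨BTensor A W C⟩) :
    (valueTensorInv adj v (BTensor A W C)).lin (((rhoHom (BTensor A W C)).mapFunctor F).lin y) =
      (assoc A W A C X).symm (lTensor W (lam C) ((valueTensorInv adj v W).lin y)) := by
  rw [← valueTensorInv_valueTensor adj v ((assoc A W A C X).symm _), valueTensor_assoc_lam,
    valueTensor_valueTensorInv]

variable (M : Type u) [AddCommGroup M] [Module Aᵐᵒᵖ M] [RComodule C M]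

theorem rTensorHom_rho_comp_rhoHom : (rTensorHom (C := C) C (rho C)).comp (rhoHom (C := C) M) =
    (rhoHom (BTensor A M C)).comp (rhoHom M) :=
  RComodHom.ext fun m => (rhoHom (C := C) M).colin m

/-- The map `F(M) → M ⊗ X`. -/
def cohomToTensor : RComodHom D (F.obj ⟨M⟩) (BTensor A M X) :=
  (valueTensorInv adj v M).comp ((rhoHom M).mapFunctor F)

/-- Coassociativity says that ρ_M ⊗ C and the coaction of M ⊗ C agree after ρ_M. Applying F and the
isomorphism with - ⊗ X turns these two maps into ρ_M ⊗ X and M ⊗ λ_X. -/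
theorem omega_cohomToTensor (y : F.obj ⟨M⟩) :
    omega C M X ((cohomToTensor adj v M).lin y) = 0 := by
  rw [omega_apply, sub_eq_zero, ← AddEquiv.eq_symm_apply]
  change rTensor X (rho C) ((valueTensorInv adj v M).lin _) = _
  rw [← valueTensorInv_mapFunctor, RComodHom.mapFunctor_comp, rTensorHom_rho_comp_rhoHom,
    ← RComodHom.mapFunctor_comp]
  exact valueTensorInv_rho adj v _

/-- The map `F(M) → M □ X`. -/
def cohomToCotensor : RComodHom D (F.obj ⟨M⟩) (Cotensor C M X) :=
  RComodHom.lift (inclHomR M X) incl_injective (cohomToTensor adj v M)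
    (fun y => mk _ (omega_cohomToTensor adj v M y)) (fun _ => rfl)

/-- Coseparability makes ρ_M a split injection in the category of comodules, so F(ρ_M) is one too;
this gives injectivity. Naturality of the retraction produces preimages. -/
theorem cohomToCotensor_bijective (hC : Coseparable C) :
    Function.Bijective (cohomToCotensor adj v M).lin := by
  obtain ⟨π, hπ⟩ := hC
  have hs := rhoRetract_rho (M := M) hπ
  refine ⟨fun y y' h => ?_, fun k => ?_⟩
  · have h1 : (cohomToTensor adj v M).lin y = (cohomToTensor adj v M).lin y' := congrArg incl h
    have h2 := congrArg (valueTensor adj v M).lin h1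
    change (valueTensor adj v M).lin ((valueTensorInv adj v M).lin _) =
      (valueTensor adj v M).lin ((valueTensorInv adj v M).lin _) at h2
    rw [valueTensor_valueTensorInv, valueTensor_valueTensorInv] at h2
    rw [← RComodHom.mapFunctor_of_leftInverse F (rhoRetract π M) (rhoHom M) hs y, h2,
      RComodHom.mapFunctor_of_leftInverse F (rhoRetract π M) (rhoHom M) hs y']
  -- The preimage of k is its image in F(M ⊗ C) retracted to F(M). By `e1`, ρ_M after the retraction
  -- for M is the retraction for M ⊗ C after ρ_M ⊗ C. By `e2`, ρ_M ⊗ X may be replaced on k by M ⊗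
  -- λ_X, that is, by the coaction of M ⊗ C, which that retraction cancels.
  · refine ⟨((rhoRetract π M).mapFunctor F).lin ((valueTensor adj v M).lin (incl k)),
      incl_injective ?_⟩
    have e1 : (rhoHom M).comp (rhoRetract π M) =
        (rhoRetract π (BTensor A M C)).comp (rTensorHom (C := C) C (rho C)) :=
      RComodHom.ext fun t => (rhoRetract_rTensor (rhoHom M) t).symm
    have e2 : rTensor X (rho C) (incl k) = (assoc A M A C X).symm (lTensor M (lam C) (incl k)) :=
      (assoc A M A C X).eq_symm_apply.2 (sub_eq_zero.1 (omega_incl k))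
    change (valueTensorInv adj v M).lin (((rhoHom M).mapFunctor F).lin _) = incl k
    rw [RComodHom.mapFunctor_comp, e1, ← RComodHom.mapFunctor_comp, ← valueTensor_rTensor, e2,
      valueTensor_assoc_lam,
      RComodHom.mapFunctor_of_leftInverse F _ _ (rhoRetract_rho (M := BTensor A M C) hπ),
      valueTensorInv_valueTensor]

/-- Over a coseparable coring, a co-hom functor with value `X` at `C` is the cotensor product
with `X`. -/
def cohomIsoCotensor (hC : Coseparable C) : F ≅ cotensorRight X :=
  NatIso.ofComponents
    (fun M =>
      { hom := cohomToCotensor adj v M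
        inv := (cohomToCotensor adj v M).inverse (cohomToCotensor_bijective adj v M hC)
        hom_inv_id := RComodHom.ext
          ((cohomToCotensor adj v M).inverse_apply (cohomToCotensor_bijective adj v M hC))
        inv_hom_id := RComodHom.ext fun k =>
          (LinearEquiv.ofBijective _ (cohomToCotensor_bijective adj v M hC)).apply_symm_apply k })
    (fun {M M'} f => RComodHom.ext fun y => incl_injective (by
      change (valueTensorInv adj v M').lin (((rhoHom M').mapFunctor F).lin
        ((RComodHom.mapFunctor F (M := M) (M' := M') f).lin y)) =
        rTensor X (RComodHom.lin f) ((valueTensorInv adj v M).lin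
          (((rhoHom M).mapFunctor F).lin y))
      have e : (rhoHom M').comp (f : RComodHom C M M') =
          (rTensorHom (C := C) C (RComodHom.lin f)).comp (rhoHom M) :=
        RComodHom.ext fun m => (RComodHom.colin f m).symm
      rw [RComodHom.mapFunctor_comp, e, ← RComodHom.mapFunctor_comp, valueTensorInv_mapFunctor]))

theorem CohomValueIso.rightAdjunction (h : CohomValueIso X Λ) (hC : Coseparable C) :
    RightAdjunction X Λ := by
  obtain ⟨-, F, ⟨adj⟩, ⟨v⟩⟩ := h
  exact ⟨adj.ofNatIsoLeft (cohomIsoCotensor adj v hC)⟩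

end CohomValue

end

end Corings

theorem mainTheorem9 {A B : Type u} [Ring A] [Ring B] (C : Coring A) (D : Coring B)
    [LFlat A C] [RFlat A C] [LFlat B D] [RFlat B D] (X : Bicomod C D) (Λ : Bicomod D C) :
    -- (1) and (2) are equivalent and imply (3); the converse for `C` coseparable
    (RightAdjunction X Λ ↔ CohomFunctorIso X Λ) ∧
    (RightAdjunction X Λ → CohomValueIso X Λ) ∧
    (Coseparable C → CohomValueIso X Λ → RightAdjunction X Λ) ∧
    -- (4) implies (1)
    (FlatPure X Λ ∨ (Coseparable C ∧ Coseparable D) → UnitCounit X Λ → RightAdjunction X Λ) ∧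
    -- sufficient conditions for flatness and purity
    ((LCoflat C X ∧ LCoflat D Λ) ∨ (VonNeumannRegular A ∧ VonNeumannRegular B) →
      FlatPure X Λ) ∧
    -- (1) implies (4)
    ((LCoflat C X ∧ LCoflat D Λ) ∨ (VonNeumannRegular A ∧ VonNeumannRegular B) ∨
      (Coseparable C ∧ Coseparable D) → RightAdjunction X Λ → UnitCounit X Λ) ∧
    -- (1), (4) and (5) are equivalent
    ((Coseparable C ∧ Coseparable D) ∨
      ((LCoflat C X ∧ RCoflat D X) ∧ (LCoflat D Λ ∧ RCoflat C Λ)) ∨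
      (VonNeumannRegular A ∧ VonNeumannRegular B) →
      (RightAdjunction X Λ ↔ UnitCounit X Λ) ∧ (UnitCounit X Λ ↔ LeftAdjunction X Λ)) := by
  have hFP : (LCoflat C X ∧ LCoflat D Λ) ∨ (VonNeumannRegular A ∧ VonNeumannRegular B) →
      FlatPure X Λ := by
    rintro (⟨hX, hΛ⟩ | ⟨hA, hB⟩)
    -- Coflatness of Λ gives purity of ω_{X,Λ} because X is flat over A, and coflatness of X gives
    -- purity of ω_{Λ,X} because Λ is flat over B; the two instances record this flatness.
    · have := hX.lFlat
      have := hΛ.lFlat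
      exact ⟨hX.lFlat, hΛ.lFlat, lPure_omegaL_iff.2 fun Z _ _ => hΛ.tensorCotensor_bijective Z,
        lPure_omegaL_iff.2 fun Z _ _ => hX.tensorCotensor_bijective Z⟩
    · refine ⟨hA.lFlat X, hB.lFlat Λ, lPure_omegaL_iff.2 fun Z _ _ => ?_,
        lPure_omegaL_iff.2 fun Z _ _ => ?_⟩
      · have := hA.rFlat Z
        exact tensorCotensor_bijective_of_flat
      · have := hB.rFlat Z
        exact tensorCotensor_bijective_of_flat
  have h41 : FlatPure X Λ ∨ (Coseparable C ∧ Coseparable D) → UnitCounit X Λ →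
      RightAdjunction X Λ := by
    rintro (⟨hX, hΛ, -, hp⟩ | ⟨hC, -⟩) h
    -- Purity of ω_{Λ,X} controls Z ⊗ (Λ □ X). Flatness of Λ and of D ⊗ Λ over B controls (M □ X) ⊗
    -- Λ and (M □ X) ⊗ (D ⊗ Λ).
    · have := LFlat.tensor (A := B) (B := B) D Λ
      exact h.rightAdjunction (lPure_omegaL_iff.1 hp)
        (fun _ _ _ _ => cotensorTensor_bijective_of_flat)
        (fun _ _ _ _ => cotensorTensor_bijective_of_flat.1)
    · exact h.rightAdjunction (fun _ _ _ => hC.tensorCotensor_bijective)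
        (fun _ _ _ _ => hC.cotensorTensor_bijective)
        (fun _ _ _ _ => hC.cotensorTensor_bijective.1)
  have h14 : FlatPure X Λ ∨ (Coseparable C ∧ Coseparable D) → RightAdjunction X Λ →
      UnitCounit X Λ := by
    rintro (⟨-, -, -, hp⟩ | ⟨hC, -⟩) h
    · exact h.unitCounit (lPure_omegaL_iff.1 hp)
    · exact h.unitCounit fun _ _ _ => hC.tensorCotensor_bijective
  have h45 : (Coseparable C ∧ Coseparable D) ∨
      ((LCoflat C X ∧ RCoflat D X) ∧ (LCoflat D Λ ∧ RCoflat C Λ)) ∨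
      (VonNeumannRegular A ∧ VonNeumannRegular B) → (UnitCounit X Λ ↔ LeftAdjunction X Λ) := by
    rintro (⟨hC, -⟩ | ⟨⟨-, hX⟩, ⟨-, hΛ⟩⟩ | ⟨-, hB⟩)
    · exact ⟨fun h => h.leftAdjunction (fun _ _ _ => hC.cotensorTensor_bijective)
          (fun _ _ _ _ => hC.tensorCotensor_bijective)
          (fun _ _ _ _ => hC.tensorCotensor_bijective.1),
        fun h => h.unitCounit fun _ _ _ => hC.cotensorTensor_bijective⟩
    -- Coflatness of X as a right comodule makes X and X ⊗ D flat right B-modules, which controls X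
    -- ⊗ (Λ □ M). With this, coflatness of Λ as a right comodule controls (Λ □ X) ⊗ Z.
    · have := hX.rFlat
      have := RFlat.tensor (A := B) (B := B) X D
      exact ⟨fun h => h.leftAdjunction (fun Z _ _ => hΛ.cotensorTensor_bijective Z)
          (fun _ _ _ _ => tensorCotensor_bijective_of_flat)
          (fun _ _ _ _ => tensorCotensor_bijective_of_flat.1),
        fun h => h.unitCounit fun Z _ _ => hΛ.cotensorTensor_bijective Z⟩
    · have hl := fun (Z : Type u) [AddCommGroup Z] [Module B Z] => hB.lFlat Z
      have hr := hB.rFlat X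
      have := RFlat.tensor (A := B) (B := B) X D
      exact ⟨fun h => h.leftAdjunction (fun _ _ _ => cotensorTensor_bijective_of_flat)
          (fun _ _ _ _ => tensorCotensor_bijective_of_flat)
          (fun _ _ _ _ => tensorCotensor_bijective_of_flat.1),
        fun h => h.unitCounit fun _ _ _ => cotensorTensor_bijective_of_flat⟩
  have hd : (Coseparable C ∧ Coseparable D) ∨
      ((LCoflat C X ∧ RCoflat D X) ∧ (LCoflat D Λ ∧ RCoflat C Λ)) ∨
      (VonNeumannRegular A ∧ VonNeumannRegular B) →
      FlatPure X Λ ∨ (Coseparable C ∧ Coseparable D) := by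
    rintro (h | ⟨⟨hX, -⟩, ⟨hΛ, -⟩⟩ | h)
    · exact Or.inr h
    · exact Or.inl (hFP (Or.inl ⟨hX, hΛ⟩))
    · exact Or.inl (hFP (Or.inr h))
  refine ⟨rightAdjunction_iff_cohomFunctorIso, RightAdjunction.cohomValueIso,
    fun hC h => h.rightAdjunction hC, h41, hFP, ?_,
    fun h => ⟨⟨h14 (hd h), h41 (hd h)⟩, h45 h⟩⟩
  rintro (h | h | h)
  · exact h14 (Or.inl (hFP (Or.inl h)))
  · exact h14 (Or.inl (hFP (Or.inr h)))
  · exact h14 (Or.inr h)
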